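/- Fix $c>0$. For $L>0$ let $H^\infty_{\rm per}$ be the space of smooth real $L$-periodic functions, with the topology given by all the norms of $H^k_{\rm per}$, $k\ge 0$. An $L$-periodic wave with parameters $(a,b)$ is a function $\phi\in H^\infty_{\rm per}$ with fundamental period $L$ (in particular, not constant) such that $c-\phi>0$ and $$(c-\phi)^2(\phi'^2-\phi^2-b)+a=0 .$$ It is the profile of a travelling wave $u(t,x)=\phi(x-ct)$ of the Degasperis--Procesi equation $u_t-u_{txx}+4uu_x=3u_xu_{xx}+uu_{xxx}$. Put $$M(u)=\oint u\,dx,\qquad F(u)=\frac16\oint u^3\,dx,$$ $$J=-(1-\partial_x^2)^{-1}(4-\partial_x^2)\partial_x,\qquad \mathcal L=c-\phi-3c(4-\partial_x^2)^{-1},$$ and call $\phi$ spectrally stable if the spectrum of $J\mathcal L$ in the complex space $L^2_{\rm per}$ (co-periodic perturbations, with domain all $w$ such that $\mathcal Lw\in H^1_{\rm per}$) lies on $i\mathbb R$. Let $$\Gamma=\{(p(c-p)^3,\ cp-2p^2): c/4<p<c\}$$ be the boundary curve $a=a_-(b)$, $b\in(-c^2,\frac18c^2)$, in the $(a,b)$-plane,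 at which the waves become the constants $\phi=p$. There is an open neighbourhood $U$ of $\Gamma$ in the $(a,b)$-plane such that for every period $L>0$ there exist $a_L\in(0,\frac{27}{256}c^4)$, a $C^1$ map $a\mapsto b=\mathcal B_L(a)$ on $(0,a_L)$ and a $C^1$ map $a\mapsto\Phi_L(\cdot,a)\in H^\infty_{\rm per}$ on $(0,a_L)$ with the following properties, where $\mathcal M_L(a)=M(\Phi_L(\cdot,a))$ and $\mathcal F_L(a)=F(\Phi_L(\cdot,a))$. 1. For every $a\in(0,a_L)$, $\Phi_L(\cdot,a)$ is an $L$-periodic wave with parameters $(a,\mathcal B_L(a))$. As $a\to a_L^-$, the point $(a,\mathcal B_L(a))$ tends to a point $(a_L,b_L)$ of $\Gamma$. 2. Let $a\in(0,a_L)$ with $\mathcal B_L'(a)\ne0$. If $\mathcal F_L/\mathcal M_L^3$ is strictly decreasing in a neighbourhood of $a$ and, in the case $\mathcal B_L'(a)<0$, if additionally $\mathcal M_L$ is strictly increasing in a neighbourhood of $a$, then the wave $\Phi_L(\cdot,a)$ is spectrally stable. 3. For every $a\in(0,a_L)$ with $(a,\mathcal B_L(a))\in U$, the map $\mathcal F_L/\mathcal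 M_L^3$ is strictly decreasing, and $\mathcal M_L$ is strictly increasing, in a neighbourhood of $a$. In particular the criterion of part 2 is satisfied at every point near the boundary $a=a_-(b)$. -/

import Mathlib

open Set Filter Topology MeasureTheory
open scoped ENNReal ContDiff

noncomputable section

namespace DP

/-! ## Smooth periodic functions -/

/-- The space `H^∞_per` of real `L`-periodic functions all of whose derivatives are square integrable
over a period; these are the `C^∞` functions of period `L`. -/
structure HInfPer (L : ℝ) where
  /-- the function on the line -/
  toFun : ℝ → ℝ
  smooth : ContDiff ℝ ∞ toFun
  periodic : Function.Periodic toFun L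

instance (L : ℝ) : CoeFun (HInfPer L) (fun _ => ℝ → ℝ) := ⟨HInfPer.toFun⟩

/-- The norm of the Sobolev space `H^k_per`, of a smooth `L`-periodic function `u`. -/
def sobolevNorm (L : ℝ) (k : ℕ) (u : ℝ → ℝ) : ℝ :=
  Real.sqrt (∑ j ∈ Finset.range (k + 1), ∫ x in (0 : ℝ)..L, (iteratedDeriv j u x) ^ 2)

/-- `a ↦ Φ a` is a `C¹` map from the open set `I` to the Fréchet space `H^∞_per`, whose topology
is that of the norms of all `H^k_per`: the difference quotients converge in every `H^k_per` to a
derivative `Ψ a`, which depends continuously on `a` in every `H^k_per`. -/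
def IsC1HInf {L : ℝ} (I : Set ℝ) (Φ : ℝ → HInfPer L) : Prop :=
  ∃ Ψ : ℝ → HInfPer L, ∀ a ∈ I, ∀ k : ℕ,
    Tendsto (fun h => sobolevNorm L k (fun x => (Φ (a + h) x - Φ a x) / h - Ψ a x))
      (𝓝[≠] 0) (𝓝 0) ∧
    Tendsto (fun a' => sobolevNorm L k (fun x => Ψ a' x - Ψ a x)) (𝓝 a) (𝓝 0)

/-! ## Travelling waves -/

/-- `φ` is the profile of a smooth periodic wave of speed `c`, with `c - φ > 0`, with parameters
`(a, b)` in the first-order invariant `(c - φ)² (φ'² - φ² - b) + a = 0`, and with fundamental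
period `L` (no smaller positive period, so that `φ` is not constant). -/
structure IsWave (c a b L : ℝ) (φ : HInfPer L) : Prop where
  lt_speed : ∀ x, φ x < c
  invariant : ∀ x, (c - φ x) ^ 2 * ((deriv φ x) ^ 2 - (φ x) ^ 2 - b) + a = 0
  fundamental : ∀ T ∈ Ioo 0 L, ¬ Function.Periodic φ T

/-- The boundary `a = a₋(b)`, `-c² < b < c²/8`, of constant waves in the `(a, b)` plane,
parametrized by the value `p ∈ (c/4, c)` of the constant wave. -/
def constantWaveBoundary (c : ℝ) : Set (ℝ × ℝ) :=
  {q | ∃ p ∈ Ioo (c / 4) c, q = (p * (c - p) ^ 3, c * p - 2 * p ^ 2)}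

/-- The mass `M(u) = ∮ u dx`. -/
def mass {L : ℝ} (u : HInfPer L) : ℝ := ∫ x in (0 : ℝ)..L, u x

/-- The energy `F(u) = (1/6) ∮ u³ dx`. -/
def energy {L : ℝ} (u : HInfPer L) : ℝ := (1 / 6) * ∫ x in (0 : ℝ)..L, (u x) ^ 3

/-- The map `f` is strictly decreasing near the point `a`. -/
def StrictDecrNear (f : ℝ → ℝ) (a : ℝ) : Prop :=
  ∃ δ > 0, StrictAntiOn f (Ioo (a - δ) (a + δ))

/-- The map `f` is strictly increasing near the point `a`. -/
def StrictIncrNear (f : ℝ → ℝ) (a : ℝ) : Prop :=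
  ∃ δ > 0, StrictMonoOn f (Ioo (a - δ) (a + δ))

/-! ## The linearized operator in complex `L²_per` -/

section Operators

variable (L : ℝ) [Fact (0 < L)]

/-- The complex Hilbert space `L²_per` of square integrable functions of period `L`. -/
abbrev L2per : Type := Lp ℂ 2 (@AddCircle.haarAddCircle L _)

/-- The wave number `2πn/L` of the `n`-th Fourier mode. -/
def waveNumber (n : ℤ) : ℝ := 2 * Real.pi * n / L

/-- The Fourier multiplier in `L²_per` with symbol `m`, on its maximal domain: it multiplies the
`n`-th Fourier coefficient by `m n`. -/
def fourierMultiplier (m : ℤ → ℂ) : L2per L →ₗ.[ℂ] L2per L where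
  domain :=
    { carrier := {f | Memℓp (fun n => m n * fourierBasis.repr f n) 2}
      add_mem' := fun {f g} hf hg => by
        have h := Memℓp.add hf hg
        refine (congrArg (Memℓp · 2) (funext fun n => ?_)).mp h
        simp [mul_add]
      zero_mem' := by
        refine (congrArg (Memℓp · 2) (funext fun n => ?_)).mp
          (zero_memℓp : Memℓp (0 : ℤ → ℂ) 2)
        simp
      smul_mem' := fun z f hf => by
        have h := Memℓp.const_smul hf z
        refine (congrArg (Memℓp · 2) (funext fun n => ?_)).mp h
        simp [mul_left_comm] }
  toFun :=
    { toFun := fun f => fourierBasis.repr.symm ⟨fun n => m n * fourierBasis.repr f.1 n, f.2⟩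
      map_add' := fun f g => by
        refine Eq.trans (congrArg fourierBasis.repr.symm ?_) (map_add fourierBasis.repr.symm _ _)
        refine Subtype.ext (funext fun n => ?_)
        simp [mul_add]
        rfl
      map_smul' := fun z f => by
        refine Eq.trans (congrArg fourierBasis.repr.symm ?_) (map_smul fourierBasis.repr.symm _ _)
        refine Subtype.ext (funext fun n => ?_)
        simp [mul_left_comm] }

/-- The symbol `1 / (4 + k²)` of `(4 - ∂ₓ²)⁻¹`. -/
def invSymbol (n : ℤ) : ℂ := ((1 / (4 + waveNumber L n ^ 2) : ℝ) : ℂ)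

theorem mem_domain_invSymbol (f : L2per L) : f ∈ (fourierMultiplier L (invSymbol L)).domain := by
  have hb : ∀ n, ‖invSymbol L n * fourierBasis.repr f n‖ ≤ ‖fourierBasis.repr f n‖ := by
    intro n
    rw [norm_mul]
    refine mul_le_of_le_one_left (norm_nonneg _) ?_
    rw [invSymbol, Complex.norm_real, Real.norm_eq_abs, abs_of_nonneg (by positivity),
      div_le_one (by positivity)]
    nlinarith [sq_nonneg (waveNumber L n)]
  have h2 : (0 : ℝ) < (2 : ℝ≥0∞).toReal := by norm_num
  have hs := (lp.memℓp (fourierBasis.repr f)).summable h2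
  refine memℓp_gen (hs.of_nonneg_of_le (fun n => Real.rpow_nonneg (norm_nonneg _) _) fun n => ?_)
  exact Real.rpow_le_rpow (norm_nonneg _) (hb n) h2.le

/-- The bounded operator `(4 - ∂ₓ²)⁻¹` on `L²_per`. -/
def helmholtzInv : L2per L →ₗ[ℂ] L2per L :=
  (fourierMultiplier L (invSymbol L)).toFun ∘ₗ
    LinearMap.codRestrict _ LinearMap.id (mem_domain_invSymbol L)

/-- The operator `J = -(1 - ∂ₓ²)⁻¹ (4 - ∂ₓ²) ∂ₓ` in `L²_per`, with domain `H¹_per`. -/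
def opJ : L2per L →ₗ.[ℂ] L2per L :=
  fourierMultiplier L fun n =>
    -((4 + waveNumber L n ^ 2) / (1 + waveNumber L n ^ 2) * (Complex.I * waveNumber L n))

variable {L}

/-- A smooth periodic function as a continuous complex function on the circle `ℝ / Lℤ`. -/
def HInfPer.onCircle (φ : HInfPer L) : C(AddCircle L, ℂ) where
  toFun := fun x => ((φ.periodic.lift x : ℝ) : ℂ)
  continuous_toFun :=
    Complex.continuous_ofReal.comp (continuous_coinduced_dom.mpr φ.smooth.continuous)

/-- Multiplication by a continuous function on `L²_per`. -/
def mulOp (g : C(AddCircle L, ℂ)) : L2per L →ₗ[ℂ] L2per L where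
  toFun := fun w => (ContinuousMap.toLp ∞ AddCircle.haarAddCircle ℂ g) • w
  map_add' := fun v w => Lp.add_smul _ v w
  map_smul' := fun z w => (Lp.smul_comm z _ w).symm

/-- The Hessian operator `𝓛 = c - φ - 3c (4 - ∂ₓ²)⁻¹` on `L²_per`. -/
def hessian (c : ℝ) (φ : HInfPer L) : L2per L →ₗ[ℂ] L2per L :=
  mulOp (ContinuousMap.const _ (c : ℂ) - φ.onCircle) - (3 * c : ℂ) • helmholtzInv L

/-- The linearized operator `J𝓛` in `L²_per`, on the domain of all `w` with `𝓛w` in the domain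
of `J`. -/
def linearizedOp (c : ℝ) (φ : HInfPer L) : L2per L →ₗ.[ℂ] L2per L where
  domain := (opJ L).domain.comap (hessian c φ)
  toFun := (opJ L).toFun ∘ₗ
    LinearMap.codRestrict _ (hessian c φ ∘ₗ Submodule.subtype _) (fun w => w.2)

end Operators

/-- The resolvent set of an unbounded operator `T` in a normed space: the `z` for which `T - z` is
a bijection from the domain onto the space with a bounded inverse. -/
def resolventSetOf {E : Type*} [NormedAddCommGroup E] [NormedSpace ℂ E] (T : E →ₗ.[ℂ] E) : Set ℂ :=
  {z | ∃ R : E →L[ℂ] E,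
    (∀ f, ∃ h : R f ∈ T.domain, T ⟨R f, h⟩ - z • R f = f) ∧
    ∀ w : T.domain, R (T w - z • (w : E)) = w}

/-- The spectrum of an unbounded operator. -/
def spectrumOf {E : Type*} [NormedAddCommGroup E] [NormedSpace ℂ E] (T : E →ₗ.[ℂ] E) : Set ℂ :=
  (resolventSetOf T)ᶜ

/-- The wave `φ` of speed `c` is spectrally stable with respect to co-periodic perturbations: the
spectrum of `J𝓛` in `L²_per` lies on the imaginary axis. -/
def SpectrallyStable {L : ℝ} [Fact (0 < L)] (c : ℝ) (φ : HInfPer L) : Prop :=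
  spectrumOf (linearizedOp c φ) ⊆ {z | z.re = 0}

end DP

end

/-! Waves as orbits in a well. Put k = p/(c - p), where p is the constant wave at the centre, and c
- φ = c τ/(1 + k). The invariant becomes τ'² + V(τ) = r² with V = `amp`², a well with its centre at
τ = 1 and its saddle at the zero of `wellPoly`. The parameter a depends on k alone and decreases in
k, while b depends on k and r. With h = `ampInv`, the orbit is τ = h(-r cos θ), τ' = r sin θ, dx =
h'(-r cos θ) dθ. Hence the period is T(k, r) = ∮ h'(-r cos θ) dθ, and an integration by parts gives
∂T/∂r = r ∮ sin² θ h'''(-r cos θ) dθ. This is positive because h''' > 0, which reduces to the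
polynomial inequality `slopeSq₂_pos`. Since T starts at 2π/√(3k - 1) for r = 0 and takes arbitrarily
large values near the separatrix (`exists_period_gt`), each k > `kMin L` carries exactly one orbit
of period L. These orbits, labelled by a, form the curve.

Stability. An eigenvector w of J𝓛 with eigenvalue z off iℝ is orthogonal to 1 and, since Jφ² = -2cφ'
and 𝓛φ' = 0, also to φ². Moreover (𝓛w, w) = 0. If 𝓛 is nonnegative on the complement of {1, φ²},
then 𝓛w lies in span{1, φ²}, so w is a multiple of φ', so 𝓛w = 0 and w = 0
(`eq_zero_of_eigenvector`). The spectrum consists of eigenvalues, because (1 + ∂ₓ)⁻¹(J𝓛 - z) is an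
invertible multiplication times a compact perturbation of the identity.

Nonnegativity of 𝓛 under the two constraints (`hessianForm_nonneg`). Writing w = (4 - ∂ₓ²)f and
completing a square bounds (𝓛w, w) below by 3c times the Hill form ∮ f'² + (4 - 3c/(c - φ)) f². The
Hill equation has the solution (c - φ)φ' with two zeros per period, so by Picone's inequality there
are at most two negative directions. There is at most one if B' > 0, since the variation of the wave
at fixed b then gives an even solution with a favourable sign at the trough (`exists_isVariation`).
On the other side, 𝓛∂ₐφ = B'/4 and 𝓛φ = b/4 - φ²/2, so span{∂ₐφ, φ} is 𝓛-orthogonal to the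
constrained space. Its Gram determinant is B'/8 times an expression with the sign of (F/M³)'. The
criterion thus makes this plane nonpositive if B' < 0, or makes it contain a nonpositive line if B'
> 0. All possible negative directions are then used up, and the constrained form is nonnegative.

Near constant waves. Derivatives of orbit averages along T = L extend continuously to r = 0, because
the factor r in ∂/∂r cancels in the implicit derivative. The signs in part 3 are therefore computed
at r = 0 and persist in a neighbourhood. -/

noncomputable section

namespace DP

/-! ## Integrals depending smoothly on parameters -/

section Parametric

variable {E : Type} [NormedAddCommGroup E] [NormedSpace ℝ E]

/-- The partial derivative in the first variable. -/
def fderivFst {F : Type} [NormedAddCommGroup F] [NormedSpace ℝ F] (f : E × ℝ → F) (p : E × ℝ) :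
    E →L[ℝ] F :=
  (fderiv ℝ f p).comp (ContinuousLinearMap.inl ℝ E ℝ)

theorem hasFDerivAt_slice {F : Type} [NormedAddCommGroup F] [NormedSpace ℝ F] {U : Set E}
    (hU : IsOpen U) {f : E × ℝ → F} (hf : ContDiffOn ℝ ∞ f (U ×ˢ univ)) {x : E} (hx : x ∈ U)
    (t : ℝ) : HasFDerivAt (fun x => f (x, t)) (fderivFst f (x, t)) x := by
  have h1 : DifferentiableAt ℝ f (x, t) :=
    (hf.differentiableOn (by simp)).differentiableAt
      ((hU.prod isOpen_univ).mem_nhds ⟨hx, mem_univ _⟩)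
  exact h1.hasFDerivAt.comp x (hasFDerivAt_prodMk_left x t)

theorem contDiffOn_fderivFst {F : Type} [NormedAddCommGroup F] [NormedSpace ℝ F] {U : Set E}
    (hU : IsOpen U) {f : E × ℝ → F} (hf : ContDiffOn ℝ ∞ f (U ×ˢ univ)) :
    ContDiffOn ℝ ∞ (fderivFst f) (U ×ˢ univ) :=
  (hf.fderiv_of_isOpen (hU.prod isOpen_univ) (m := ∞) (by simp)).clm_comp contDiffOn_const

variable [FiniteDimensional ℝ E]

/-- Domination is automatic: the derivative in the parameter is continuous, hence bounded on a
closed ball times the interval of integration. -/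
theorem hasFDerivAt_intervalIntegral {F : Type} [NormedAddCommGroup F] [NormedSpace ℝ F]
    {U : Set E} (hU : IsOpen U) {f : E × ℝ → F} (hf : ContDiffOn ℝ ∞ f (U ×ˢ univ)) (a b : ℝ)
    {x : E} (hx : x ∈ U) :
    HasFDerivAt (fun x => ∫ t in a..b, f (x, t)) (∫ t in a..b, fderivFst f (x, t)) x := by
  have := FiniteDimensional.proper ℝ E
  obtain ⟨r, hr, hrU⟩ := Metric.nhds_basis_closedBall.mem_iff.mp (hU.mem_nhds hx)
  have hcf := contDiffOn_fderivFst hU hf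
  have hslice : ∀ {G : Type} [NormedAddCommGroup G] [NormedSpace ℝ G] {g : E × ℝ → G},
      ContDiffOn ℝ ∞ g (U ×ˢ univ) → ∀ y ∈ U, Continuous fun t => g (y, t) := by
    intro G _ _ g hg y hy
    exact hg.continuousOn.comp_continuous (by fun_prop) (fun t => ⟨hy, mem_univ _⟩)
  have hK : IsCompact (Metric.closedBall x r ×ˢ uIcc a b) :=
    (isCompact_closedBall x r).prod isCompact_uIcc
  obtain ⟨C, hC⟩ := hK.exists_bound_of_continuousOn
    (hcf.continuousOn.mono (prod_mono hrU (subset_univ _)))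
  refine intervalIntegral.hasFDerivAt_integral_of_dominated_of_fderiv_le
    (F := fun x t => f (x, t)) (F' := fun x t => fderivFst f (x, t)) (bound := fun _ => C)
    (s := Metric.closedBall x r) (Metric.closedBall_mem_nhds x hr) ?_ ?_ ?_ ?_ ?_ ?_
  · filter_upwards [hU.mem_nhds hx] with y hy
    exact (hslice hf y hy).aestronglyMeasurable
  · exact (hslice hf x hx).intervalIntegrable _ _
  · exact (hslice hcf x hx).aestronglyMeasurable
  · exact Eventually.of_forall fun t ht y hy => hC (y, t) ⟨hy, uIoc_subset_uIcc ht⟩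
  · exact intervalIntegrable_const
  · exact Eventually.of_forall fun t _ y hy => hasFDerivAt_slice hU hf (hrU hy) t

theorem contDiffOn_intervalIntegral {F : Type} [NormedAddCommGroup F] [NormedSpace ℝ F]
    {U : Set E} (hU : IsOpen U) {f : E × ℝ → F} (hf : ContDiffOn ℝ ∞ f (U ×ˢ univ)) (a b : ℝ) :
    ContDiffOn ℝ ∞ (fun x => ∫ t in a..b, f (x, t)) U := by
  -- The target space is quantified inside the induction, since the derivative is an integral with
  -- values in `E →L[ℝ] F`.
  have key : ∀ n : ℕ, ∀ (F : Type) [NormedAddCommGroup F] [NormedSpace ℝ F] (f : E × ℝ → F),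
      ContDiffOn ℝ ∞ f (U ×ˢ univ) → ContDiffOn ℝ n (fun x => ∫ t in a..b, f (x, t)) U := by
    intro n
    induction n with
    | zero =>
      intro F _ _ f hf
      exact contDiffOn_zero.mpr fun x hx =>
        (hasFDerivAt_intervalIntegral hU hf a b hx).continuousAt.continuousWithinAt
    | succ n ih =>
      intro F _ _ f hf
      have h : ContDiffOn ℝ ((n : ℕ∞ω) + 1) (fun x => ∫ t in a..b, f (x, t)) U := by
        rw [contDiffOn_succ_iff_fderiv_of_isOpen hU]
        refine ⟨fun x hx => (hasFDerivAt_intervalIntegral hU hf a b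
          hx).differentiableAt.differentiableWithinAt, by simp, ?_⟩
        exact (ih _ _ (contDiffOn_fderivFst hU hf)).congr
          fun x hx => (hasFDerivAt_intervalIntegral hU hf a b hx).fderiv
      exact_mod_cast h
  exact contDiffOn_infty.mpr fun n => key n F f hf

end Parametric

/-! ## Inverting a function of the last variable -/

section FiberInverse

variable {E : Type} [NormedAddCommGroup E] [NormedSpace ℝ E]

/-- The map `(e, t) ↦ (e, l e + m t)` with `m ≠ 0` as a linear equivalence. -/
def triangularEquiv (l : E × ℝ →L[ℝ] ℝ) (h : l (0, 1) ≠ 0) : (E × ℝ) ≃L[ℝ] (E × ℝ) :=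
  ContinuousLinearEquiv.equivOfInverse
    ((ContinuousLinearMap.fst ℝ E ℝ).prod l)
    ((ContinuousLinearMap.fst ℝ E ℝ).prod ((l (0, 1))⁻¹ •
      (ContinuousLinearMap.snd ℝ E ℝ -
        (l.comp (ContinuousLinearMap.inl ℝ E ℝ)).comp (ContinuousLinearMap.fst ℝ E ℝ))))
    (fun p => by
      have h2 : l p = l (p.1, 0) + p.2 * l (0, 1) := by
        rw [← smul_eq_mul, ← map_smul, ← map_add]
        simp
      refine Prod.ext rfl ?_
      simp [h2]
      field_simp)
    (fun p => by
      have h2 : ∀ q : E × ℝ, l q = l (q.1, 0) + q.2 * l (0, 1) := by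
        intro q
        rw [← smul_eq_mul, ← map_smul, ← map_add]
        simp
      refine Prod.ext rfl ?_
      simp only [ContinuousLinearMap.prod_apply]
      rw [h2]
      simp
      field_simp
      ring)

variable [CompleteSpace E]

/-- The inverse function theorem for (e, t) ↦ (e, f(e, t)), whose differential is triangular.
Injectivity on fibres glues the local inverses. It yields the inverse amplitude, the angle, the
radius of given period and k as a function of a, each smooth jointly with its parameters. -/
theorem exists_fiber_inverse {Ω : Set (E × ℝ)} (hΩ : IsOpen Ω) {f : E × ℝ → ℝ}
    (hf : ContDiffOn ℝ ∞ f Ω) (hd : ∀ p ∈ Ω, fderiv ℝ f p (0, 1) ≠ 0)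
    (hinj : ∀ e t t', (e, t) ∈ Ω → (e, t') ∈ Ω → f (e, t) = f (e, t') → t = t') :
    IsOpen ((fun p : E × ℝ => (p.1, f p)) '' Ω) ∧ ∃ g : E × ℝ → ℝ,
      ContDiffOn ℝ ∞ g ((fun p : E × ℝ => (p.1, f p)) '' Ω) ∧ ∀ p ∈ Ω, g (p.1, f p) = p.2 := by
  set F : E × ℝ → E × ℝ := fun p => (p.1, f p) with hF
  have hFinj : InjOn F Ω := by
    rintro ⟨e, t⟩ hp ⟨e', t'⟩ hp' h
    simp only [hF, Prod.mk.injEq] at h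
    obtain ⟨rfl, h⟩ := h
    rw [hinj e t t' hp hp' h]
  have hFc : ∀ p ∈ Ω, ContDiffAt ℝ ∞ F p := fun p hp =>
    contDiffAt_fst.prodMk (hf.contDiffAt (hΩ.mem_nhds hp))
  have hFd : ∀ p (hp : p ∈ Ω), HasFDerivAt F
      (triangularEquiv (fderiv ℝ f p) (hd p hp) : E × ℝ →L[ℝ] E × ℝ) p := by
    intro p hp
    exact hasFDerivAt_fst.prodMk ((hf.contDiffAt (hΩ.mem_nhds hp)).differentiableAt
      (by simp)).hasFDerivAt
  have hopen : IsOpen (F '' Ω) := by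
    rw [isOpen_iff_mem_nhds]
    rintro _ ⟨p, hp, rfl⟩
    have h1 := (hFc p hp).hasStrictFDerivAt' (hFd p hp) (by simp)
    rw [← h1.map_nhds_eq_of_equiv]
    exact image_mem_map (hΩ.mem_nhds hp)
  refine ⟨hopen, fun q => (Function.invFunOn F Ω q).2, ?_, ?_⟩
  · rintro _ ⟨p, hp, rfl⟩
    refine ContDiffAt.contDiffWithinAt ?_
    have h1 := (hFc p hp).hasStrictFDerivAt' (hFd p hp) (by simp)
    have h2 := (hFc p hp).to_localInverse (hFd p hp) (by simp)
    refine (contDiffAt_snd.comp (F p) h2).congr_of_eventuallyEq ?_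
    have h3 : ∀ᶠ q in 𝓝 (F p), F (h1.localInverse F _ p q) = q := h1.eventually_right_inverse
    have h4 : ∀ᶠ q in 𝓝 (F p), h1.localInverse F _ p q ∈ Ω := by
      refine h1.localInverse_continuousAt.eventually_mem ?_
      rw [h1.localInverse_apply_image]
      exact hΩ.mem_nhds hp
    filter_upwards [h3, h4] with q hq hq'
    have h5 : q ∈ F '' Ω := ⟨_, hq', hq⟩
    -- Global injectivity identifies the chosen inverse with the smooth local one.
    have := hFinj (Function.invFunOn_mem h5) hq' ((Function.invFunOn_eq h5).trans hq.symm)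
    simp only [this, Function.comp]
    rfl
  · intro p hp
    have h5 : F p ∈ F '' Ω := ⟨_, hp, rfl⟩
    have := hFinj (Function.invFunOn_mem h5) hp (Function.invFunOn_eq h5)
    exact congrArg Prod.snd this

end FiberInverse

/-! ## Directional derivatives -/

section Directional

variable {E : Type} [NormedAddCommGroup E] [NormedSpace ℝ E]

/-- The derivative of `G` in the direction `v`. -/
def dirDeriv (v : E) (G : E → ℝ) (p : E) : ℝ := fderiv ℝ G p v

theorem contDiffOn_dirDeriv {Ω : Set E} (hΩ : IsOpen Ω) {G : E → ℝ} (hG : ContDiffOn ℝ ∞ G Ω)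
    (v : E) : ContDiffOn ℝ ∞ (dirDeriv v G) Ω :=
  (hG.fderiv_of_isOpen hΩ (m := ∞) (by simp)).clm_apply contDiffOn_const

theorem dirDeriv_comm {Ω : Set E} (hΩ : IsOpen Ω) {G : E → ℝ} (hG : ContDiffOn ℝ ∞ G Ω)
    (v w : E) {p : E} (hp : p ∈ Ω) :
    dirDeriv v (dirDeriv w G) p = dirDeriv w (dirDeriv v G) p := by
  have h1 : ContDiffAt ℝ ∞ G p := hG.contDiffAt (hΩ.mem_nhds hp)
  have h2 : IsSymmSndFDerivAt ℝ G p := h1.isSymmSndFDerivAt (by simp; exact WithTop.coe_le_coe.mpr (le_top : (2 : ℕ∞) ≤ ⊤))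
  have h3 : DifferentiableAt ℝ (fderiv ℝ G) p :=
    (h1.fderiv_right (m := ∞) (by simp)).differentiableAt (by simp)
  have h4 : ∀ u : E, fderiv ℝ (dirDeriv u G) p = (fderiv ℝ (fderiv ℝ G) p).flip u := by
    intro u
    have := h3.hasFDerivAt.clm_apply (hasFDerivAt_const u p)
    rw [show dirDeriv u G = fun y => fderiv ℝ G y u from rfl, this.fderiv]
    simp
  rw [dirDeriv, h4, dirDeriv, h4]
  exact h2 v w

theorem dirDeriv_congr {Ω : Set E} (hΩ : IsOpen Ω) {G H : E → ℝ} (h : EqOn G H Ω) (v : E) :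
    EqOn (dirDeriv v G) (dirDeriv v H) Ω := by
  intro p hp
  rw [dirDeriv, dirDeriv, (h.eventuallyEq_of_mem (hΩ.mem_nhds hp)).fderiv_eq]

theorem hasDerivAt_comp_curve {Ω : Set E} (hΩ : IsOpen Ω) {G : E → ℝ} (hG : ContDiffOn ℝ ∞ G Ω)
    {γ : ℝ → E} {v : E} {t : ℝ} (hγ : HasDerivAt γ v t) (ht : γ t ∈ Ω) :
    HasDerivAt (fun s => G (γ s)) (dirDeriv v G (γ t)) t :=
  ((hG.contDiffAt (hΩ.mem_nhds ht)).differentiableAt (by simp)).hasFDerivAt.comp_hasDerivAt t hγ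

theorem dirDeriv_add (v w : E) (G : E → ℝ) (p : E) :
    dirDeriv (v + w) G p = dirDeriv v G p + dirDeriv w G p := map_add _ _ _

theorem dirDeriv_smul (r : ℝ) (v : E) (G : E → ℝ) (p : E) :
    dirDeriv (r • v) G p = r * dirDeriv v G p := map_smul _ _ _

end Directional

/-! ## The Picone inequality -/

section Picone

variable {V y y₁ f f₁ : ℝ → ℝ}

/-- The function ∫ (f'² + V f²) - y' f²/y has derivative (f' - y' f/y)² ≥ 0. Only one-sided limits
of the boundary term are assumed, so that y may vanish at the ends. -/
theorem picone_le_integral {α β : ℝ} (hαβ : α < β) (hV : Continuous V)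
    (hy : ∀ x, HasDerivAt y (y₁ x) x) (hy₁ : ∀ x, HasDerivAt y₁ (V x * y x) x)
    (hne : ∀ x ∈ Ioo α β, y x ≠ 0) (hf : ∀ x, HasDerivAt f (f₁ x) x) (hf₁ : Continuous f₁)
    {A B : ℝ} (hA : Tendsto (fun x => y₁ x * f x ^ 2 / y x) (𝓝[>] α) (𝓝 A))
    (hB : Tendsto (fun x => y₁ x * f x ^ 2 / y x) (𝓝[<] β) (𝓝 B)) :
    B - A ≤ ∫ x in α..β, (f₁ x ^ 2 + V x * f x ^ 2) := by
  have hfc : Continuous f := continuous_iff_continuousAt.mpr fun x => (hf x).continuousAt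
  have hgc : Continuous fun x => f₁ x ^ 2 + V x * f x ^ 2 := by fun_prop
  set I : ℝ → ℝ := fun x => ∫ t in α..x, (f₁ t ^ 2 + V t * f t ^ 2)
  have hI : ∀ x, HasDerivAt I (f₁ x ^ 2 + V x * f x ^ 2) x := fun x =>
    (hgc.integral_hasStrictDerivAt α x).hasDerivAt
  have hIc : Continuous I := continuous_iff_continuousAt.mpr fun x => (hI x).continuousAt
  set G : ℝ → ℝ := fun x => I x - y₁ x * f x ^ 2 / y x
  have hG : ∀ x ∈ Ioo α β, HasDerivAt G ((f₁ x - y₁ x / y x * f x) ^ 2) x := by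
    intro x hx
    have h0 := hne x hx
    have h := (hI x).sub (((hy₁ x).mul ((hf x).pow 2)).div (hy x) h0)
    refine h.congr_deriv ?_
    simp only [Pi.mul_apply, Pi.pow_apply]
    field_simp
    ring
  have hmono : MonotoneOn G (Ioo α β) := by
    refine monotoneOn_of_deriv_nonneg (convex_Ioo α β)
      (fun x hx => (hG x hx).continuousAt.continuousWithinAt) ?_ ?_
    · rw [interior_Ioo]
      exact fun x hx => (hG x hx).differentiableAt.differentiableWithinAt
    · rw [interior_Ioo]
      intro x hx
      rw [(hG x hx).deriv]
      positivity
  have hα : Tendsto G (𝓝[>] α) (𝓝 (I α - A)) :=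
    (hIc.continuousAt.tendsto.mono_left nhdsWithin_le_nhds).sub hA
  have hβ : Tendsto G (𝓝[<] β) (𝓝 (I β - B)) :=
    (hIc.continuousAt.tendsto.mono_left nhdsWithin_le_nhds).sub hB
  have h0 : I α = 0 := intervalIntegral.integral_same
  have h1 : ∀ x ∈ Ioo α β, I α - A ≤ G x := by
    intro x hx
    refine le_of_tendsto hα ?_
    filter_upwards [Ioo_mem_nhdsGT hx.1] with z hz
    exact hmono ⟨hz.1, hz.2.trans hx.2⟩ hx hz.2.le
  have h2 : I α - A ≤ I β - B := by
    refine ge_of_tendsto hβ ?_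
    filter_upwards [Ioo_mem_nhdsLT hαβ] with z hz
    exact h1 z hz
  rw [h0] at h2
  change B - A ≤ I β
  linarith

/-- The zero of y is simple and f² vanishes to second order there, so the quotient still tends to 0.
-/
theorem tendsto_picone_of_zero {α : ℝ} (hy : HasDerivAt y (y₁ α) α) (hy₁ : ContinuousAt y₁ α)
    (hf : HasDerivAt f (f₁ α) α) (hyα : y α = 0) (hne : y₁ α ≠ 0) (hfα : f α = 0) :
    Tendsto (fun x => y₁ x * f x ^ 2 / y x) (𝓝[≠] α) (𝓝 0) := by
  have h1 := hasDerivAt_iff_tendsto_slope.mp hy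
  have h2 := hasDerivAt_iff_tendsto_slope.mp hf
  have h3 : Tendsto f (𝓝[≠] α) (𝓝 0) := by
    have := hf.continuousAt.tendsto.mono_left (nhdsWithin_le_nhds (s := {α}ᶜ))
    rwa [hfα] at this
  have h4 := ((hy₁.tendsto.mono_left (nhdsWithin_le_nhds (s := {α}ᶜ))).mul h3).mul (h2.div h1 hne)
  rw [mul_zero, zero_mul] at h4
  refine h4.congr' ?_
  filter_upwards [self_mem_nhdsWithin] with x hx
  have hx' : x - α ≠ 0 := sub_ne_zero.mpr hx
  simp only [slope_def_field, hyα, hfα, sub_zero, Pi.div_apply]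
  rw [div_div_div_cancel_right₀ hx']
  ring

theorem tendsto_picone_of_ne {α : ℝ} (hy : ContinuousAt y α) (hy₁ : ContinuousAt y₁ α)
    (hf : ContinuousAt f α) (hne : y α ≠ 0) (s : Set ℝ) :
    Tendsto (fun x => y₁ x * f x ^ 2 / y x) (𝓝[s] α) (𝓝 (y₁ α * f α ^ 2 / y α)) :=
  (((hy₁.mul (hf.pow 2)).div hy hne).tendsto).mono_left nhdsWithin_le_nhds

end Picone

/-! ## Curves in `H^∞_per` -/

section Frechet

/-- Uniform smallness of each derivative on one period controls every Sobolev norm. -/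
theorem tendsto_sobolevNorm_zero {L : ℝ} (hL : 0 < L) {l : Filter ℝ} {k : ℕ} {u : ℝ → ℝ → ℝ}
    (h : ∀ j ≤ k, ∀ ε > 0, ∀ᶠ s in l, ∀ x ∈ Icc 0 L, |iteratedDeriv j (u s) x| ≤ ε) :
    Tendsto (fun s => sobolevNorm L k (u s)) l (𝓝 0) := by
  have h1 : ∀ j ≤ k, Tendsto (fun s => ∫ x in (0 : ℝ)..L, (iteratedDeriv j (u s) x) ^ 2) l
      (𝓝 0) := by
    intro j hj
    rw [Metric.tendsto_nhds]
    intro ε hε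
    have hδ : 0 < Real.sqrt (ε / (2 * L)) := Real.sqrt_pos.mpr (by positivity)
    filter_upwards [h j hj _ hδ] with s hs
    rw [Real.dist_eq, sub_zero, ← Real.norm_eq_abs]
    refine (intervalIntegral.norm_integral_le_of_norm_le_const (C := ε / (2 * L)) ?_).trans_lt ?_
    · intro x hx
      rw [uIoc_of_le hL.le] at hx
      have := hs x ⟨hx.1.le, hx.2⟩
      rw [Real.norm_eq_abs, abs_pow]
      calc _ ≤ Real.sqrt (ε / (2 * L)) ^ 2 := by gcongr
        _ = _ := Real.sq_sqrt (by positivity)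
    · rw [sub_zero, abs_of_pos hL]
      field_simp
      linarith
  have h2 : Tendsto (fun s => ∑ j ∈ Finset.range (k + 1),
      ∫ x in (0 : ℝ)..L, (iteratedDeriv j (u s) x) ^ 2) l (𝓝 0) := by
    have := tendsto_finsetSum (Finset.range (k + 1)) fun j hj =>
      h1 j (by simpa [Nat.lt_succ_iff] using hj)
    simpa using this
  have := (Real.continuous_sqrt.tendsto 0).comp h2
  rwa [Real.sqrt_zero] at this

variable {I : Set ℝ} {G : ℝ × ℝ → ℝ}

theorem hasDerivAt_fst_dirDeriv (hI : IsOpen I) (hG : ContDiffOn ℝ ∞ G (I ×ˢ univ)) {a : ℝ}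
    (ha : a ∈ I) (x : ℝ) : HasDerivAt (fun s => G (s, x)) (dirDeriv (1, 0) G (a, x)) a :=
  hasDerivAt_comp_curve (γ := fun s => (s, x)) (hI.prod isOpen_univ) hG
    ((hasDerivAt_id a).prodMk (hasDerivAt_const a x)) ⟨ha, mem_univ _⟩

theorem hasDerivAt_snd_dirDeriv (hI : IsOpen I) (hG : ContDiffOn ℝ ∞ G (I ×ˢ univ)) {a : ℝ}
    (ha : a ∈ I) (x : ℝ) : HasDerivAt (fun s => G (a, s)) (dirDeriv (0, 1) G (a, x)) x :=
  hasDerivAt_comp_curve (γ := fun s => (a, s)) (hI.prod isOpen_univ) hG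
    ((hasDerivAt_const x a).prodMk (hasDerivAt_id x)) ⟨ha, mem_univ _⟩

/-- The iterated derivative in the last variable. -/
def iterDirDeriv (G : ℝ × ℝ → ℝ) (j : ℕ) : ℝ × ℝ → ℝ := (dirDeriv (0, 1))^[j] G

theorem iterDirDeriv_succ (j : ℕ) : iterDirDeriv G (j + 1) = dirDeriv (0, 1) (iterDirDeriv G j) :=
  Function.iterate_succ_apply' _ _ _

theorem contDiffOn_iterDirDeriv (hI : IsOpen I) (hG : ContDiffOn ℝ ∞ G (I ×ˢ univ)) (j : ℕ) :
    ContDiffOn ℝ ∞ (iterDirDeriv G j) (I ×ˢ univ) := by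
  induction j with
  | zero => exact hG
  | succ j ih =>
    rw [iterDirDeriv_succ]
    exact contDiffOn_dirDeriv (hI.prod isOpen_univ) ih _

theorem iterDirDeriv_comm (hI : IsOpen I) (hG : ContDiffOn ℝ ∞ G (I ×ˢ univ)) (j : ℕ) :
    EqOn (iterDirDeriv (dirDeriv (1, 0) G) j) (dirDeriv (1, 0) (iterDirDeriv G j))
      (I ×ˢ univ) := by
  induction j with
  | zero => exact fun _ _ => rfl
  | succ j ih =>
    intro p hp
    rw [iterDirDeriv_succ, iterDirDeriv_succ, dirDeriv_congr (hI.prod isOpen_univ) ih _ hp]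
    exact dirDeriv_comm (hI.prod isOpen_univ) (contDiffOn_iterDirDeriv hI hG j) _ _ hp

theorem eventually_abs_sub_le (hI : IsOpen I) (hG : ContDiffOn ℝ ∞ G (I ×ˢ univ)) {a : ℝ}
    (ha : a ∈ I) (L : ℝ) {ε : ℝ} (hε : 0 < ε) :
    ∀ᶠ s in 𝓝 a, ∀ x ∈ Icc 0 L, |G (s, x) - G (a, x)| ≤ ε := by
  refine IsCompact.eventually_forall_of_forall_eventually isCompact_Icc fun x _ => ?_
  have h1 : ContinuousAt (fun z : ℝ × ℝ => G z - G (a, z.2)) (a, x) := by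
    have hc : ∀ z ∈ I ×ˢ (univ : Set ℝ), ContinuousAt G z := fun z hz =>
      hG.continuousOn.continuousAt ((hI.prod isOpen_univ).mem_nhds hz)
    exact (hc _ ⟨ha, mem_univ _⟩).sub
      (ContinuousAt.comp (f := fun z : ℝ × ℝ => (a, z.2)) (hc _ ⟨ha, mem_univ _⟩) (by fun_prop))
  have h2 := h1.tendsto.eventually (Metric.ball_mem_nhds _ hε)
  filter_upwards [h2] with z hz
  simp only [sub_self, dist_zero_right, Real.norm_eq_abs] at hz
  exact hz.le

/-- The mean value inequality applied to s ↦ G(s, x) - s ∂ₐG(a, x), whose derivative is small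
uniformly in x by compactness of the period. -/
theorem eventually_slope_sub_le (hI : IsOpen I) (hG : ContDiffOn ℝ ∞ G (I ×ˢ univ)) {a : ℝ}
    (ha : a ∈ I) (L : ℝ) {ε : ℝ} (hε : 0 < ε) :
    ∀ᶠ h in 𝓝[≠] (0 : ℝ), ∀ x ∈ Icc 0 L,
      |(G (a + h, x) - G (a, x)) / h - dirDeriv (1, 0) G (a, x)| ≤ ε := by
  have h1 := (eventually_abs_sub_le hI (contDiffOn_dirDeriv (hI.prod isOpen_univ) hG (1, 0)) ha L
    hε).and (hI.mem_nhds ha)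
  obtain ⟨r, hr, hr'⟩ := Metric.eventually_nhds_iff_ball.mp h1
  filter_upwards [nhdsWithin_le_nhds (Metric.ball_mem_nhds (0 : ℝ) hr), self_mem_nhdsWithin]
    with h hh hne x hx
  have hne' : h ≠ 0 := hne
  have h2 : ∀ s ∈ Metric.ball a r, HasDerivWithinAt
      (fun s => G (s, x) - s * dirDeriv (1, 0) G (a, x))
      (dirDeriv (1, 0) G (s, x) - 1 * dirDeriv (1, 0) G (a, x)) (Metric.ball a r) s := fun s hs =>
    ((hasDerivAt_fst_dirDeriv hI hG (hr' s hs).2 x).sub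
      ((hasDerivAt_id s).mul_const _)).hasDerivWithinAt
  have h3 := (convex_ball a r).norm_image_sub_le_of_norm_hasDerivWithin_le h2
    (fun s hs => by rw [one_mul]; exact (hr' s hs).1 x hx) (Metric.mem_ball_self hr)
    (show a + h ∈ Metric.ball a r by simpa using hh)
  have h4 : (G (a + h, x) - G (a, x)) / h - dirDeriv (1, 0) G (a, x) =
      (G (a + h, x) - (a + h) * dirDeriv (1, 0) G (a, x)
        - (G (a, x) - a * dirDeriv (1, 0) G (a, x))) / h := by
    field_simp
    ring
  rw [h4, abs_div, div_le_iff₀ (abs_pos.mpr hne')]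
  simpa using h3

variable {L : ℝ} {Φ Ψ : ℝ → HInfPer L}

/-- Joint smoothness in (a, x) suffices: partial derivatives commute, so each x-derivative of the
difference quotient is the difference quotient of an x-derivative, and the uniform estimates apply
to it. -/
theorem isC1HInf_of_contDiffOn (hL : 0 < L) (hI : IsOpen I) (hG : ContDiffOn ℝ ∞ G (I ×ˢ univ))
    (hΦ : ∀ a ∈ I, ∀ x, Φ a x = G (a, x))
    (hΨ : ∀ a ∈ I, ∀ x, Ψ a x = dirDeriv (1, 0) G (a, x)) : IsC1HInf I Φ := by
  refine ⟨Ψ, fun a ha k => ⟨?_, ?_⟩⟩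
  · refine tendsto_sobolevNorm_zero hL fun j hj ε hε => ?_
    have hmem : ∀ᶠ h in 𝓝[≠] (0 : ℝ), a + h ∈ I := by
      refine nhdsWithin_le_nhds ((continuous_const_add a).continuousAt.eventually_mem ?_)
      simpa using hI.mem_nhds ha
    filter_upwards [eventually_slope_sub_le hI (contDiffOn_iterDirDeriv hI hG j) ha L hε, hmem]
      with h hh hm x hx
    have : iteratedDeriv j (fun x => (Φ (a + h) x - Φ a x) / h - Ψ a x) = fun x =>
        (iterDirDeriv G j (a + h, x) - iterDirDeriv G j (a, x)) / h -
          dirDeriv (1, 0) (iterDirDeriv G j) (a, x) := by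
      have hG1 := contDiffOn_dirDeriv (hI.prod isOpen_univ) hG (1, 0)
      -- The induction leaves ∂ₐ innermost; it is exchanged with ∂ₓʲ only afterwards.
      have key : iteratedDeriv j (fun x => (Φ (a + h) x - Φ a x) / h - Ψ a x) = fun x =>
        (iterDirDeriv G j (a + h, x) - iterDirDeriv G j (a, x)) / h -
          iterDirDeriv (dirDeriv (1, 0) G) j (a, x) := by
        clear hh hj
        induction j with
        | zero =>
          rw [iteratedDeriv_zero]
          funext x
          rw [hΦ _ hm, hΦ _ ha, hΨ _ ha]
          rfl
        | succ j ih =>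
          rw [iteratedDeriv_succ, ih]
          simp only [iterDirDeriv_succ]
          funext x
          have hc := contDiffOn_iterDirDeriv hI hG j
          exact ((((hasDerivAt_snd_dirDeriv hI hc hm x).sub
            (hasDerivAt_snd_dirDeriv hI hc ha x)).div_const h).sub
            (hasDerivAt_snd_dirDeriv hI (contDiffOn_iterDirDeriv hI hG1 j) ha x)).deriv
      rw [key]
      funext x
      rw [iterDirDeriv_comm hI hG j ⟨ha, mem_univ _⟩]
    rw [this]
    exact hh x hx
  · refine tendsto_sobolevNorm_zero hL fun j hj ε hε => ?_
    have hG1 := contDiffOn_dirDeriv (hI.prod isOpen_univ) hG (1, 0)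
    filter_upwards [eventually_abs_sub_le hI (contDiffOn_iterDirDeriv hI hG1 j) ha L hε,
      hI.mem_nhds ha] with s hs hm x hx
    have : iteratedDeriv j (fun x => Ψ s x - Ψ a x) = fun x =>
        iterDirDeriv (dirDeriv (1, 0) G) j (s, x) - iterDirDeriv (dirDeriv (1, 0) G) j (a, x) := by
      clear hs hj
      induction j with
      | zero =>
        rw [iteratedDeriv_zero]
        funext x
        rw [hΨ _ hm, hΨ _ ha]
        rfl
      | succ j ih =>
        rw [iteratedDeriv_succ, ih]
        simp only [iterDirDeriv_succ]
        funext x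
        have hc := contDiffOn_iterDirDeriv hI hG1 j
        exact ((hasDerivAt_snd_dirDeriv hI hc hm x).sub
          (hasDerivAt_snd_dirDeriv hI hc ha x)).deriv
    rw [this]
    exact hs x hx

end Frechet

/-! ## The amplitude coordinate -/

/-- The polynomial `D` whose positivity describes the potential well. -/
def wellPoly (k t : ℝ) : ℝ := k * (1 + t + t ^ 2) - t ^ 3

/-- The cofactor of `(1 - t)² / t²` in the potential. -/
def wellFactor (k t : ℝ) : ℝ := k + 2 * k * t - t ^ 2

/-- The pairs `(k, t)` with `t` in the potential well with parameter `k`. -/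
def wellDomain : Set (ℝ × ℝ) := {p | 1 / 3 < p.1 ∧ 0 < p.2 ∧ 0 < wellPoly p.1 p.2}

/-- The signed square root of the potential. -/
def amp (p : ℝ × ℝ) : ℝ := (p.2 - 1) * Real.sqrt (wellFactor p.1 p.2) / p.2

theorem isOpen_wellDomain : IsOpen wellDomain := by
  have h1 : IsOpen {p : ℝ × ℝ | 1 / 3 < p.1} := isOpen_lt continuous_const continuous_fst
  have h2 : IsOpen {p : ℝ × ℝ | 0 < p.2} := isOpen_lt continuous_const continuous_snd
  have h3 : IsOpen {p : ℝ × ℝ | 0 < wellPoly p.1 p.2} :=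
    isOpen_lt continuous_const (by unfold wellPoly; fun_prop)
  exact h1.inter (h2.inter h3)

/-- For t ≥ 1 it follows from (1 + t + t²)·`wellFactor` - (1 + 2t)·`wellPoly` = t²(t² - 1). -/
theorem wellFactor_pos {k t : ℝ} (h : (k, t) ∈ wellDomain) : 0 < wellFactor k t := by
  obtain ⟨hk, ht, hD⟩ := h
  simp only [wellPoly, wellFactor] at *
  rcases le_total t 1 with h1 | h1
  · nlinarith
  · have h2 : 0 < (1 + 2 * t) * (k * (1 + t + t ^ 2) - t ^ 3) := by positivity
    have h3 : 0 ≤ t ^ 2 * (t ^ 2 - 1) := mul_nonneg (sq_nonneg t) (by nlinarith)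
    have h4 : 0 < (1 + t + t ^ 2) * (k + 2 * k * t - t ^ 2) := by nlinarith
    exact pos_of_mul_pos_right h4 (by positivity)

/-- Positivity of `wellPoly` means k > t³/(1 + t + t²), and the right side increases in t. So each
fibre of the well is an interval starting at 0. -/
theorem wellDomain_of_le {k t t' : ℝ} (h : (k, t') ∈ wellDomain) (ht : 0 < t) (htt : t ≤ t') :
    (k, t) ∈ wellDomain := by
  obtain ⟨hk, ht', hD⟩ := h
  refine ⟨hk, ht, ?_⟩
  simp only [wellPoly] at *
  have h1 : t ^ 3 ≤ t' ^ 3 := by gcongr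
  have h2 : t ^ 2 ≤ t' ^ 2 := by gcongr
  have h3 : t ^ 3 * (1 + t' + t' ^ 2) ≤ t' ^ 3 * (1 + t + t ^ 2) := by
    have e1 : t ^ 3 * t' ≤ t' ^ 3 * t := by
      have : t * t' * t ^ 2 ≤ t * t' * t' ^ 2 := by gcongr
      nlinarith
    have e2 : t ^ 3 * t' ^ 2 ≤ t' ^ 3 * t ^ 2 := by
      have : t ^ 2 * t' ^ 2 * t ≤ t ^ 2 * t' ^ 2 * t' := by gcongr
      nlinarith
    nlinarith
  have h4 : 0 < (1 + t + t ^ 2) * (k * (1 + t' + t' ^ 2) - t' ^ 3) := by positivity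
  have h5 : 0 < (1 + t' + t' ^ 2) * (k * (1 + t + t ^ 2) - t ^ 3) := by nlinarith
  exact pos_of_mul_pos_right h5 (by positivity)

theorem one_mem_wellDomain {k : ℝ} (hk : 1 / 3 < k) : (k, (1 : ℝ)) ∈ wellDomain :=
  ⟨hk, one_pos, by simp only [wellPoly]; linarith⟩

theorem contDiffOn_amp : ContDiffOn ℝ ∞ amp wellDomain := by
  intro p hp
  refine ContDiffAt.contDiffWithinAt ?_
  have h1 : wellFactor p.1 p.2 ≠ 0 := (wellFactor_pos hp).ne'
  have h2 : p.2 ≠ 0 := hp.2.1.ne'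
  have h3 : ContDiff ℝ ∞ fun p : ℝ × ℝ => wellFactor p.1 p.2 := by
    unfold wellFactor
    fun_prop
  exact ((contDiffAt_snd.sub contDiffAt_const).mul (h3.contDiffAt.sqrt h1)).div contDiffAt_snd h2

theorem amp_sq {k t : ℝ} (h : (k, t) ∈ wellDomain) :
    amp (k, t) ^ 2 = (1 - t) ^ 2 * wellFactor k t / t ^ 2 := by
  rw [amp, div_pow, mul_pow, Real.sq_sqrt (wellFactor_pos h).le]
  ring

theorem hasDerivAt_amp {k t : ℝ} (h : (k, t) ∈ wellDomain) :
    HasDerivAt (fun t => amp (k, t)) (wellPoly k t / (t ^ 2 * Real.sqrt (wellFactor k t))) t := by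
  have h0 := wellFactor_pos h
  have ht : t ≠ 0 := h.2.1.ne'
  have h1 : HasDerivAt (fun t => wellFactor k t) (2 * k - 2 * t) t := by
    unfold wellFactor
    have := (((hasDerivAt_id t).const_mul (2 * k)).const_add k).sub ((hasDerivAt_id t).pow 2)
    refine this.congr_deriv ?_
    simp
  have h2 := (((hasDerivAt_id t).sub_const 1).mul (h1.sqrt h0.ne')).div (hasDerivAt_id t) ht
  refine h2.congr_deriv ?_
  have h3 : Real.sqrt (wellFactor k t) ≠ 0 := (Real.sqrt_pos.mpr h0).ne'
  simp only [id, Pi.mul_apply]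
  field_simp
  rw [Real.sq_sqrt h0.le]
  simp only [wellFactor, wellPoly]
  ring

theorem deriv_amp_pos {k t : ℝ} (h : (k, t) ∈ wellDomain) :
    0 < wellPoly k t / (t ^ 2 * Real.sqrt (wellFactor k t)) :=
  div_pos h.2.2 (mul_pos (pow_pos h.2.1 2) (Real.sqrt_pos.mpr (wellFactor_pos h)))

theorem fderiv_amp {p : ℝ × ℝ} (h : p ∈ wellDomain) :
    fderiv ℝ amp p (0, 1) = wellPoly p.1 p.2 / (p.2 ^ 2 * Real.sqrt (wellFactor p.1 p.2)) := by
  have h1 := hasDerivAt_comp_curve (γ := fun s => (p.1, s)) isOpen_wellDomain contDiffOn_amp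
    ((hasDerivAt_const p.2 p.1).prodMk (hasDerivAt_id p.2)) h
  exact h1.unique (hasDerivAt_amp (k := p.1) (t := p.2) h)

theorem amp_lt_amp {k t t' : ℝ} (ht : 0 < t) (h' : (k, t') ∈ wellDomain) (htt : t < t') :
    amp (k, t) < amp (k, t') := by
  have hmem : ∀ s ∈ Icc t t', (k, s) ∈ wellDomain := fun s hs =>
    wellDomain_of_le h' (ht.trans_le hs.1) hs.2
  have : StrictMonoOn (fun t => amp (k, t)) (Icc t t') := by
    refine strictMonoOn_of_deriv_pos (convex_Icc t t')
      (fun s hs => (hasDerivAt_amp (hmem s hs)).continuousAt.continuousWithinAt) fun s hs => ?_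
    rw [interior_Icc] at hs
    have hs' := hmem s (Ioo_subset_Icc_self hs)
    rw [(hasDerivAt_amp hs').deriv]
    exact deriv_amp_pos hs'
  exact this (left_mem_Icc.mpr htt.le) (right_mem_Icc.mpr htt.le) htt

/-- The range of the amplitude coordinate. -/
def ampRange : Set (ℝ × ℝ) := (fun p : ℝ × ℝ => (p.1, amp p)) '' wellDomain

theorem exists_ampInv : IsOpen ampRange ∧ ∃ g : ℝ × ℝ → ℝ,
    ContDiffOn ℝ ∞ g ampRange ∧ ∀ p ∈ wellDomain, g (p.1, amp p) = p.2 := by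
  refine exists_fiber_inverse isOpen_wellDomain contDiffOn_amp (fun p hp => ?_)
    fun k t t' ht ht' h => ?_
  · rw [fderiv_amp hp]
    exact (deriv_amp_pos (k := p.1) (t := p.2) hp).ne'
  · rcases lt_trichotomy t t' with h1 | h1 | h1
    · exact absurd h (amp_lt_amp ht.2.1 ht' h1).ne
    · exact h1
    · exact absurd h (amp_lt_amp ht'.2.1 ht h1).ne'

/-- The inverse of the amplitude coordinate, in the last variable. -/
def ampInv : ℝ × ℝ → ℝ := exists_ampInv.2.choose

theorem isOpen_ampRange : IsOpen ampRange := exists_ampInv.1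

theorem contDiffOn_ampInv : ContDiffOn ℝ ∞ ampInv ampRange := exists_ampInv.2.choose_spec.1

theorem ampInv_amp {k t : ℝ} (h : (k, t) ∈ wellDomain) : ampInv (k, amp (k, t)) = t :=
  exists_ampInv.2.choose_spec.2 (k, t) h

theorem mem_wellDomain_ampInv {k s : ℝ} (h : (k, s) ∈ ampRange) :
    (k, ampInv (k, s)) ∈ wellDomain := by
  obtain ⟨⟨k', t⟩, hp, he⟩ := h
  simp only [Prod.mk.injEq] at he
  obtain ⟨rfl, rfl⟩ := he
  rwa [ampInv_amp hp]

theorem amp_ampInv {k s : ℝ} (h : (k, s) ∈ ampRange) : amp (k, ampInv (k, s)) = s := by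
  obtain ⟨⟨k', t⟩, hp, he⟩ := h
  simp only [Prod.mk.injEq] at he
  obtain ⟨rfl, rfl⟩ := he
  rw [ampInv_amp hp]

theorem mem_ampRange_amp {k t : ℝ} (h : (k, t) ∈ wellDomain) : (k, amp (k, t)) ∈ ampRange :=
  ⟨(k, t), h, rfl⟩

theorem lt_of_mem_ampRange {k s : ℝ} (h : (k, s) ∈ ampRange) : 1 / 3 < k :=
  (mem_wellDomain_ampInv h).1

theorem amp_one (k : ℝ) : amp (k, 1) = 0 := by simp [amp]

theorem zero_mem_ampRange {k : ℝ} (hk : 1 / 3 < k) : (k, (0 : ℝ)) ∈ ampRange := by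
  rw [← amp_one k]
  exact mem_ampRange_amp (one_mem_wellDomain hk)

theorem ampInv_zero {k : ℝ} (hk : 1 / 3 < k) : ampInv (k, 0) = 1 := by
  rw [← amp_one k]
  exact ampInv_amp (one_mem_wellDomain hk)

/-- The amplitude tends to -∞ at the singularity t → 0⁺, so its range is a down-set. An orbit
therefore stays in the well as soon as its largest amplitude does. -/
theorem mem_ampRange_of_le {k s s' : ℝ} (h : (k, s) ∈ ampRange) (hs : s' ≤ s) :
    (k, s') ∈ ampRange := by
  obtain ⟨⟨k', t⟩, hp, he⟩ := h
  simp only [Prod.mk.injEq] at he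
  obtain ⟨rfl, rfl⟩ := he
  have hk : 0 < k' := lt_trans (by norm_num) hp.1
  -- For ε ≤ 1/2 the amplitude at ε is at most -√k'/(2ε), and the last bound on ε makes this at most
  -- -(|s'| + 1).
  set ε := min (min (1 / 2) t) (Real.sqrt k' / (2 * (|s'| + 1))) with hε
  have h0 : 0 < ε := by
    have := hp.2.1
    have := Real.sqrt_pos.mpr hk
    positivity
  have h1 : ε ≤ 1 / 2 := (min_le_left _ _).trans (min_le_left _ _)
  have h2 : ε ≤ t := (min_le_left _ _).trans (min_le_right _ _)
  have h3 : ε ≤ Real.sqrt k' / (2 * (|s'| + 1)) := min_le_right _ _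
  have hεm := wellDomain_of_le hp h0 h2
  have h4 : amp (k', ε) ≤ s' := by
    have e1 : Real.sqrt k' ≤ Real.sqrt (wellFactor k' ε) := by
      refine Real.sqrt_le_sqrt ?_
      simp only [wellFactor]
      have := hp.1
      nlinarith
    rw [le_div_iff₀ (by positivity)] at h3
    rw [amp, div_le_iff₀ h0]
    have e2 : -(|s'| * ε) ≤ s' * ε := by
      have := neg_abs_le s'
      nlinarith
    have e3 := Real.sqrt_nonneg k'
    nlinarith
  have h5 : ContinuousOn (fun t => amp (k', t)) (Icc ε t) := fun u hu =>
    (hasDerivAt_amp (wellDomain_of_le hp (h0.trans_le hu.1) hu.2)).continuousAt.continuousWithinAt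
  obtain ⟨u, hu, hu'⟩ := intermediate_value_Icc h2 h5 ⟨h4, hs⟩
  simp only at hu'
  rw [← hu']
  exact mem_ampRange_amp (wellDomain_of_le hp (h0.trans_le hu.1) hu.2)

/-! ## Derivatives of the inverse of the amplitude coordinate -/

/-- The square of the derivative of `ampInv`, as a function of the well coordinate. -/
def slopeSq (k t : ℝ) : ℝ := t ^ 4 * wellFactor k t / wellPoly k t ^ 2

/-- The derivative of `slopeSq`. -/
def slopeSq₁ (k t : ℝ) : ℝ :=
  (k ^ 2 * (4 * t ^ 3 + 12 * t ^ 4 + 6 * t ^ 5 + 2 * t ^ 6) - k * (6 * t ^ 5 + 2 * t ^ 6)) /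
    wellPoly k t ^ 3

/-- The second derivative of `slopeSq`. -/
def slopeSq₂ (k t : ℝ) : ℝ :=
  6 * k * t ^ 2 * (k ^ 2 * (2 + 8 * t + 5 * t ^ 2) +
    k * (t ^ 2 * (-5 + 10 * t ^ 2 + 4 * t ^ 3 + t ^ 4)) - t ^ 5 * (4 + t)) / wellPoly k t ^ 4

theorem slopeSq_pos {k t : ℝ} (h : (k, t) ∈ wellDomain) : 0 < slopeSq k t :=
  div_pos (mul_pos (pow_pos h.2.1 4) (wellFactor_pos h)) (pow_pos h.2.2 2)

theorem hasDerivAt_wellPoly (k t : ℝ) :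
    HasDerivAt (fun t => wellPoly k t) (k * (1 + 2 * t) - 3 * t ^ 2) t := by
  unfold wellPoly
  have := ((((hasDerivAt_id t).const_add 1).add ((hasDerivAt_id t).pow 2)).const_mul k).sub
    ((hasDerivAt_id t).pow 3)
  refine this.congr_deriv ?_
  simp

theorem hasDerivAt_slopeSq {k t : ℝ} (h : (k, t) ∈ wellDomain) :
    HasDerivAt (fun t => slopeSq k t) (slopeSq₁ k t) t := by
  have hD : wellPoly k t ≠ 0 := h.2.2.ne'
  have h1 : HasDerivAt (fun t => t ^ 4 * wellFactor k t)
      (4 * k * t ^ 3 + 10 * k * t ^ 4 - 6 * t ^ 5) t := by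
    unfold wellFactor
    have := ((hasDerivAt_id t).pow 4).mul
      ((((hasDerivAt_id t).const_mul (2 * k)).const_add k).sub ((hasDerivAt_id t).pow 2))
    refine this.congr_deriv ?_
    simp
    ring
  refine (h1.div ((hasDerivAt_wellPoly k t).pow 2) (pow_ne_zero 2 hD)).congr_deriv ?_
  simp only [slopeSq₁, Pi.pow_apply]
  rw [div_eq_div_iff (by positivity) (by positivity)]
  simp only [wellFactor, wellPoly, Nat.cast_ofNat]
  ring

theorem hasDerivAt_slopeSq₁ {k t : ℝ} (h : (k, t) ∈ wellDomain) :
    HasDerivAt (fun t => slopeSq₁ k t) (slopeSq₂ k t) t := by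
  have hD : wellPoly k t ≠ 0 := h.2.2.ne'
  have h1 : HasDerivAt (fun t : ℝ => k ^ 2 * (4 * t ^ 3 + 12 * t ^ 4 + 6 * t ^ 5 + 2 * t ^ 6) -
      k * (6 * t ^ 5 + 2 * t ^ 6))
      (k ^ 2 * (12 * t ^ 2 + 48 * t ^ 3 + 30 * t ^ 4 + 12 * t ^ 5) -
        k * (30 * t ^ 4 + 12 * t ^ 5)) t := by
    have e : ∀ n : ℕ, HasDerivAt (fun t : ℝ => t ^ n) (n * t ^ (n - 1)) t :=
      fun n => hasDerivAt_pow n t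
    have := ((((((e 3).const_mul 4).add ((e 4).const_mul 12)).add ((e 5).const_mul 6)).add
      ((e 6).const_mul 2)).const_mul (k ^ 2)).sub
      ((((e 5).const_mul 6).add ((e 6).const_mul 2)).const_mul k)
    refine this.congr_deriv ?_
    norm_num
    ring
  refine (h1.div ((hasDerivAt_wellPoly k t).pow 3) (pow_ne_zero 3 hD)).congr_deriv ?_
  simp only [slopeSq₂, Pi.pow_apply]
  rw [div_eq_div_iff (by positivity) (by positivity)]
  simp only [wellPoly, Nat.cast_ofNat]
  ring

/-- The convexity behind the monotonicity of the period. For fixed t the bracket is a quadratic in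
k, which only has to be checked at the lower end of the admissible k. -/
theorem slopeSq₂_pos {k t : ℝ} (h : (k, t) ∈ wellDomain) : 0 < slopeSq₂ k t := by
  obtain ⟨hk, ht, hD⟩ := h
  simp only at hk ht hD
  refine div_pos (mul_pos (by positivity) ?_) (pow_pos hD 4)
  set A := 2 + 8 * t + 5 * t ^ 2
  set B := t ^ 2 * (-5 + 10 * t ^ 2 + 4 * t ^ 3 + t ^ 4)
  set C := t ^ 5 * (4 + t)
  have hA : 0 < A := by positivity
  have hC : 0 < C := by positivity
  -- With q(k) = k²A + kB - C one has k₀ q(k) - k q(k₀) = (k - k₀)(A k k₀ + C), so positivity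
  -- propagates upwards from k₀.
  have key : ∀ k₀ : ℝ, 0 < k₀ → k₀ < k → 0 ≤ k₀ ^ 2 * A + k₀ * B - C →
      0 < k ^ 2 * A + k * B - C := by
    intro k₀ h0 h1 h2
    have h3 : 0 < (k - k₀) * (A * k * k₀ + C) := mul_pos (by linarith) (by positivity)
    have h4 : 0 ≤ k * (k₀ ^ 2 * A + k₀ * B - C) := mul_nonneg (by linarith) h2
    have h5 : 0 < k₀ * (k ^ 2 * A + k * B - C) := by nlinarith
    exact pos_of_mul_pos_right h5 h0.le
  -- The admissible k exceed both 1/3 and t³/(1 + t + t²). The two bounds coincide at t = 1, and the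
  -- larger one is taken as k₀.
  rcases le_total t 1 with h1 | h1
  · refine key (1 / 3) (by norm_num) hk ?_
    have : 0 ≤ 2 + 8 * t - 10 * t ^ 2 + 30 * t ^ 4 - 24 * t ^ 5 - 6 * t ^ 6 := by
      have e : 2 + 8 * t - 10 * t ^ 2 + 30 * t ^ 4 - 24 * t ^ 5 - 6 * t ^ 6 =
        (1 - t) * (2 + 10 * t + 30 * t ^ 4 + 6 * t ^ 5) := by ring
      rw [e]
      exact mul_nonneg (by linarith) (by positivity)
    simp only [A, B, C]
    nlinarith
  · have hs : 0 < 1 + t + t ^ 2 := by positivity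
    refine key (t ^ 3 / (1 + t + t ^ 2)) (by positivity) ?_ ?_
    · rw [div_lt_iff₀ hs]
      simp only [wellPoly] at hD
      linarith
    · have e : (t ^ 3 / (1 + t + t ^ 2)) ^ 2 * A + t ^ 3 / (1 + t + t ^ 2) * B - C =
          t ^ 5 * (-9 - 12 * t - t ^ 2 + 8 * t ^ 3 + 9 * t ^ 4 + 4 * t ^ 5 + t ^ 6) /
            (1 + t + t ^ 2) ^ 2 := by
        simp only [A, B, C]
        field_simp
        ring
      rw [e]
      have h2 : 1 ≤ t ^ 3 := one_le_pow₀ h1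
      have h3 : t ≤ t ^ 4 := le_self_pow₀ h1 (by norm_num)
      have h4 : t ≤ t ^ 5 := le_self_pow₀ h1 (by norm_num)
      have h5 : t ^ 2 ≤ t ^ 6 := pow_le_pow_right₀ h1 (by norm_num)
      have h6 : 1 ≤ t ^ 4 := one_le_pow₀ h1
      have : 0 ≤ -9 - 12 * t - t ^ 2 + 8 * t ^ 3 + 9 * t ^ 4 + 4 * t ^ 5 + t ^ 6 := by linarith
      positivity

section Plane

variable {Ω : Set (ℝ × ℝ)} {G : ℝ × ℝ → ℝ}

theorem hasDerivAt_snd (hΩ : IsOpen Ω) (hG : ContDiffOn ℝ ∞ G Ω) {a x : ℝ} (h : (a, x) ∈ Ω) :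
    HasDerivAt (fun s => G (a, s)) (dirDeriv (0, 1) G (a, x)) x :=
  hasDerivAt_comp_curve (γ := fun s => (a, s)) hΩ hG
    ((hasDerivAt_const x a).prodMk (hasDerivAt_id x)) h

theorem hasDerivAt_fst (hΩ : IsOpen Ω) (hG : ContDiffOn ℝ ∞ G Ω) {a x : ℝ} (h : (a, x) ∈ Ω) :
    HasDerivAt (fun s => G (s, x)) (dirDeriv (1, 0) G (a, x)) a :=
  hasDerivAt_comp_curve (γ := fun s => (s, x)) hΩ hG
    ((hasDerivAt_id a).prodMk (hasDerivAt_const a x)) h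

end Plane

/-- The derivative of `ampInv` in the amplitude coordinate. -/
def ampInv₁ : ℝ × ℝ → ℝ := dirDeriv (0, 1) ampInv

theorem contDiffOn_ampInv₁ : ContDiffOn ℝ ∞ ampInv₁ ampRange :=
  contDiffOn_dirDeriv isOpen_ampRange contDiffOn_ampInv _

theorem hasDerivAt_ampInv {k s : ℝ} (h : (k, s) ∈ ampRange) :
    HasDerivAt (fun s => ampInv (k, s)) (ampInv₁ (k, s)) s :=
  hasDerivAt_snd isOpen_ampRange contDiffOn_ampInv h

theorem eventually_mem_ampRange {k s : ℝ} (h : (k, s) ∈ ampRange) :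
    ∀ᶠ x in 𝓝 s, (k, x) ∈ ampRange :=
  (Continuous.prodMk_right k).continuousAt.eventually_mem (isOpen_ampRange.mem_nhds h)

/-- The form h'² = S(h), with S = `slopeSq` rational, makes higher derivatives explicit: h'' =
S'(h)/2 and h''' = S''(h) h'/2. -/
theorem ampInv₁_eq {k s : ℝ} (h : (k, s) ∈ ampRange) :
    ampInv₁ (k, s) = Real.sqrt (slopeSq k (ampInv (k, s))) := by
  have hw := mem_wellDomain_ampInv h
  have h1 := (hasDerivAt_amp hw).comp s (hasDerivAt_ampInv h)
  have h2 : HasDerivAt (fun x : ℝ => x) 1 s := hasDerivAt_id s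
  have h3 : (fun x => amp (k, ampInv (k, x))) =ᶠ[𝓝 s] fun x => x := by
    filter_upwards [eventually_mem_ampRange h] with x hx
    exact amp_ampInv hx
  have h4 := h1.unique (h2.congr_of_eventuallyEq h3)
  set t := ampInv (k, s)
  have ht := hw.2.1
  have hD := hw.2.2
  have hF := Real.sqrt_pos.mpr (wellFactor_pos hw)
  simp only at ht hD
  have h5 : Real.sqrt (slopeSq k t) = t ^ 2 * Real.sqrt (wellFactor k t) / wellPoly k t := by
    rw [slopeSq, Real.sqrt_div' _ (by positivity), Real.sqrt_mul (by positivity),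
      Real.sqrt_sq hD.le, show t ^ 4 = (t ^ 2) ^ 2 by ring, Real.sqrt_sq (by positivity)]
  rw [h5, eq_div_iff hD.ne']
  rw [div_mul_eq_mul_div, div_eq_iff (by positivity)] at h4
  linarith

theorem ampInv₁_pos {k s : ℝ} (h : (k, s) ∈ ampRange) : 0 < ampInv₁ (k, s) := by
  rw [ampInv₁_eq h]
  exact Real.sqrt_pos.mpr (slopeSq_pos (mem_wellDomain_ampInv h))

theorem dirDeriv_ampInv₁ {k s : ℝ} (h : (k, s) ∈ ampRange) :
    dirDeriv (0, 1) ampInv₁ (k, s) = slopeSq₁ k (ampInv (k, s)) / 2 := by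
  have hw := mem_wellDomain_ampInv h
  have h0 := (hasDerivAt_slopeSq hw).comp s (hasDerivAt_ampInv h)
  have h1 := h0.sqrt (slopeSq_pos hw).ne'
  have h2 : (fun x => ampInv₁ (k, x)) =ᶠ[𝓝 s] fun x => Real.sqrt (slopeSq k (ampInv (k, x))) := by
    filter_upwards [eventually_mem_ampRange h] with x hx
    exact ampInv₁_eq hx
  have h3 := (hasDerivAt_snd isOpen_ampRange contDiffOn_ampInv₁ h).unique
    (h1.congr_of_eventuallyEq h2)
  have h4 : Real.sqrt (slopeSq k (ampInv (k, s))) ≠ 0 :=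
    (Real.sqrt_pos.mpr (slopeSq_pos hw)).ne'
  rw [h3, ampInv₁_eq h]
  simp only [Function.comp]
  field_simp

theorem dirDeriv_dirDeriv_ampInv₁ {k s : ℝ} (h : (k, s) ∈ ampRange) :
    dirDeriv (0, 1) (dirDeriv (0, 1) ampInv₁) (k, s) =
      slopeSq₂ k (ampInv (k, s)) * ampInv₁ (k, s) / 2 := by
  have hw := mem_wellDomain_ampInv h
  have h1 := ((hasDerivAt_slopeSq₁ hw).comp s (hasDerivAt_ampInv h)).div_const 2
  have h2 : (fun x => dirDeriv (0, 1) ampInv₁ (k, x)) =ᶠ[𝓝 s]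
      fun x => slopeSq₁ k (ampInv (k, x)) / 2 := by
    filter_upwards [eventually_mem_ampRange h] with x hx
    exact dirDeriv_ampInv₁ hx
  exact (hasDerivAt_snd isOpen_ampRange (contDiffOn_dirDeriv isOpen_ampRange
    contDiffOn_ampInv₁ _) h).unique (h1.congr_of_eventuallyEq h2)

theorem dirDeriv_dirDeriv_ampInv₁_pos {k s : ℝ} (h : (k, s) ∈ ampRange) :
    0 < dirDeriv (0, 1) (dirDeriv (0, 1) ampInv₁) (k, s) := by
  rw [dirDeriv_dirDeriv_ampInv₁ h]
  have := slopeSq₂_pos (mem_wellDomain_ampInv h)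
  have := ampInv₁_pos h
  positivity

/-! ## Averages over orbits -/

/-- The pairs `(k, r)` such that the orbit of radius `|r|` lies in the well with parameter `k`. -/
def orbitDomain : Set (ℝ × ℝ) := {q | q ∈ ampRange ∧ (q.1, -q.2) ∈ ampRange}

theorem isOpen_orbitDomain : IsOpen orbitDomain := by
  refine isOpen_ampRange.inter (isOpen_ampRange.preimage (f := fun q : ℝ × ℝ => (q.1, -q.2)) ?_)
  fun_prop

theorem mem_ampRange_of_orbit {q : ℝ × ℝ} (h : q ∈ orbitDomain) (θ : ℝ) :
    (q.1, -q.2 * Real.cos θ) ∈ ampRange := by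
  have h1 : -q.2 * Real.cos θ ≤ |q.2| := by
    refine (le_abs_self _).trans ?_
    rw [abs_mul, abs_neg]
    exact mul_le_of_le_one_right (abs_nonneg _) (Real.abs_cos_le_one θ)
  rcases abs_cases q.2 with ⟨h2, _⟩ | ⟨h2, _⟩
  · exact mem_ampRange_of_le (s := q.2) h.1 (h1.trans_eq h2)
  · exact mem_ampRange_of_le h.2 (h1.trans_eq h2)

theorem mem_orbitDomain {k r : ℝ} (hr : 0 ≤ r) (h : (k, r) ∈ ampRange) : (k, r) ∈ orbitDomain :=
  ⟨h, mem_ampRange_of_le h (by simp; linarith)⟩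

theorem zero_mem_orbitDomain {k : ℝ} (hk : 1 / 3 < k) : (k, (0 : ℝ)) ∈ orbitDomain :=
  mem_orbitDomain le_rfl (zero_mem_ampRange hk)

theorem contDiffOn_orbit {g : ℝ × ℝ → ℝ} (hg : ContDiffOn ℝ ∞ g ampRange) :
    ContDiffOn ℝ ∞ (fun p : (ℝ × ℝ) × ℝ => g (p.1.1, -p.1.2 * Real.cos p.2))
      (orbitDomain ×ˢ univ) := by
  refine hg.comp ?_ fun p hp => mem_ampRange_of_orbit hp.1 p.2
  have : ContDiff ℝ ∞ fun p : (ℝ × ℝ) × ℝ => (p.1.1, -p.1.2 * Real.cos p.2) := by fun_prop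
  exact this.contDiffOn

/-- The integral of `g` over the orbit. -/
def avg (g : ℝ × ℝ → ℝ) (q : ℝ × ℝ) : ℝ :=
  ∫ θ in (0 : ℝ)..(2 * Real.pi), g (q.1, -q.2 * Real.cos θ)

/-- The integral of `sin² g` over the orbit. -/
def avgSin (g : ℝ × ℝ → ℝ) (q : ℝ × ℝ) : ℝ :=
  ∫ θ in (0 : ℝ)..(2 * Real.pi), Real.sin θ ^ 2 * g (q.1, -q.2 * Real.cos θ)

section Avg

variable {g : ℝ × ℝ → ℝ}

theorem contDiffOn_avg (hg : ContDiffOn ℝ ∞ g ampRange) : ContDiffOn ℝ ∞ (avg g) orbitDomain :=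
  contDiffOn_intervalIntegral isOpen_orbitDomain (contDiffOn_orbit hg) _ _

theorem contDiffOn_avgSin (hg : ContDiffOn ℝ ∞ g ampRange) :
    ContDiffOn ℝ ∞ (avgSin g) orbitDomain := by
  have h1 : ContDiff ℝ ∞ fun p : (ℝ × ℝ) × ℝ => Real.sin p.2 ^ 2 := by fun_prop
  exact contDiffOn_intervalIntegral isOpen_orbitDomain
    (f := fun p : (ℝ × ℝ) × ℝ => Real.sin p.2 ^ 2 * g (p.1.1, -p.1.2 * Real.cos p.2))
    (h1.contDiffOn.mul (contDiffOn_orbit hg)) _ _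

theorem avg_zero (k : ℝ) : avg g (k, 0) = 2 * Real.pi * g (k, 0) := by
  simp [avg]

theorem avgSin_zero (k : ℝ) : avgSin g (k, 0) = Real.pi * g (k, 0) := by
  simp [avgSin, integral_sin_sq]

theorem continuous_orbit (hg : ContDiffOn ℝ ∞ g ampRange) {q : ℝ × ℝ} (hq : q ∈ orbitDomain) :
    Continuous fun θ => g (q.1, -q.2 * Real.cos θ) :=
  hg.continuousOn.comp_continuous (by fun_prop) fun θ => mem_ampRange_of_orbit hq θ

/-- Differentiation under the integral produces the factor -cos θ = (-sin θ)'. Integrating by parts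
produces a second derivative of g, a weight sin² θ and an explicit factor r. This factor later
cancels, so that no singularity remains at r = 0. -/
theorem dirDeriv_snd_avg (hg : ContDiffOn ℝ ∞ g ampRange) {q : ℝ × ℝ} (hq : q ∈ orbitDomain) :
    dirDeriv (0, 1) (avg g) q = q.2 * avgSin (dirDeriv (0, 1) (dirDeriv (0, 1) g)) q := by
  have hg1 := contDiffOn_dirDeriv isOpen_ampRange hg (0, 1)
  have hg2 := contDiffOn_dirDeriv isOpen_ampRange hg1 (0, 1)
  have hf := contDiffOn_orbit hg
  have h1 := hasFDerivAt_intervalIntegral isOpen_orbitDomain hf 0 (2 * Real.pi) hq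
  have hc := (contDiffOn_fderivFst isOpen_orbitDomain hf).continuousOn.comp_continuous
    (f := fun θ : ℝ => (q, θ)) (by fun_prop) fun θ => ⟨hq, mem_univ θ⟩
  simp only [Function.comp_def] at hc
  have h2 : dirDeriv (0, 1) (avg g) q = ∫ θ in (0 : ℝ)..(2 * Real.pi),
      dirDeriv (0, 1) g (q.1, -q.2 * Real.cos θ) * -Real.cos θ := by
    rw [dirDeriv, show avg g = fun q => ∫ θ in (0 : ℝ)..(2 * Real.pi),
      g (q.1, -q.2 * Real.cos θ) from rfl, h1.fderiv,
      ContinuousLinearMap.intervalIntegral_apply (hc.intervalIntegrable _ _)]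
    refine intervalIntegral.integral_congr fun θ _ => ?_
    have e1 := hasFDerivAt_slice isOpen_orbitDomain hf hq θ
    have e2 : HasDerivAt (fun r : ℝ => (q.1, r)) ((0 : ℝ), (1 : ℝ)) q.2 :=
      (hasDerivAt_const q.2 q.1).prodMk (hasDerivAt_id q.2)
    have e3 := HasFDerivAt.comp_hasDerivAt (f := fun r : ℝ => (q.1, r)) q.2 e1 e2
    have e4 : HasDerivAt (fun r : ℝ => -r * Real.cos θ) (-1 * Real.cos θ) q.2 :=
      (hasDerivAt_id q.2).neg.mul_const _
    have e5 := (hasDerivAt_snd isOpen_ampRange hg (mem_ampRange_of_orbit hq θ)).comp q.2 e4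
    refine (e3.unique e5).trans ?_
    ring
  have h3 : ∀ θ, HasDerivAt (fun θ => dirDeriv (0, 1) g (q.1, -q.2 * Real.cos θ))
      (dirDeriv (0, 1) (dirDeriv (0, 1) g) (q.1, -q.2 * Real.cos θ) * (q.2 * Real.sin θ)) θ := by
    intro θ
    have e4 : HasDerivAt (fun θ : ℝ => -q.2 * Real.cos θ) (q.2 * Real.sin θ) θ := by
      refine ((Real.hasDerivAt_cos θ).const_mul (-q.2)).congr_deriv ?_
      ring
    exact (hasDerivAt_snd isOpen_ampRange hg1 (mem_ampRange_of_orbit hq θ)).comp θ e4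
  have h4 : ∀ θ, HasDerivAt (fun θ => -Real.sin θ) (-Real.cos θ) θ := fun θ =>
    (Real.hasDerivAt_sin θ).neg
  have c2 := continuous_orbit hg2 hq
  rw [h2, intervalIntegral.integral_mul_deriv_eq_deriv_mul (fun θ _ => h3 θ) (fun θ _ => h4 θ)
    (by apply Continuous.intervalIntegrable; fun_prop)
    (by apply Continuous.intervalIntegrable; fun_prop), avgSin,
    ← intervalIntegral.integral_const_mul]
  simp only [Real.sin_two_pi, Real.sin_zero, neg_zero, mul_zero, sub_self, zero_sub]
  rw [← intervalIntegral.integral_neg]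
  refine intervalIntegral.integral_congr fun θ _ => ?_
  ring

end Avg

/-! ## The period -/

/-- The period of the orbit. -/
def period : ℝ × ℝ → ℝ := avg ampInv₁

theorem contDiffOn_period : ContDiffOn ℝ ∞ period orbitDomain := contDiffOn_avg contDiffOn_ampInv₁

theorem avgSin_pos {g : ℝ × ℝ → ℝ} (hg : ContDiffOn ℝ ∞ g ampRange)
    (hpos : ∀ p ∈ ampRange, 0 < g p) {q : ℝ × ℝ} (hq : q ∈ orbitDomain) : 0 < avgSin g q := by
  have hc := continuous_orbit hg hq
  refine intervalIntegral.integral_pos Real.two_pi_pos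
    (((by fun_prop : Continuous fun θ => Real.sin θ ^ 2).mul hc).continuousOn) (fun θ _ => ?_)
    ⟨Real.pi / 2, ⟨by positivity, by linarith [Real.pi_pos]⟩, ?_⟩
  · exact mul_nonneg (sq_nonneg _) (hpos _ (mem_ampRange_of_orbit hq θ)).le
  · rw [Real.sin_pi_div_two]
    have := hpos _ (mem_ampRange_of_orbit hq (Real.pi / 2))
    linarith

/-- The derivative of the period in the squared radius, up to a factor `2`. -/
def periodSlope : ℝ × ℝ → ℝ := avgSin (dirDeriv (0, 1) (dirDeriv (0, 1) ampInv₁))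

theorem contDiffOn_ampInv₃ :
    ContDiffOn ℝ ∞ (dirDeriv (0, 1) (dirDeriv (0, 1) ampInv₁)) ampRange :=
  contDiffOn_dirDeriv isOpen_ampRange
    (contDiffOn_dirDeriv isOpen_ampRange contDiffOn_ampInv₁ _) _

theorem contDiffOn_periodSlope : ContDiffOn ℝ ∞ periodSlope orbitDomain :=
  contDiffOn_avgSin contDiffOn_ampInv₃

theorem periodSlope_pos {q : ℝ × ℝ} (hq : q ∈ orbitDomain) : 0 < periodSlope q :=
  avgSin_pos contDiffOn_ampInv₃ (fun _ hp => dirDeriv_dirDeriv_ampInv₁_pos hp) hq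

theorem dirDeriv_snd_period {q : ℝ × ℝ} (hq : q ∈ orbitDomain) :
    dirDeriv (0, 1) period q = q.2 * periodSlope q :=
  dirDeriv_snd_avg contDiffOn_ampInv₁ hq

theorem period_pos {q : ℝ × ℝ} (hq : q ∈ orbitDomain) : 0 < period q :=
  intervalIntegral.intervalIntegral_pos_of_pos
    ((continuous_orbit contDiffOn_ampInv₁ hq).intervalIntegrable _ _)
    (fun θ => ampInv₁_pos (mem_ampRange_of_orbit hq θ)) Real.two_pi_pos

theorem ampInv₁_zero {k : ℝ} (hk : 1 / 3 < k) : ampInv₁ (k, 0) = (Real.sqrt (3 * k - 1))⁻¹ := by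
  rw [ampInv₁_eq (zero_mem_ampRange hk), ampInv_zero hk, ← Real.sqrt_inv]
  congr 1
  have h : 3 * k - 1 ≠ 0 := by linarith
  simp only [slopeSq, wellFactor, wellPoly]
  have h2 : k * (1 + 1 + 1 ^ 2) - 1 ^ 3 = 3 * k - 1 := by ring
  rw [h2]
  rw [show 1 ^ 4 * (k + 2 * k * 1 - 1 ^ 2) = 3 * k - 1 by ring]
  field_simp

theorem period_zero {k : ℝ} (hk : 1 / 3 < k) :
    period (k, 0) = 2 * Real.pi * (Real.sqrt (3 * k - 1))⁻¹ := by
  rw [period, avg_zero, ampInv₁_zero hk]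

theorem orbitDomain_of_le {k r r' : ℝ} (h : (k, r') ∈ orbitDomain) (hr : 0 ≤ r) (hrr : r ≤ r') :
    (k, r) ∈ orbitDomain :=
  mem_orbitDomain hr (mem_ampRange_of_le h.1 hrr)

theorem period_lt_period {k r r' : ℝ} (h : (k, r') ∈ orbitDomain) (hr : 0 ≤ r) (hrr : r < r') :
    period (k, r) < period (k, r') := by
  have hmem : ∀ s ∈ Icc r r', (k, s) ∈ orbitDomain := fun s hs =>
    orbitDomain_of_le h (hr.trans hs.1) hs.2
  have : StrictMonoOn (fun s => period (k, s)) (Icc r r') := by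
    refine strictMonoOn_of_deriv_pos (convex_Icc r r') (fun s hs =>
      (hasDerivAt_snd isOpen_orbitDomain contDiffOn_period
        (hmem s hs)).continuousAt.continuousWithinAt) fun s hs => ?_
    rw [interior_Icc] at hs
    have hs' := hmem s (Ioo_subset_Icc_self hs)
    rw [(hasDerivAt_snd isOpen_orbitDomain contDiffOn_period hs').deriv, dirDeriv_snd_period hs']
    exact mul_pos (hr.trans_lt hs.1) (periodSlope_pos hs')
  exact this (left_mem_Icc.mpr hrr.le) (right_mem_Icc.mpr hrr.le) hrr

/-! ## The phase along an orbit -/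

/-- The time at which the orbit reaches the angle `θ`. -/
def phase (p : (ℝ × ℝ) × ℝ) : ℝ := ∫ τ in (0 : ℝ)..p.2, ampInv₁ (p.1.1, -p.1.2 * Real.cos τ)

/-- The parameter domain of the profiles. -/
def phaseDomain : Set ((ℝ × ℝ) × ℝ) := orbitDomain ×ˢ univ

theorem isOpen_phaseDomain : IsOpen phaseDomain := isOpen_orbitDomain.prod isOpen_univ

theorem continuous_phase_integrand {q : ℝ × ℝ} (hq : q ∈ orbitDomain) :
    Continuous fun τ => ampInv₁ (q.1, -q.2 * Real.cos τ) :=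
  continuous_orbit contDiffOn_ampInv₁ hq

/-- The variable end point is scaled to a fixed interval, which turns it into an ordinary parameter.
-/
theorem contDiffOn_phase : ContDiffOn ℝ ∞ phase phaseDomain := by
  have h1 : phase = fun p : (ℝ × ℝ) × ℝ =>
      p.2 * ∫ σ in (0 : ℝ)..1, ampInv₁ (p.1.1, -p.1.2 * Real.cos (p.2 * σ)) := by
    funext p
    have := intervalIntegral.mul_integral_comp_mul_left (a := 0) (b := 1)
      (f := fun τ => ampInv₁ (p.1.1, -p.1.2 * Real.cos τ)) p.2
    rw [mul_zero, mul_one] at this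
    exact this.symm
  rw [h1]
  have h2 : ContDiffOn ℝ ∞ (fun p : ((ℝ × ℝ) × ℝ) × ℝ =>
      ampInv₁ (p.1.1.1, -p.1.1.2 * Real.cos (p.1.2 * p.2))) (phaseDomain ×ˢ univ) := by
    refine contDiffOn_ampInv₁.comp ?_ fun p hp => mem_ampRange_of_orbit hp.1.1 (p.1.2 * p.2)
    have : ContDiff ℝ ∞ fun p : ((ℝ × ℝ) × ℝ) × ℝ =>
      (p.1.1.1, -p.1.1.2 * Real.cos (p.1.2 * p.2)) := by fun_prop
    exact this.contDiffOn
  exact contDiff_snd.contDiffOn.mul (contDiffOn_intervalIntegral isOpen_phaseDomain h2 0 1)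

theorem hasDerivAt_phase {q : ℝ × ℝ} (hq : q ∈ orbitDomain) (θ : ℝ) :
    HasDerivAt (fun θ => phase (q, θ)) (ampInv₁ (q.1, -q.2 * Real.cos θ)) θ :=
  ((continuous_phase_integrand hq).integral_hasStrictDerivAt 0 θ).hasDerivAt

theorem strictMono_phase {q : ℝ × ℝ} (hq : q ∈ orbitDomain) :
    StrictMono fun θ => phase (q, θ) :=
  strictMono_of_deriv_pos fun θ => by
    rw [(hasDerivAt_phase hq θ).deriv]
    exact ampInv₁_pos (mem_ampRange_of_orbit hq θ)

theorem phase_zero (q : ℝ × ℝ) : phase (q, 0) = 0 := intervalIntegral.integral_same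

theorem phase_two_pi (q : ℝ × ℝ) : phase (q, 2 * Real.pi) = period q := rfl

theorem phase_neg (q : ℝ × ℝ) (θ : ℝ) : phase (q, -θ) = -phase (q, θ) := by
  simp only [phase]
  rw [intervalIntegral.integral_symm]
  have := intervalIntegral.integral_comp_neg (a := 0) (b := θ)
    (f := fun τ => ampInv₁ (q.1, -q.2 * Real.cos τ))
  simp only [Real.cos_neg, neg_zero] at this
  rw [this]

theorem phase_add_two_pi {q : ℝ × ℝ} (hq : q ∈ orbitDomain) (θ : ℝ) :
    phase (q, θ + 2 * Real.pi) = phase (q, θ) + period q := by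
  have hc := continuous_phase_integrand hq
  simp only [phase]
  rw [← intervalIntegral.integral_add_adjacent_intervals (hc.intervalIntegrable 0 θ)
    (hc.intervalIntegrable θ _)]
  congr 1
  have hp : Function.Periodic (fun τ => ampInv₁ (q.1, -q.2 * Real.cos τ)) (2 * Real.pi) := by
    intro τ
    simp only [Real.cos_add_two_pi]
  rw [hp.intervalIntegral_add_eq θ 0, zero_add]
  rfl

theorem phase_pi {q : ℝ × ℝ} (hq : q ∈ orbitDomain) : phase (q, Real.pi) = period q / 2 := by
  have h1 := phase_add_two_pi hq (-Real.pi)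
  rw [phase_neg, show -Real.pi + 2 * Real.pi = Real.pi by ring] at h1
  linarith

theorem fderiv_phase {p : (ℝ × ℝ) × ℝ} (hp : p ∈ phaseDomain) :
    fderiv ℝ phase p (0, 1) = ampInv₁ (p.1.1, -p.1.2 * Real.cos p.2) := by
  have h1 := hasDerivAt_comp_curve (γ := fun s => (p.1, s)) isOpen_phaseDomain contDiffOn_phase
    ((hasDerivAt_const p.2 p.1).prodMk (hasDerivAt_id p.2)) hp
  exact h1.unique (hasDerivAt_phase hp.1 p.2)

/-- Each full turn adds one period, so the time is unbounded in both directions. -/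
theorem surjective_phase {q : ℝ × ℝ} (hq : q ∈ orbitDomain) (x : ℝ) :
    ∃ θ, phase (q, θ) = x := by
  have hT := period_pos hq
  have hn : ∀ n : ℕ, phase (q, n * (2 * Real.pi)) = n * period q := by
    intro n
    induction n with
    | zero => simp [phase_zero]
    | succ n ih =>
      rw [show ((n + 1 : ℕ) : ℝ) * (2 * Real.pi) = n * (2 * Real.pi) + 2 * Real.pi by
        push_cast; ring, phase_add_two_pi hq, ih]
      push_cast
      ring
  obtain ⟨n, hn'⟩ := exists_nat_gt (|x| / period q)
  rw [div_lt_iff₀ hT] at hn'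
  have hc : Continuous fun θ => phase (q, θ) :=
    continuous_iff_continuousAt.mpr fun θ => (hasDerivAt_phase hq θ).continuousAt
  have h0 : 0 ≤ (n : ℝ) * (2 * Real.pi) := by positivity
  have := intermediate_value_Icc (a := -(n * (2 * Real.pi))) (b := n * (2 * Real.pi))
    (by linarith) hc.continuousOn
  simp only [phase_neg, hn] at this
  have hx : x ∈ Icc (-(n * period q)) (n * period q) :=
    ⟨by linarith [neg_abs_le x], by linarith [le_abs_self x]⟩
  obtain ⟨θ, -, hθ⟩ := this hx
  exact ⟨θ, hθ⟩

theorem image_phase :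
    (fun p : (ℝ × ℝ) × ℝ => (p.1, phase p)) '' phaseDomain = phaseDomain := by
  refine Subset.antisymm ?_ fun p hp => ?_
  · rintro _ ⟨p, hp, rfl⟩
    exact ⟨hp.1, mem_univ _⟩
  · obtain ⟨θ, hθ⟩ := surjective_phase hp.1 p.2
    exact ⟨(p.1, θ), ⟨hp.1, mem_univ _⟩, Prod.ext rfl hθ⟩

theorem exists_angle : ∃ g : (ℝ × ℝ) × ℝ → ℝ, ContDiffOn ℝ ∞ g phaseDomain ∧
    ∀ p ∈ phaseDomain, g (p.1, phase p) = p.2 := by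
  have h := exists_fiber_inverse isOpen_phaseDomain contDiffOn_phase
    (fun p hp => by
      rw [fderiv_phase hp]
      exact (ampInv₁_pos (mem_ampRange_of_orbit hp.1 p.2)).ne')
    (fun q t t' h _ he => (strictMono_phase h.1).injective he)
  rw [image_phase] at h
  exact h.2

/-- The angle of the orbit at a given time. -/
def angle : (ℝ × ℝ) × ℝ → ℝ := exists_angle.choose

theorem contDiffOn_angle : ContDiffOn ℝ ∞ angle phaseDomain := exists_angle.choose_spec.1

theorem angle_phase {q : ℝ × ℝ} (hq : q ∈ orbitDomain) (θ : ℝ) : angle (q, phase (q, θ)) = θ :=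
  exists_angle.choose_spec.2 (q, θ) ⟨hq, mem_univ _⟩

theorem phase_angle {q : ℝ × ℝ} (hq : q ∈ orbitDomain) (x : ℝ) : phase (q, angle (q, x)) = x := by
  obtain ⟨θ, rfl⟩ := surjective_phase hq x
  rw [angle_phase hq]

theorem angle_zero {q : ℝ × ℝ} (hq : q ∈ orbitDomain) : angle (q, 0) = 0 := by
  have := angle_phase hq 0
  rwa [phase_zero] at this

theorem angle_half {q : ℝ × ℝ} (hq : q ∈ orbitDomain) : angle (q, period q / 2) = Real.pi := by
  rw [← phase_pi hq, angle_phase hq]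

theorem angle_neg {q : ℝ × ℝ} (hq : q ∈ orbitDomain) (x : ℝ) : angle (q, -x) = -angle (q, x) := by
  have h := angle_phase hq (-angle (q, x))
  rwa [phase_neg, phase_angle hq] at h

theorem angle_add_period {q : ℝ × ℝ} (hq : q ∈ orbitDomain) (x : ℝ) :
    angle (q, x + period q) = angle (q, x) + 2 * Real.pi := by
  have h := angle_phase hq (angle (q, x) + 2 * Real.pi)
  rwa [phase_add_two_pi hq, phase_angle hq] at h

theorem strictMono_angle {q : ℝ × ℝ} (hq : q ∈ orbitDomain) :
    StrictMono fun x => angle (q, x) := by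
  intro x y hxy
  by_contra h
  have := (strictMono_phase hq).monotone (not_lt.mp h)
  simp only [phase_angle hq] at this
  linarith

/-- The equation of motion of the angle; from it τ' = r sin θ follows by the chain rule. -/
theorem hasDerivAt_angle {q : ℝ × ℝ} (hq : q ∈ orbitDomain) (x : ℝ) :
    HasDerivAt (fun x => angle (q, x)) (ampInv₁ (q.1, -q.2 * Real.cos (angle (q, x))))⁻¹ x := by
  have h1 : HasDerivAt (fun x => angle (q, x)) (dirDeriv (0, 1) angle (q, x)) x :=
    hasDerivAt_comp_curve (γ := fun s => (q, s)) isOpen_phaseDomain contDiffOn_angle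
      ((hasDerivAt_const x q).prodMk (hasDerivAt_id x)) ⟨hq, mem_univ _⟩
  have h2 := (hasDerivAt_phase hq (angle (q, x))).comp x h1
  have h3 : (fun θ => phase (q, θ)) ∘ (fun x => angle (q, x)) = fun x => x :=
    funext fun x => phase_angle hq x
  rw [h3] at h2
  have h4 := h2.unique (hasDerivAt_id x)
  rwa [← eq_inv_of_mul_eq_one_right h4]

/-! ## The normalized profile -/

/-- The normalized profile: the solution of `τ'² + V(τ) = r²` with a minimum at `0`. -/
def profile (p : (ℝ × ℝ) × ℝ) : ℝ := ampInv (p.1.1, -p.1.2 * Real.cos (angle p))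

theorem contDiffOn_profile : ContDiffOn ℝ ∞ profile phaseDomain := by
  refine contDiffOn_ampInv.comp ?_ fun p hp => mem_ampRange_of_orbit hp.1 _
  have h1 : ContDiff ℝ ∞ fun p : (ℝ × ℝ) × ℝ => p.1.1 := by fun_prop
  have h2 : ContDiff ℝ ∞ fun p : (ℝ × ℝ) × ℝ => -p.1.2 := by fun_prop
  exact h1.contDiffOn.prodMk (h2.contDiffOn.mul contDiffOn_angle.cos)

theorem mem_wellDomain_profile {q : ℝ × ℝ} (hq : q ∈ orbitDomain) (x : ℝ) :
    (q.1, profile (q, x)) ∈ wellDomain :=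
  mem_wellDomain_ampInv (mem_ampRange_of_orbit hq _)

theorem amp_profile {q : ℝ × ℝ} (hq : q ∈ orbitDomain) (x : ℝ) :
    amp (q.1, profile (q, x)) = -q.2 * Real.cos (angle (q, x)) :=
  amp_ampInv (mem_ampRange_of_orbit hq _)

theorem hasDerivAt_profile {q : ℝ × ℝ} (hq : q ∈ orbitDomain) (x : ℝ) :
    HasDerivAt (fun x => profile (q, x)) (q.2 * Real.sin (angle (q, x))) x := by
  have hm := mem_ampRange_of_orbit hq (angle (q, x))
  have h1 := (hasDerivAt_angle hq x).cos.const_mul (-q.2)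
  have h2 := (hasDerivAt_ampInv hm).comp x h1
  refine h2.congr_deriv ?_
  rw [mul_comm, mul_assoc, mul_assoc, inv_mul_cancel₀ (ampInv₁_pos hm).ne']
  ring

/-- Half the force in the well. -/
theorem hasDerivAt_profile₁ {q : ℝ × ℝ} (hq : q ∈ orbitDomain) (x : ℝ) :
    HasDerivAt (fun x => q.2 * Real.sin (angle (q, x)))
      ((1 - profile (q, x)) * wellPoly q.1 (profile (q, x)) / profile (q, x) ^ 3) x := by
  have hm := mem_ampRange_of_orbit hq (angle (q, x))
  have hw := mem_wellDomain_profile hq x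
  have h1 := (hasDerivAt_angle hq x).sin.const_mul q.2
  refine h1.congr_deriv ?_
  have h2 := amp_profile hq x
  have h3 := ampInv₁_eq hm
  rw [show ampInv (q.1, -q.2 * Real.cos (angle (q, x))) = profile (q, x) from rfl] at h3
  have ht := hw.2.1
  have hD := hw.2.2
  have hW := wellFactor_pos hw
  simp only at ht hD
  have hF := Real.sqrt_pos.mpr hW
  set t := profile (q, x)
  have h5 : Real.sqrt (slopeSq q.1 t) = t ^ 2 * Real.sqrt (wellFactor q.1 t) / wellPoly q.1 t := by
    rw [slopeSq, Real.sqrt_div' _ (by positivity), Real.sqrt_mul (by positivity),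
      Real.sqrt_sq hD.le, show t ^ 4 = (t ^ 2) ^ 2 by ring, Real.sqrt_sq (by positivity)]
  rw [h3, h5]
  have h6 : q.2 * Real.cos (angle (q, x)) = -amp (q.1, t) := by linarith
  rw [← mul_assoc, h6, amp]
  field_simp
  ring

theorem profile_energy {q : ℝ × ℝ} (hq : q ∈ orbitDomain) (x : ℝ) :
    (q.2 * Real.sin (angle (q, x))) ^ 2 + (1 - profile (q, x)) ^ 2 *
      wellFactor q.1 (profile (q, x)) / profile (q, x) ^ 2 = q.2 ^ 2 := by
  rw [← amp_sq (mem_wellDomain_profile hq x), amp_profile hq x]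
  have := Real.sin_sq_add_cos_sq (angle (q, x))
  linear_combination q.2 ^ 2 * this

theorem profile_neg {q : ℝ × ℝ} (hq : q ∈ orbitDomain) (x : ℝ) :
    profile (q, -x) = profile (q, x) := by
  rw [profile, profile, angle_neg hq, Real.cos_neg]

theorem profile_add_period {q : ℝ × ℝ} (hq : q ∈ orbitDomain) (x : ℝ) :
    profile (q, x + period q) = profile (q, x) := by
  rw [profile, profile, angle_add_period hq, Real.cos_add_two_pi]

/-- Substitution of the angle for the time: integrals over a period of the wave become orbit
averages, which depend smoothly on (k, r) down to r = 0. -/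
theorem integral_profile {q : ℝ × ℝ} (hq : q ∈ orbitDomain) {f : ℝ → ℝ} (hf : Continuous f) :
    ∫ x in (0 : ℝ)..period q, f (profile (q, x)) =
      avg (fun p => f (ampInv p) * ampInv₁ p) q := by
  have hc := continuous_phase_integrand hq
  have hc' := continuous_orbit contDiffOn_ampInv hq
  have hcp : Continuous fun x => profile (q, x) :=
    continuous_iff_continuousAt.mpr fun x => (hasDerivAt_profile hq x).continuousAt
  have h1 := intervalIntegral.integral_comp_mul_deriv (a := 0) (b := 2 * Real.pi)
    (f := fun θ => phase (q, θ)) (g := fun x => f (profile (q, x)))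
    (fun θ _ => hasDerivAt_phase hq θ) hc.continuousOn (hf.comp hcp)
  simp only [phase_zero, phase_two_pi] at h1
  rw [← h1, avg]
  refine intervalIntegral.integral_congr fun θ _ => ?_
  simp only [Function.comp, profile, angle_phase hq]

/-! ## Orbits of a given period -/

theorem exists_wellPoly_zero {k : ℝ} (hk : 1 / 3 < k) : ∃ t₁ > 1, wellPoly k t₁ = 0 := by
  have hc : Continuous fun t => wellPoly k t := by unfold wellPoly; fun_prop
  have h1 : 0 < wellPoly k 1 := (one_mem_wellDomain hk).2.2
  -- For t = 3k + 1 ≥ 1 one has k(1 + t + t²) ≤ 3k t² < t³.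
  have h2 : wellPoly k (3 * k + 1) ≤ 0 := by
    simp only [wellPoly]
    nlinarith [mul_pos (show (0 : ℝ) < k by linarith) (show (0 : ℝ) < k by linarith)]
  obtain ⟨t, ht, ht'⟩ := intermediate_value_Icc' (by linarith) hc.continuousOn ⟨h2, h1.le⟩
  refine ⟨t, lt_of_le_of_ne ht.1 ?_, ht'⟩
  rintro rfl
  exact h1.ne' ht'

theorem mem_wellDomain_of_lt {k t t₁ : ℝ} (hk : 1 / 3 < k) (ht : 0 < t) (h : t < t₁)
    (h₁ : wellPoly k t₁ = 0) : (k, t) ∈ wellDomain := by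
  refine ⟨hk, ht, ?_⟩
  simp only [wellPoly] at *
  have ht₁ := ht.trans h
  have e : t₁ ^ 3 * (k * (1 + t + t ^ 2) - t ^ 3) =
      k * ((t₁ ^ 3 - t ^ 3) + t * t₁ * (t₁ ^ 2 - t ^ 2) + t ^ 2 * t₁ ^ 2 * (t₁ - t)) := by
    linear_combination t ^ 3 * h₁
  have e1 : t ^ 2 < t₁ ^ 2 := by gcongr
  have e2 : t ^ 3 < t₁ ^ 3 := by gcongr
  have h2 : 0 < t₁ ^ 3 * (k * (1 + t + t ^ 2) - t ^ 3) := by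
    rw [e]
    have := mul_pos (mul_pos ht ht₁) (sub_pos.mpr e1)
    have := mul_pos (mul_pos (pow_pos ht 2) (pow_pos ht₁ 2)) (sub_pos.mpr h)
    exact mul_pos (by linarith) (by linarith)
  exact pos_of_mul_pos_right h2 (by positivity)

theorem lt_of_mem_wellDomain {k t t₁ : ℝ} (h : (k, t) ∈ wellDomain) (ht₁ : 0 < t₁)
    (h₁ : wellPoly k t₁ = 0) : t < t₁ := by
  by_contra h2
  have := (wellDomain_of_le h ht₁ (not_lt.mp h2)).2.2
  simp only at this
  linarith

/-- Near the saddle point, the kinetic energy is at most the square of the distance to it. -/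
theorem amp_sq_sub_le {k t u t₁ : ℝ} (ht : (k, t) ∈ wellDomain) (hu : (k, u) ∈ wellDomain)
    (ht₁ : 1 < t₁) (h₁ : wellPoly k t₁ = 0) (h1u : 1 ≤ u) :
    amp (k, u) ^ 2 - amp (k, t) ^ 2 ≤ (t₁ - t) ^ 2 := by
  have hk : 0 < k := lt_trans (by norm_num) ht.1
  have h0 : 0 < t := ht.2.1
  have h0' : 0 < u := hu.2.1
  have h2 : t < t₁ := lt_of_mem_wellDomain ht (by linarith) h₁
  have h3 : u < t₁ := lt_of_mem_wellDomain hu (by linarith) h₁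
  -- At the saddle t₁ the difference V(t₁) - V(s) has a double zero. The bracket is at most 1, which
  -- is used at s = t, and it is nonnegative for s ≥ 1, which is used at s = u.
  have key : ∀ s : ℝ, 0 < s → (1 - t₁) ^ 2 * wellFactor k t₁ / t₁ ^ 2 -
      (1 - s) ^ 2 * wellFactor k s / s ^ 2 =
      (t₁ - s) ^ 2 * (1 - k * (2 * s + t₁) / (s ^ 2 * t₁ ^ 3)) := by
    intro s hs
    have e : (1 - t₁) ^ 2 * wellFactor k t₁ / t₁ ^ 2 - (1 - s) ^ 2 * wellFactor k s / s ^ 2 -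
        (t₁ - s) ^ 2 * (1 - k * (2 * s + t₁) / (s ^ 2 * t₁ ^ 3)) =
        2 * (t₁ - s) * (t₁ - 1) * wellPoly k t₁ / t₁ ^ 3 := by
      simp only [wellFactor, wellPoly]
      field_simp
      ring
    rw [h₁, mul_zero, zero_div] at e
    linarith
  rw [amp_sq ht, amp_sq hu]
  have e1 : (t₁ - t) ^ 2 * (1 - k * (2 * t + t₁) / (t ^ 2 * t₁ ^ 3)) ≤ (t₁ - t) ^ 2 :=
    mul_le_of_le_one_right (sq_nonneg _) (by
      have : 0 ≤ k * (2 * t + t₁) / (t ^ 2 * t₁ ^ 3) := by positivity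
      linarith)
  have e2 : 0 ≤ (t₁ - u) ^ 2 * (1 - k * (2 * u + t₁) / (u ^ 2 * t₁ ^ 3)) := by
    refine mul_nonneg (sq_nonneg _) (sub_nonneg.mpr ?_)
    rw [div_le_one (by positivity)]
    simp only [wellPoly] at h₁
    have h4 : t₁ ^ 3 = k * (1 + t₁ + t₁ ^ 2) := by linarith
    rw [h4]
    have h5 : 2 * u + t₁ ≤ u ^ 2 * (1 + t₁ + t₁ ^ 2) := by
      have h6 : u ≤ u ^ 2 := by nlinarith
      have h7 : t₁ ≤ u ^ 2 * t₁ := by nlinarith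
      have h8 : u ^ 2 ≤ u ^ 2 * t₁ ^ 2 := by
        refine le_mul_of_one_le_right (sq_nonneg u) (one_le_pow₀ ht₁.le)
      linarith
    nlinarith
  linarith [key t h0, key u h0']

/-- Near the saddle t₁ the speed is at most t₁ - τ, so the approach to t₁ takes logarithmically
long. The orbit turning at u spends at least the time M between τ = 1 and τ = u, so its half period
is at least M. -/
theorem exists_period_gt {k : ℝ} (hk : 1 / 3 < k) (L : ℝ) :
    ∃ r > 0, (k, r) ∈ orbitDomain ∧ L < period (k, r) := by
  obtain ⟨t₁, ht₁, h₁⟩ := exists_wellPoly_zero hk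
  set M := |L| + 1
  have hM : 0 < M := by positivity
  have he : Real.exp (-M) < 1 :=
    (Real.exp_lt_exp.mpr (neg_lt_zero.mpr hM)).trans_eq Real.exp_zero
  have he' := Real.exp_pos (-M)
  -- The turning point is chosen so that log((t₁ - 1)/(t₁ - u)) = M.
  set u := t₁ - (t₁ - 1) * Real.exp (-M)
  have hu1 : 1 < u := by
    have : (t₁ - 1) * Real.exp (-M) < (t₁ - 1) * 1 :=
      mul_lt_mul_of_pos_left he (by linarith)
    linarith
  have hu2 : u < t₁ := by
    have := mul_pos (sub_pos.mpr ht₁) he'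
    linarith
  have hu := mem_wellDomain_of_lt hk (by linarith) hu2 h₁
  set r := amp (k, u)
  have hr : 0 < r := by
    have := amp_lt_amp one_pos hu hu1
    rwa [amp_one] at this
  have hq : (k, r) ∈ orbitDomain := mem_orbitDomain hr.le (mem_ampRange_amp hu)
  refine ⟨r, hr, hq, ?_⟩
  have hm := mem_ampRange_of_orbit hq
  simp only at hm
  have hlt : ∀ θ, 0 < t₁ - ampInv (k, -r * Real.cos θ) := fun θ =>
    sub_pos.mpr (lt_of_mem_wellDomain (mem_wellDomain_ampInv (hm θ)) (by linarith) h₁)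
  -- The function x + log(t₁ - τ) is nondecreasing in θ because τ' = r sin θ ≤ t₁ - τ. It is
  -- compared at θ = π/2, where τ = 1, and at θ = π, where τ = u.
  set ψ : ℝ → ℝ := fun θ => phase ((k, r), θ) + Real.log (t₁ - ampInv (k, -r * Real.cos θ))
  have hψ : ∀ θ, HasDerivAt ψ (ampInv₁ (k, -r * Real.cos θ) +
      -(ampInv₁ (k, -r * Real.cos θ) * (r * Real.sin θ)) /
        (t₁ - ampInv (k, -r * Real.cos θ))) θ := by
    intro θ
    have e4 : HasDerivAt (fun θ : ℝ => -r * Real.cos θ) (r * Real.sin θ) θ := by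
      refine ((Real.hasDerivAt_cos θ).const_mul (-r)).congr_deriv ?_
      ring
    have e5 := (hasDerivAt_ampInv (hm θ)).comp θ e4
    exact (hasDerivAt_phase hq θ).add ((e5.const_sub t₁).log (hlt θ).ne')
  have hmono : Monotone ψ := by
    refine monotone_of_deriv_nonneg (fun θ => (hψ θ).differentiableAt) fun θ => ?_
    rw [(hψ θ).deriv]
    have h3 := amp_sq_sub_le (mem_wellDomain_ampInv (hm θ)) hu ht₁ h₁ hu1.le
    rw [amp_ampInv (hm θ)] at h3
    have h4 : (r * Real.sin θ) ^ 2 ≤ (t₁ - ampInv (k, -r * Real.cos θ)) ^ 2 := by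
      have := Real.sin_sq_add_cos_sq θ
      have e : (r * Real.sin θ) ^ 2 = r ^ 2 - (-r * Real.cos θ) ^ 2 := by
        linear_combination r ^ 2 * this
      rw [e]
      exact h3
    have h5 := abs_le_of_sq_le_sq h4 (hlt θ).le
    have h6 : r * Real.sin θ / (t₁ - ampInv (k, -r * Real.cos θ)) ≤ 1 := by
      rw [div_le_one (hlt θ)]
      exact (abs_le.mp h5).2
    have h7 := ampInv₁_pos (hm θ)
    rw [neg_div, mul_div_assoc]
    nlinarith
  have h8 := hmono (show Real.pi / 2 ≤ Real.pi by linarith [Real.pi_pos])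
  have h9 := (strictMono_phase hq).monotone (show 0 ≤ Real.pi / 2 by positivity)
  simp only [ψ, Real.cos_pi_div_two, Real.cos_pi, mul_zero, phase_zero, phase_pi hq,
    ampInv_zero hk] at h8 h9
  rw [show -r * -1 = amp (k, u) by simp only [r]; ring, ampInv_amp hu,
    show t₁ - u = (t₁ - 1) * Real.exp (-M) by ring,
    Real.log_mul (by linarith) he'.ne', Real.log_exp] at h8
  have := le_abs_self L
  have := abs_nonneg L
  linarith

/-- The value of the parameter `k` for which the small oscillations have period `L`. -/
def kMin (L : ℝ) : ℝ := (1 + (2 * Real.pi / L) ^ 2) / 3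

theorem kMin_gt {L : ℝ} (hL : 0 < L) : 1 / 3 < kMin L := by
  have : 0 < (2 * Real.pi / L) ^ 2 := by positivity
  rw [kMin]
  linarith

theorem period_zero_kMin {L : ℝ} (hL : 0 < L) : period (kMin L, 0) = L := by
  rw [period_zero (kMin_gt hL)]
  have h : 3 * kMin L - 1 = (2 * Real.pi / L) ^ 2 := by
    rw [kMin]
    ring
  rw [h, Real.sqrt_sq (by positivity)]
  field_simp

theorem period_zero_lt {L k : ℝ} (hL : 0 < L) (hk : kMin L < k) : period (k, 0) < L := by
  have h0 := kMin_gt hL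
  rw [← period_zero_kMin hL, period_zero h0, period_zero (h0.trans hk)]
  have : 0 < 3 * kMin L - 1 := by linarith
  gcongr

theorem exists_radius : IsOpen ((fun q => (q.1, period q)) '' {q ∈ orbitDomain | 0 < q.2}) ∧
    ∃ g : ℝ × ℝ → ℝ, ContDiffOn ℝ ∞ g
      ((fun q => (q.1, period q)) '' {q ∈ orbitDomain | 0 < q.2}) ∧
      ∀ q ∈ {q ∈ orbitDomain | 0 < q.2}, g (q.1, period q) = q.2 := by
  refine exists_fiber_inverse (isOpen_orbitDomain.inter (isOpen_lt continuous_const continuous_snd))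
    (contDiffOn_period.mono fun q hq => hq.1) (fun q hq => ?_) fun k r r' h h' he => ?_
  · have : 0 < dirDeriv (0, 1) period q := by
      rw [dirDeriv_snd_period hq.1]
      exact mul_pos hq.2 (periodSlope_pos hq.1)
    exact this.ne'
  · rcases lt_trichotomy r r' with h1 | h1 | h1
    · exact absurd he (period_lt_period h'.1 h.2.le h1).ne
    · exact h1
    · exact absurd he (period_lt_period h.1 h'.2.le h1).ne'

/-- The radius of the orbit of period `L` in the well with parameter `k`. -/
def radius (L k : ℝ) : ℝ := exists_radius.2.choose (k, L)

/-- Intermediate values in r: for k > `kMin L` small oscillations are faster than L, and orbits near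
the separatrix are slower. -/
theorem exists_orbit_of_period {L k : ℝ} (hL : 0 < L) (hk : kMin L < k) :
    ∃ r > 0, (k, r) ∈ orbitDomain ∧ period (k, r) = L := by
  have h0 := (kMin_gt hL).trans hk
  obtain ⟨r, hr, hq, hr'⟩ := exists_period_gt h0 L
  have hc : ContinuousOn (fun s => period (k, s)) (Icc 0 r) := fun s hs =>
    (hasDerivAt_snd isOpen_orbitDomain contDiffOn_period
      (orbitDomain_of_le hq hs.1 hs.2)).continuousAt.continuousWithinAt
  obtain ⟨s, hs, hs'⟩ := intermediate_value_Icc hr.le hc ⟨(period_zero_lt hL hk).le, hr'.le⟩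
  refine ⟨s, lt_of_le_of_ne hs.1 ?_, orbitDomain_of_le hq hs.1 hs.2, hs'⟩
  rintro rfl
  exact (period_zero_lt hL hk).ne hs'

theorem radius_period {q : ℝ × ℝ} (hq : q ∈ orbitDomain) (h : 0 < q.2) :
    radius (period q) q.1 = q.2 :=
  exists_radius.2.choose_spec.2 q ⟨hq, h⟩

theorem radius_pos {L k : ℝ} (hL : 0 < L) (hk : kMin L < k) : 0 < radius L k := by
  obtain ⟨r, hr, hq, rfl⟩ := exists_orbit_of_period hL hk
  rwa [radius_period hq hr]

theorem radius_mem {L k : ℝ} (hL : 0 < L) (hk : kMin L < k) : (k, radius L k) ∈ orbitDomain := by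
  obtain ⟨r, hr, hq, rfl⟩ := exists_orbit_of_period hL hk
  rwa [radius_period hq hr]

theorem period_radius {L k : ℝ} (hL : 0 < L) (hk : kMin L < k) : period (k, radius L k) = L := by
  obtain ⟨r, hr, hq, rfl⟩ := exists_orbit_of_period hL hk
  rw [radius_period hq hr]

theorem contDiffOn_radius {L : ℝ} (hL : 0 < L) : ContDiffOn ℝ ∞ (radius L) (Ioi (kMin L)) := by
  have h := exists_radius.2.choose_spec.1
  refine h.comp (f := fun k => (k, L)) (by fun_prop) fun k hk => ?_
  obtain ⟨r, hr, hq, he⟩ := exists_orbit_of_period hL hk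
  exact ⟨(k, r), ⟨hq, hr⟩, by simp [he]⟩

/-- At k = `kMin L` the period already exceeds L for every positive radius δ. This persists for
nearby k, and monotonicity in the radius forces the orbit of period L inside δ. -/
theorem tendsto_radius {L : ℝ} (hL : 0 < L) :
    Tendsto (radius L) (𝓝[>] kMin L) (𝓝 0) := by
  have h0 := kMin_gt hL
  rw [tendsto_order]
  refine ⟨fun ε hε => ?_, fun ε hε => ?_⟩
  · filter_upwards [self_mem_nhdsWithin] with k hk
    exact hε.trans (radius_pos hL hk)
  · obtain ⟨r, hr, hq, -⟩ := exists_period_gt h0 0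
    set δ := min r (ε / 2)
    have hδ : 0 < δ := by positivity
    have hδm : (kMin L, δ) ∈ orbitDomain := orbitDomain_of_le hq hδ.le (min_le_left _ _)
    have h1 : L < period (kMin L, δ) := by
      have := period_lt_period hδm le_rfl hδ
      rwa [period_zero_kMin hL] at this
    have hc := contDiffOn_period.continuousOn.continuousAt (isOpen_orbitDomain.mem_nhds hδm)
    have hc' : ContinuousAt (fun k => ((k, δ) : ℝ × ℝ)) (kMin L) := by fun_prop
    have h2 : ∀ᶠ k in 𝓝 (kMin L), L < period (k, δ) :=
      (ContinuousAt.comp (f := fun k => ((k, δ) : ℝ × ℝ)) hc hc').eventually_const_lt h1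
    have h3 : ∀ᶠ k in 𝓝 (kMin L), (k, δ) ∈ orbitDomain :=
      hc'.eventually_mem (isOpen_orbitDomain.mem_nhds hδm)
    filter_upwards [self_mem_nhdsWithin, nhdsWithin_le_nhds h2, nhdsWithin_le_nhds h3]
      with k hk hk2 hk3
    have h4 : radius L k < δ := by
      by_contra h5
      rcases (not_lt.mp h5).eq_or_lt with h6 | h6
      · rw [h6, period_radius hL hk] at hk2
        exact lt_irrefl _ hk2
      · have := period_lt_period (radius_mem hL hk) hδ.le h6
        rw [period_radius hL hk] at this
        linarith
    have : δ ≤ ε / 2 := min_le_right _ _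
    linarith

/-! ## The parameters of the waves -/

/-- The parameter `a` of the waves in the well with parameter `k`. -/
def aOf (c k : ℝ) : ℝ := c ^ 4 * k / (1 + k) ^ 4

/-- The parameter `b` of the wave on the orbit `q = (k, r)`. -/
def bOf (c : ℝ) (q : ℝ × ℝ) : ℝ := c ^ 2 * (q.1 - q.1 ^ 2 + q.2 ^ 2) / (1 + q.1) ^ 2

theorem hasDerivAt_aOf (c : ℝ) {k : ℝ} (hk : 1 / 3 < k) :
    HasDerivAt (aOf c) (-(c ^ 4 * (3 * k - 1) / (1 + k) ^ 5)) k := by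
  have h : 1 + k ≠ 0 := by linarith
  have h1 := ((hasDerivAt_id k).const_mul (c ^ 4)).div (((hasDerivAt_id k).const_add 1).pow 4)
    (pow_ne_zero 4 h)
  refine h1.congr_deriv ?_
  simp only [id, Pi.pow_apply]
  field_simp
  push_cast
  ring

theorem aOf_deriv_neg {c k : ℝ} (hc : 0 < c) (hk : 1 / 3 < k) :
    -(c ^ 4 * (3 * k - 1) / (1 + k) ^ 5) < 0 := by
  have h : 0 < 1 + k := by linarith
  have h' : 0 < 3 * k - 1 := by linarith
  rw [neg_lt_zero]
  positivity

theorem aOf_lt_aOf {c k k' : ℝ} (hc : 0 < c) (hk : 1 / 3 < k) (h : k < k') :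
    aOf c k' < aOf c k := by
  have : StrictAntiOn (aOf c) (Icc k k') := by
    refine strictAntiOn_of_deriv_neg (convex_Icc k k') (fun s hs =>
      (hasDerivAt_aOf c (hk.trans_le hs.1)).continuousAt.continuousWithinAt) fun s hs => ?_
    rw [interior_Icc] at hs
    rw [(hasDerivAt_aOf c (hk.trans hs.1)).deriv]
    exact aOf_deriv_neg hc (hk.trans hs.1)
  exact this (left_mem_Icc.mpr h.le) (right_mem_Icc.mpr h.le) h

theorem aOf_pos {c k : ℝ} (hc : 0 < c) (hk : 1 / 3 < k) : 0 < aOf c k := by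
  have h : 0 < k := by linarith
  rw [aOf]
  positivity

/-- The function k/(1 + k)⁴ has its maximum 27/256 at k = 1/3, a double root of the difference. -/
theorem aOf_lt_max {c k : ℝ} (hc : 0 < c) (hk : 1 / 3 < k) : aOf c k < 27 / 256 * c ^ 4 := by
  have h : 0 < k := by linarith
  rw [aOf, div_lt_iff₀ (by positivity)]
  have h1 : 0 < c ^ 4 := by positivity
  have h2 : k < 27 / 256 * (1 + k) ^ 4 := by
    have e : 27 / 256 * (1 + k) ^ 4 - k = 27 / 256 * (k - 1 / 3) ^ 2 * (k ^ 2 + 14 / 3 * k + 9) := by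
      ring
    have : 0 < 27 / 256 * (k - 1 / 3) ^ 2 * (k ^ 2 + 14 / 3 * k + 9) :=
      mul_pos (mul_pos (by norm_num) (pow_pos (by linarith) 2)) (by positivity)
    linarith
  nlinarith

/-- The speeds and parameters `(c, k)` of waves. -/
def paramDomain : Set (ℝ × ℝ) := {p | 0 < p.1 ∧ 1 / 3 < p.2}

theorem exists_kOf : IsOpen ((fun p : ℝ × ℝ => (p.1, aOf p.1 p.2)) '' paramDomain) ∧
    ∃ g : ℝ × ℝ → ℝ, ContDiffOn ℝ ∞ g ((fun p : ℝ × ℝ => (p.1, aOf p.1 p.2)) '' paramDomain) ∧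
      ∀ p ∈ paramDomain, g (p.1, aOf p.1 p.2) = p.2 := by
  have hopen : IsOpen paramDomain :=
    (isOpen_lt continuous_const continuous_fst).inter (isOpen_lt continuous_const continuous_snd)
  have hsm : ContDiffOn ℝ ∞ (fun p : ℝ × ℝ => aOf p.1 p.2) paramDomain := by
    have h1 : ContDiff ℝ ∞ fun p : ℝ × ℝ => p.1 ^ 4 * p.2 := by fun_prop
    have h2 : ContDiff ℝ ∞ fun p : ℝ × ℝ => (1 + p.2) ^ 4 := by fun_prop
    refine h1.contDiffOn.div h2.contDiffOn fun p hp => ?_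
    have : 0 < 1 + p.2 := by linarith [hp.2]
    positivity
  refine exists_fiber_inverse hopen hsm (fun p hp => ?_) fun c k k' h h' he => ?_
  · have h1 := hasDerivAt_comp_curve (γ := fun s => (p.1, s)) hopen hsm
      ((hasDerivAt_const p.2 p.1).prodMk (hasDerivAt_id p.2)) hp
    exact (h1.unique (hasDerivAt_aOf p.1 hp.2)).trans_ne (aOf_deriv_neg hp.1 hp.2).ne
  · rcases lt_trichotomy k k' with h1 | h1 | h1
    · exact absurd he (aOf_lt_aOf h.1 h.2 h1).ne'
    · exact h1
    · exact absurd he (aOf_lt_aOf h.1 h'.2 h1).ne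

/-- The parameter `k` of the well of the waves with parameter `a`. -/
def kOf (c a : ℝ) : ℝ := exists_kOf.2.choose (c, a)

theorem kOf_aOf {c k : ℝ} (hc : 0 < c) (hk : 1 / 3 < k) : kOf c (aOf c k) = k :=
  exists_kOf.2.choose_spec.2 (c, k) ⟨hc, hk⟩

theorem contDiffAt_kOf {c k : ℝ} (hc : 0 < c) (hk : 1 / 3 < k) :
    ContDiffAt ℝ ∞ (kOf c) (aOf c k) := by
  have h := exists_kOf.2.choose_spec.1.contDiffAt (exists_kOf.1.mem_nhds ⟨(c, k), ⟨hc, hk⟩, rfl⟩)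
  exact h.comp (aOf c k) (f := fun a => (c, a)) (by fun_prop)

/-- The end point of the curve of waves of period `L`. -/
def aMax (c L : ℝ) : ℝ := aOf c (kMin L)

theorem exists_aOf_eq {c k₀ a : ℝ} (hc : 0 < c) (hk₀ : 1 / 3 < k₀) (ha : a ∈ Ioo 0 (aOf c k₀)) :
    ∃ k > k₀, aOf c k = a := by
  -- Large enough that c⁴ < aK, whence `aOf c K` ≤ a.
  set K := max k₀ (c ^ 4 / a + 1)
  have hK : c ^ 4 / a + 1 ≤ K := le_max_right _ _
  have hK0 : k₀ ≤ K := le_max_left _ _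
  have hd : 0 ≤ c ^ 4 / a := div_nonneg (by positivity) ha.1.le
  have h1 : aOf c K ≤ a := by
    have h2 : c ^ 4 < a * K := by
      have := mul_le_mul_of_nonneg_left hK ha.1.le
      rw [mul_add, mul_div_cancel₀ _ ha.1.ne'] at this
      linarith [ha.1]
    rw [aOf, div_le_iff₀ (by positivity)]
    have hK1 : 1 ≤ K := by linarith
    have h3 : K ^ 2 ≤ (1 + K) ^ 4 := by
      calc K ^ 2 ≤ (1 + K) ^ 2 := by gcongr; linarith
        _ ≤ (1 + K) ^ 4 := pow_le_pow_right₀ (by linarith) (by norm_num)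
    calc c ^ 4 * K ≤ a * K * K := by gcongr
      _ = a * K ^ 2 := by ring
      _ ≤ a * (1 + K) ^ 4 := by gcongr; exact ha.1.le
  have hc' : ContinuousOn (aOf c) (Icc k₀ K) := fun s hs =>
    (hasDerivAt_aOf c (hk₀.trans_le hs.1)).continuousAt.continuousWithinAt
  obtain ⟨k, hk, hk'⟩ := intermediate_value_Icc' hK0 hc' ⟨h1, ha.2.le⟩
  refine ⟨k, lt_of_le_of_ne hk.1 ?_, hk'⟩
  rintro rfl
  exact ha.2.ne hk'.symm

/-! ### The curve of orbits of period L, parametrized by a -/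

section Curve

variable {c L a : ℝ}

theorem aMax_mem (hc : 0 < c) (hL : 0 < L) : aMax c L ∈ Ioo 0 (27 / 256 * c ^ 4) :=
  ⟨aOf_pos hc (kMin_gt hL), aOf_lt_max hc (kMin_gt hL)⟩

theorem kOf_gt (hc : 0 < c) (hL : 0 < L) (ha : a ∈ Ioo 0 (aMax c L)) : kMin L < kOf c a := by
  obtain ⟨k, hk, rfl⟩ := exists_aOf_eq hc (kMin_gt hL) ha
  rwa [kOf_aOf hc ((kMin_gt hL).trans hk)]

theorem aOf_kOf (hc : 0 < c) (hL : 0 < L) (ha : a ∈ Ioo 0 (aMax c L)) : aOf c (kOf c a) = a := by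
  obtain ⟨k, hk, rfl⟩ := exists_aOf_eq hc (kMin_gt hL) ha
  rw [kOf_aOf hc ((kMin_gt hL).trans hk)]

theorem contDiffAt_kOf_of_mem (hc : 0 < c) (hL : 0 < L) (ha : a ∈ Ioo 0 (aMax c L)) :
    ContDiffAt ℝ ∞ (kOf c) a := by
  have := contDiffAt_kOf hc ((kMin_gt hL).trans (kOf_gt hc hL ha))
  rwa [aOf_kOf hc hL ha] at this

theorem tendsto_kOf (hc : 0 < c) (hL : 0 < L) :
    Tendsto (kOf c) (𝓝[<] aMax c L) (𝓝[>] kMin L) := by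
  have h1 : ContinuousAt (kOf c) (aMax c L) := (contDiffAt_kOf hc (kMin_gt hL)).continuousAt
  have h2 : kOf c (aMax c L) = kMin L := kOf_aOf hc (kMin_gt hL)
  refine tendsto_nhdsWithin_iff.mpr ⟨?_, ?_⟩
  · have := h1.tendsto.mono_left (nhdsWithin_le_nhds (s := Iio (aMax c L)))
    rwa [h2] at this
  · filter_upwards [Ioo_mem_nhdsLT (aMax_mem hc hL).1] with a ha
    exact kOf_gt hc hL ha

/-- The orbit of the wave of period `L` with parameter `a`. -/
def orbitOf (c L a : ℝ) : ℝ × ℝ := (kOf c a, radius L (kOf c a))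

theorem orbitOf_mem (hc : 0 < c) (hL : 0 < L) (ha : a ∈ Ioo 0 (aMax c L)) :
    orbitOf c L a ∈ orbitDomain := radius_mem hL (kOf_gt hc hL ha)

theorem orbitOf_pos (hc : 0 < c) (hL : 0 < L) (ha : a ∈ Ioo 0 (aMax c L)) :
    0 < (orbitOf c L a).2 := radius_pos hL (kOf_gt hc hL ha)

theorem period_orbitOf (hc : 0 < c) (hL : 0 < L) (ha : a ∈ Ioo 0 (aMax c L)) :
    period (orbitOf c L a) = L := period_radius hL (kOf_gt hc hL ha)

theorem contDiffOn_orbitOf (hc : 0 < c) (hL : 0 < L) :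
    ContDiffOn ℝ ∞ (orbitOf c L) (Ioo 0 (aMax c L)) := by
  intro a ha
  refine ContDiffAt.contDiffWithinAt ?_
  have h1 := contDiffAt_kOf_of_mem hc hL ha
  have h2 : ContDiffAt ℝ ∞ (radius L) (kOf c a) :=
    (contDiffOn_radius hL).contDiffAt (Ioi_mem_nhds (kOf_gt hc hL ha))
  exact h1.prodMk (h2.comp a h1)

theorem contDiffOn_bOf (c : ℝ) : ContDiffOn ℝ ∞ (bOf c) orbitDomain := by
  have h1 : ContDiff ℝ ∞ fun q : ℝ × ℝ => c ^ 2 * (q.1 - q.1 ^ 2 + q.2 ^ 2) := by fun_prop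
  have h2 : ContDiff ℝ ∞ fun q : ℝ × ℝ => (1 + q.1) ^ 2 := by fun_prop
  refine h1.contDiffOn.div h2.contDiffOn fun q hq => ?_
  have : 0 < 1 + q.1 := by linarith [lt_of_mem_ampRange (k := q.1) (s := q.2) hq.1]
  positivity

theorem contDiffOn_bOf_orbitOf (hc : 0 < c) (hL : 0 < L) :
    ContDiffOn ℝ ∞ (fun a => bOf c (orbitOf c L a)) (Ioo 0 (aMax c L)) :=
  (contDiffOn_bOf c).comp (contDiffOn_orbitOf hc hL) fun _ ha => orbitOf_mem hc hL ha

theorem tendsto_bOf_orbitOf (hc : 0 < c) (hL : 0 < L) :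
    Tendsto (fun a => bOf c (orbitOf c L a)) (𝓝[<] aMax c L) (𝓝 (bOf c (kMin L, 0))) := by
  have hb : ContinuousAt (bOf c) (kMin L, 0) := (contDiffOn_bOf c).continuousOn.continuousAt
    (isOpen_orbitDomain.mem_nhds (zero_mem_orbitDomain (kMin_gt hL)))
  have h1 := tendsto_kOf hc hL
  exact hb.tendsto.comp ((h1.mono_right nhdsWithin_le_nhds).prodMk_nhds ((tendsto_radius hL).comp h1))

theorem boundary_mem {k : ℝ} (hc : 0 < c) (hk : 1 / 3 < k) :
    (aOf c k, bOf c (k, 0)) ∈ constantWaveBoundary c := by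
  have h : 0 < 1 + k := by linarith
  -- The constant wave p inverting k = p/(c - p).
  refine ⟨c * k / (1 + k), ⟨?_, ?_⟩, ?_⟩
  · rw [div_lt_div_iff₀ (by norm_num) h]
    nlinarith
  · rw [div_lt_iff₀ h]
    nlinarith
  · simp only [aOf, bOf, Prod.mk.injEq]
    constructor
    · field_simp
      ring
    · field_simp
      ring

end Curve

/-! ## The waves -/

/-- The wave of speed `c` on the orbit `q`, as a function of `(q, x)`. -/
def wave (c : ℝ) (p : (ℝ × ℝ) × ℝ) : ℝ := c - c / (1 + p.1.1) * profile p

/-- The derivative of the wave. -/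
def wave₁ (c : ℝ) (p : (ℝ × ℝ) × ℝ) : ℝ := -(c / (1 + p.1.1) * (p.1.2 * Real.sin (angle p)))

section Wave

variable {c : ℝ} {q : ℝ × ℝ}

theorem one_add_pos_of_mem (hq : q ∈ orbitDomain) : 0 < 1 + q.1 := by
  linarith [lt_of_mem_ampRange (k := q.1) (s := q.2) hq.1]

theorem contDiffOn_wave (c : ℝ) : ContDiffOn ℝ ∞ (wave c) phaseDomain := by
  have h2 : ContDiff ℝ ∞ fun p : (ℝ × ℝ) × ℝ => 1 + p.1.1 := by fun_prop
  exact contDiffOn_const.sub ((contDiffOn_const.div h2.contDiffOn fun p hp =>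
    (one_add_pos_of_mem hp.1).ne').mul contDiffOn_profile)

theorem hasDerivAt_wave (c : ℝ) (hq : q ∈ orbitDomain) (x : ℝ) :
    HasDerivAt (fun x => wave c (q, x)) (wave₁ c (q, x)) x :=
  ((hasDerivAt_profile hq x).const_mul (c / (1 + q.1))).const_sub c

theorem profile_pos (hq : q ∈ orbitDomain) (x : ℝ) : 0 < profile (q, x) :=
  (mem_wellDomain_profile hq x).2.1

theorem wave_lt (hc : 0 < c) (hq : q ∈ orbitDomain) (x : ℝ) : wave c (q, x) < c := by
  have h1 := one_add_pos_of_mem hq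
  have h2 := profile_pos hq x
  have : 0 < c / (1 + q.1) * profile (q, x) := by positivity
  simp only [wave]
  linarith

/-- The second-order profile equation is taken from the equation of τ rather than from the
invariant, which determines φ'' only where φ' ≠ 0. -/
theorem hasDerivAt_wave₁ (hc : 0 < c) (hq : q ∈ orbitDomain) (x : ℝ) :
    HasDerivAt (fun x => wave₁ c (q, x))
      (wave c (q, x) - aOf c q.1 / (c - wave c (q, x)) ^ 3) x := by
  have h1 := one_add_pos_of_mem hq
  have h2 := profile_pos hq x
  refine ((hasDerivAt_profile₁ hq x).const_mul (c / (1 + q.1))).neg.congr_deriv ?_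
  simp only [wave, wellPoly, aOf, sub_sub_cancel]
  field_simp
  ring

theorem wave_invariant (c : ℝ) (hq : q ∈ orbitDomain) (x : ℝ) :
    (c - wave c (q, x)) ^ 2 * (wave₁ c (q, x) ^ 2 - wave c (q, x) ^ 2 - bOf c q) + aOf c q.1
      = 0 := by
  have h1 := one_add_pos_of_mem hq
  have h2 := profile_pos hq x
  have h3 := profile_energy hq x
  have h4 : (q.2 * Real.sin (angle (q, x))) ^ 2 = q.2 ^ 2 - (1 - profile (q, x)) ^ 2 *
      wellFactor q.1 (profile (q, x)) / profile (q, x) ^ 2 := by linarith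
  have h5 : wave₁ c (q, x) ^ 2 = (c / (1 + q.1)) ^ 2 * (q.2 * Real.sin (angle (q, x))) ^ 2 := by
    rw [wave₁]
    ring
  rw [h5, h4]
  simp only [wave, wellFactor, aOf, bOf, sub_sub_cancel]
  field_simp
  ring

theorem wave_neg (c : ℝ) (hq : q ∈ orbitDomain) (x : ℝ) : wave c (q, -x) = wave c (q, x) := by
  simp only [wave, profile_neg hq]

theorem wave_add_period (c : ℝ) (hq : q ∈ orbitDomain) (x : ℝ) :
    wave c (q, x + period q) = wave c (q, x) := by
  simp only [wave, profile_add_period hq]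

theorem isWave_of_orbit {L : ℝ} (hc : 0 < c) (hq : q ∈ orbitDomain) (hr : 0 < q.2)
    (hL : period q = L) {φ : HInfPer L} (hφ : ∀ x, φ x = wave c (q, x)) :
    IsWave c (aOf c q.1) (bOf c q) L φ where
  lt_speed x := by
    rw [hφ]
    exact wave_lt hc hq x
  invariant x := by
    have : φ.toFun = fun x => wave c (q, x) := funext hφ
    rw [this, (hasDerivAt_wave c hq x).deriv]
    exact wave_invariant c hq x
  -- A period T would return the amplitude to its minimum -r, so the cosine of the angle would be 1
  -- at T. But the angle increases strictly from 0 to 2π on [0, L].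
  fundamental T hT hper := by
    have h1 := hper 0
    rw [hφ, hφ, zero_add] at h1
    have h0 := one_add_pos_of_mem hq
    have hz : c / (1 + q.1) ≠ 0 := by positivity
    have h2 : profile (q, T) = profile (q, 0) := by
      simp only [wave] at h1
      exact mul_left_cancel₀ hz (by linarith)
    have h3 := amp_profile hq T
    rw [h2, amp_profile hq 0, angle_zero hq] at h3
    have h4 : Real.cos (angle (q, T)) = 1 := by
      have := mul_left_cancel₀ (neg_ne_zero.mpr hr.ne') h3
      rw [← this, Real.cos_zero]
    have h5 := strictMono_angle hq hT.1
    have h6 := strictMono_angle hq hT.2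
    have h7 := angle_add_period hq 0
    simp only [zero_add, angle_zero hq, hL] at h5 h6 h7
    rw [h7] at h6
    obtain ⟨n, hn⟩ := (Real.cos_eq_one_iff _).mp h4
    rw [← hn] at h5 h6
    have h8 : (0 : ℝ) < n := pos_of_mul_pos_left h5 Real.two_pi_pos.le
    have h9 : (n : ℝ) < 1 := lt_of_mul_lt_mul_right (by linarith) Real.two_pi_pos.le
    have h10 : 0 < n := by exact_mod_cast h8
    have h11 : n < 1 := by exact_mod_cast h9
    omega

end Wave

/-! ## Mass and energy -/

/-- The moments `∮ (τ - 1)^j dx` of the normalized profile. -/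
def moment (j : ℕ) : ℝ × ℝ → ℝ := avg fun p => (ampInv p - 1) ^ j * ampInv₁ p

theorem contDiffOn_moment_integrand (j : ℕ) :
    ContDiffOn ℝ ∞ (fun p => (ampInv p - 1) ^ j * ampInv₁ p) ampRange :=
  ((contDiffOn_ampInv.sub contDiffOn_const).pow j).mul contDiffOn_ampInv₁

theorem contDiffOn_moment (j : ℕ) : ContDiffOn ℝ ∞ (moment j) orbitDomain :=
  contDiffOn_avg (contDiffOn_moment_integrand j)

theorem integral_profile_pow {q : ℝ × ℝ} (hq : q ∈ orbitDomain) (j : ℕ) :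
    ∫ x in (0 : ℝ)..period q, (profile (q, x) - 1) ^ j = moment j q :=
  integral_profile hq (f := fun t => (t - 1) ^ j) (by fun_prop)

section Mass

variable {c L : ℝ} {q : ℝ × ℝ} {φ : HInfPer L}

theorem continuous_profile (hq : q ∈ orbitDomain) : Continuous fun x => profile (q, x) :=
  continuous_iff_continuousAt.mpr fun x => (hasDerivAt_profile hq x).continuousAt

theorem mass_eq (hq : q ∈ orbitDomain) (hL : period q = L) (hφ : ∀ x, φ x = wave c (q, x)) :
    mass φ = c / (1 + q.1) * (q.1 * L - moment 1 q) := by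
  have h1 := one_add_pos_of_mem hq
  have h2 : ∀ x, φ x = c / (1 + q.1) * (q.1 - (profile (q, x) - 1) ^ 1) := by
    intro x
    rw [hφ, wave]
    field_simp
    ring
  have hc := continuous_profile hq
  have hi : ∀ j : ℕ, IntervalIntegrable (fun x => (profile (q, x) - 1) ^ j) volume 0 L := fun j =>
    Continuous.intervalIntegrable (by fun_prop) _ _
  simp only [mass, h2]
  rw [intervalIntegral.integral_const_mul, intervalIntegral.integral_sub
    intervalIntegrable_const (hi 1), ← integral_profile_pow hq, hL]
  simp [mul_comm]

/-- The numerator of the ratio of the energy and the cube of the mass. -/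
def cubicMoment (q : ℝ × ℝ) : ℝ :=
  q.1 ^ 3 * period q - 3 * q.1 ^ 2 * moment 1 q + 3 * q.1 * moment 2 q - moment 3 q

theorem energy_eq (hq : q ∈ orbitDomain) (hL : period q = L) (hφ : ∀ x, φ x = wave c (q, x)) :
    energy φ = (c / (1 + q.1)) ^ 3 / 6 * cubicMoment q := by
  have h1 := one_add_pos_of_mem hq
  have h2 : ∀ x, φ x ^ 3 = (c / (1 + q.1)) ^ 3 * (q.1 ^ 3 - 3 * q.1 ^ 2 * (profile (q, x) - 1) ^ 1 +
      3 * q.1 * (profile (q, x) - 1) ^ 2 - (profile (q, x) - 1) ^ 3) := by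
    intro x
    have : φ x = c / (1 + q.1) * (q.1 - (profile (q, x) - 1)) := by
      rw [hφ, wave]
      field_simp
      ring
    rw [this]
    ring
  have hc := continuous_profile hq
  have hi : ∀ (m : ℝ) (j : ℕ), IntervalIntegrable (fun x => m * (profile (q, x) - 1) ^ j)
      volume 0 L := fun m j => Continuous.intervalIntegrable (by fun_prop) _ _
  have hi' := fun j => (hi 1 j).congr (g := fun x => (profile (q, x) - 1) ^ j)
    (by intro x _; simp)
  simp only [energy, h2]
  rw [intervalIntegral.integral_const_mul, intervalIntegral.integral_sub
    ((intervalIntegrable_const.sub (hi _ 1)).add (hi _ 2)) (hi' 3),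
    intervalIntegral.integral_add (intervalIntegrable_const.sub (hi _ 1)) (hi _ 2),
    intervalIntegral.integral_sub intervalIntegrable_const (hi _ 1),
    intervalIntegral.integral_const_mul, intervalIntegral.integral_const_mul, cubicMoment,
    ← integral_profile_pow hq, ← integral_profile_pow hq, ← integral_profile_pow hq, hL]
  simp only [intervalIntegral.integral_const, smul_eq_mul, sub_zero]
  ring

end Mass

/-! ## Derivatives along the curve of orbits of a given period -/

/-- The derivative of `avg g` along the curve of orbits of a given period, in the parameter `k`. -/
def curveDeriv (g : ℝ × ℝ → ℝ) (q : ℝ × ℝ) : ℝ :=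
  dirDeriv (1, 0) (avg g) q -
    avgSin (dirDeriv (0, 1) (dirDeriv (0, 1) g)) q * dirDeriv (1, 0) period q / periodSlope q

section Curve

variable {g : ℝ × ℝ → ℝ} {L k : ℝ}

/-- There is no division by r, so the derivative along the curve is continuous up to the constant
waves r = 0. -/
theorem continuousOn_curveDeriv (hg : ContDiffOn ℝ ∞ g ampRange) :
    ContinuousOn (curveDeriv g) orbitDomain := by
  have hg2 := contDiffOn_dirDeriv isOpen_ampRange
    (contDiffOn_dirDeriv isOpen_ampRange hg (0, 1)) (0, 1)
  exact (contDiffOn_dirDeriv isOpen_orbitDomain (contDiffOn_avg hg) _).continuousOn.sub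
    (((contDiffOn_avgSin hg2).continuousOn.mul
      (contDiffOn_dirDeriv isOpen_orbitDomain contDiffOn_period _).continuousOn).div
      contDiffOn_periodSlope.continuousOn fun q hq => (periodSlope_pos hq).ne')

theorem hasDerivAt_along {G : ℝ × ℝ → ℝ} (hL : 0 < L) (hk : kMin L < k)
    (hG : ContDiffOn ℝ ∞ G orbitDomain) :
    HasDerivAt (fun k => G (k, radius L k)) (dirDeriv (1, 0) G (k, radius L k) +
      deriv (radius L) k * dirDeriv (0, 1) G (k, radius L k)) k := by
  have h1 : HasDerivAt (radius L) (deriv (radius L) k) k :=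
    (((contDiffOn_radius hL).contDiffAt (Ioi_mem_nhds hk)).differentiableAt (by simp)).hasDerivAt
  refine (hasDerivAt_comp_curve isOpen_orbitDomain hG ((hasDerivAt_id k).prodMk h1)
    (radius_mem hL hk)).congr_deriv ?_
  rw [← dirDeriv_smul, ← dirDeriv_add]
  simp

/-- Differentiation of the identity T(k, `radius L k`) = L. -/
theorem deriv_radius (hL : 0 < L) (hk : kMin L < k) :
    dirDeriv (1, 0) period (k, radius L k) +
      deriv (radius L) k * (radius L k * periodSlope (k, radius L k)) = 0 := by
  have h1 := hasDerivAt_along hL hk contDiffOn_period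
  rw [dirDeriv_snd_period (radius_mem hL hk)] at h1
  have h2 : (fun k => period (k, radius L k)) =ᶠ[𝓝 k] fun _ => L := by
    filter_upwards [Ioi_mem_nhds hk] with s hs
    exact period_radius hL hs
  exact h1.unique ((hasDerivAt_const k L).congr_of_eventuallyEq h2)

theorem hasDerivAt_avg_along (hL : 0 < L) (hk : kMin L < k) (hg : ContDiffOn ℝ ∞ g ampRange) :
    HasDerivAt (fun k => avg g (k, radius L k)) (curveDeriv g (k, radius L k)) k := by
  refine (hasDerivAt_along hL hk (contDiffOn_avg hg)).congr_deriv ?_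
  have hm := radius_mem hL hk
  have h1 := deriv_radius hL hk
  have h2 := (periodSlope_pos hm).ne'
  rw [dirDeriv_snd_avg hg hm, curveDeriv]
  simp only
  field_simp
  linear_combination avgSin (dirDeriv (0, 1) (dirDeriv (0, 1) g)) (k, radius L k) * h1

theorem dirDeriv_fst_avg_zero (hg : ContDiffOn ℝ ∞ g ampRange) {f : ℝ → ℝ} {f' : ℝ}
    (hk : 1 / 3 < k) (h : ∀ s, 1 / 3 < s → g (s, 0) = f s) (hf : HasDerivAt f f' k) :
    dirDeriv (1, 0) (avg g) (k, 0) = 2 * Real.pi * f' := by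
  have h1 := hasDerivAt_fst isOpen_orbitDomain (contDiffOn_avg hg) (zero_mem_orbitDomain hk)
  have h2 : (fun s => avg g (s, 0)) =ᶠ[𝓝 k] fun s => 2 * Real.pi * f s := by
    filter_upwards [Ioi_mem_nhds hk] with s hs
    rw [avg_zero, h s hs]
  exact h1.unique ((hf.const_mul _).congr_of_eventuallyEq h2)

end Curve

/-! ## Values at constant waves -/

section Constant

variable {k : ℝ}

theorem dirDeriv_fst_period_zero (hk : 1 / 3 < k) :
    dirDeriv (1, 0) period (k, 0) =
      -(3 * Real.pi) * (Real.sqrt (3 * k - 1))⁻¹ / (3 * k - 1) := by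
  have h : 0 < 3 * k - 1 := by linarith
  have h1 : HasDerivAt (fun s => (Real.sqrt (3 * s - 1))⁻¹)
      (-((3 * 1) / (2 * Real.sqrt (3 * k - 1))) / Real.sqrt (3 * k - 1) ^ 2) k :=
    ((((hasDerivAt_id k).const_mul 3).sub_const 1).sqrt h.ne').inv (Real.sqrt_pos.mpr h).ne'
  rw [period, dirDeriv_fst_avg_zero contDiffOn_ampInv₁ hk (fun s hs => ampInv₁_zero hs) h1,
    Real.sq_sqrt h.le]
  have := (Real.sqrt_pos.mpr h).ne'
  field_simp

theorem dirDeriv_ampInv₁_zero (hk : 1 / 3 < k) :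
    dirDeriv (0, 1) ampInv₁ (k, 0) = 4 * k / (3 * k - 1) ^ 2 := by
  have h : 3 * k - 1 ≠ 0 := by linarith
  rw [dirDeriv_ampInv₁ (zero_mem_ampRange hk), ampInv_zero hk, slopeSq₁, wellPoly,
    show k * (1 + 1 + 1 ^ 2) - 1 ^ 3 = 3 * k - 1 by ring,
    div_div, div_eq_div_iff (by positivity) (by positivity)]
  ring

theorem periodSlope_zero (hk : 1 / 3 < k) : periodSlope (k, 0) =
    Real.pi * (15 * k * (k + 1) / (3 * k - 1) ^ 3) * (Real.sqrt (3 * k - 1))⁻¹ := by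
  have h : 3 * k - 1 ≠ 0 := by linarith
  have h1 : slopeSq₂ k 1 = 30 * k * (k + 1) / (3 * k - 1) ^ 3 := by
    rw [slopeSq₂, wellPoly, show k * (1 + 1 + 1 ^ 2) - 1 ^ 3 = 3 * k - 1 by ring,
      div_eq_div_iff (by positivity) (by positivity)]
    ring
  rw [periodSlope, avgSin_zero, dirDeriv_dirDeriv_ampInv₁ (zero_mem_ampRange hk), ampInv_zero hk,
    ampInv₁_zero hk, h1]
  ring

theorem dirDeriv_moment_integrand (j : ℕ) {s : ℝ} (h : (k, s) ∈ ampRange) :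
    dirDeriv (0, 1) (fun p => (ampInv p - 1) ^ j * ampInv₁ p) (k, s) =
      j * (ampInv (k, s) - 1) ^ (j - 1) * ampInv₁ (k, s) * ampInv₁ (k, s) +
        (ampInv (k, s) - 1) ^ j * dirDeriv (0, 1) ampInv₁ (k, s) :=
  (hasDerivAt_snd isOpen_ampRange (contDiffOn_moment_integrand j) h).unique
    ((((hasDerivAt_ampInv h).sub_const 1).pow j).mul
      (hasDerivAt_snd isOpen_ampRange contDiffOn_ampInv₁ h))

/-- The Leibniz rule at τ = 1, with h(0) - 1 = 0. The truncated exponents are harmless: where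
truncation occurs the factor j or j - 1 vanishes. -/
theorem dirDeriv_dirDeriv_moment_integrand_zero (j : ℕ) (hk : 1 / 3 < k) :
    dirDeriv (0, 1) (dirDeriv (0, 1) (fun p => (ampInv p - 1) ^ j * ampInv₁ p)) (k, 0) =
      j * ((j - 1 : ℕ) * 0 ^ (j - 1 - 1)) * ampInv₁ (k, 0) ^ 3 +
        3 * j * 0 ^ (j - 1) * ampInv₁ (k, 0) * dirDeriv (0, 1) ampInv₁ (k, 0) +
        0 ^ j * dirDeriv (0, 1) (dirDeriv (0, 1) ampInv₁) (k, 0) := by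
  have h := zero_mem_ampRange hk
  have h1 := hasDerivAt_snd isOpen_ampRange (contDiffOn_dirDeriv isOpen_ampRange
    (contDiffOn_moment_integrand j) (0, 1)) h
  have e1 := (hasDerivAt_ampInv h).sub_const 1
  have e2 := hasDerivAt_snd isOpen_ampRange contDiffOn_ampInv₁ h
  have e3 := hasDerivAt_snd isOpen_ampRange
    (contDiffOn_dirDeriv isOpen_ampRange contDiffOn_ampInv₁ (0, 1)) h
  have h2 := (((((e1.pow (j - 1)).const_mul (j : ℝ)).mul e2).mul e2).add ((e1.pow j).mul e3))
  have h3 : (fun s => dirDeriv (0, 1) (fun p => (ampInv p - 1) ^ j * ampInv₁ p) (k, s)) =ᶠ[𝓝 0]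
      fun s => j * (ampInv (k, s) - 1) ^ (j - 1) * ampInv₁ (k, s) * ampInv₁ (k, s) +
        (ampInv (k, s) - 1) ^ j * dirDeriv (0, 1) ampInv₁ (k, s) := by
    filter_upwards [eventually_mem_ampRange h] with s hs
    exact dirDeriv_moment_integrand j hs
  rw [h1.unique (h2.congr_of_eventuallyEq h3)]
  simp only [ampInv_zero hk, sub_self, Pi.mul_apply, Pi.pow_apply]
  ring

/-- The derivatives of the moments along the curve. -/
def momentDeriv (j : ℕ) : ℝ × ℝ → ℝ := curveDeriv fun p => (ampInv p - 1) ^ j * ampInv₁ p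

theorem moment_zero {j : ℕ} (hj : j ≠ 0) (hk : 1 / 3 < k) : moment j (k, 0) = 0 := by
  rw [moment, avg_zero, ampInv_zero hk, sub_self, zero_pow hj]
  ring

/-- The moment vanishes identically at r = 0, so only the variation of the radius contributes. The
last factor is -π ∂ₖT/`periodSlope` at r = 0. -/
theorem momentDeriv_zero {j : ℕ} (hj : j ≠ 0) (hk : 1 / 3 < k) : momentDeriv j (k, 0) =
    dirDeriv (0, 1) (dirDeriv (0, 1) (fun p => (ampInv p - 1) ^ j * ampInv₁ p)) (k, 0) *
      ((3 * k - 1) ^ 2 * Real.pi / (5 * k * (k + 1))) := by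
  have h : 0 < 3 * k - 1 := by linarith
  have h0 : 0 < k := by linarith
  have hs := Real.sqrt_pos.mpr h
  rw [momentDeriv, curveDeriv, dirDeriv_fst_avg_zero (f := fun _ => 0) (f' := 0)
    (contDiffOn_moment_integrand j) hk (fun s hs => ?_) (hasDerivAt_const k 0),
    avgSin_zero, dirDeriv_fst_period_zero hk, periodSlope_zero hk]
  · field_simp
    ring
  · rw [ampInv_zero hs, sub_self, zero_pow hj, zero_mul]

theorem momentDeriv_one_zero (hk : 1 / 3 < k) :
    momentDeriv 1 (k, 0) = 12 * Real.pi / (5 * (k + 1)) * (Real.sqrt (3 * k - 1))⁻¹ := by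
  have h : 0 < 3 * k - 1 := by linarith
  have h0 : 0 < k := by linarith
  have hs := Real.sqrt_pos.mpr h
  rw [momentDeriv_zero one_ne_zero hk, dirDeriv_dirDeriv_moment_integrand_zero 1 hk,
    dirDeriv_ampInv₁_zero hk, ampInv₁_zero hk]
  simp
  field_simp
  ring

theorem momentDeriv_two_zero_pos (hk : 1 / 3 < k) : 0 < momentDeriv 2 (k, 0) := by
  have h : 0 < 3 * k - 1 := by linarith
  have h0 : 0 < k := by linarith
  have hs := Real.sqrt_pos.mpr h
  rw [momentDeriv_zero two_ne_zero hk, dirDeriv_dirDeriv_moment_integrand_zero 2 hk,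
    ampInv₁_zero hk]
  simp
  positivity

/-- The integrand has a triple zero at the centre, so its second derivative vanishes there. -/
theorem momentDeriv_three_zero (hk : 1 / 3 < k) : momentDeriv 3 (k, 0) = 0 := by
  rw [momentDeriv_zero three_ne_zero hk, dirDeriv_dirDeriv_moment_integrand_zero 3 hk]
  simp

end Constant

/-! ## Monotonicity near constant waves -/

/-- The sign of the derivative of the mass along the curve, in the parameter `k`. -/
def massSlope (q : ℝ × ℝ) : ℝ := period q + moment 1 q - (1 + q.1) * momentDeriv 1 q

/-- The derivative of the cubic moment along the curve. -/
def cubicSlope (q : ℝ × ℝ) : ℝ :=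
  3 * q.1 ^ 2 * period q - 6 * q.1 * moment 1 q - 3 * q.1 ^ 2 * momentDeriv 1 q + 3 * moment 2 q +
    3 * q.1 * momentDeriv 2 q - momentDeriv 3 q

/-- The sign of the derivative of the ratio of the energy and the cube of the mass along the curve,
in the parameter `k`. -/
def ratioSlope (q : ℝ × ℝ) : ℝ :=
  cubicSlope q * (q.1 * period q - moment 1 q) - 3 * cubicMoment q * (period q - momentDeriv 1 q)

theorem continuousOn_momentDeriv (j : ℕ) : ContinuousOn (momentDeriv j) orbitDomain :=
  continuousOn_curveDeriv (contDiffOn_moment_integrand j)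

theorem continuousOn_massSlope : ContinuousOn massSlope orbitDomain := by
  have h1 := contDiffOn_period.continuousOn
  have h2 := (contDiffOn_moment 1).continuousOn
  have h3 := continuousOn_momentDeriv 1
  unfold massSlope
  fun_prop

theorem continuousOn_ratioSlope : ContinuousOn ratioSlope orbitDomain := by
  have h1 := contDiffOn_period.continuousOn
  have h2 := fun j => (contDiffOn_moment j).continuousOn
  have h3 := continuousOn_momentDeriv
  have a1 := h2 1
  have a2 := h2 2
  have a3 := h2 3
  have b1 := h3 1
  have b2 := h3 2
  have b3 := h3 3
  unfold ratioSlope cubicSlope cubicMoment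
  fun_prop

/-- In units of 1/√(3k - 1) the period contributes 2π and the first moment -12π/5, which leaves
-2π/5. -/
theorem massSlope_zero_neg {k : ℝ} (hk : 1 / 3 < k) : massSlope (k, 0) < 0 := by
  have h : 0 < 3 * k - 1 := by linarith
  have hs := inv_pos.mpr (Real.sqrt_pos.mpr h)
  have h1 : 1 + k ≠ 0 := by linarith
  have e : massSlope (k, 0) = -(2 / 5 * Real.pi * (Real.sqrt (3 * k - 1))⁻¹) := by
    rw [massSlope, moment_zero one_ne_zero hk, momentDeriv_one_zero hk, period_zero hk, add_comm k]
    field_simp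
    ring
  rw [e, neg_lt_zero]
  positivity

/-- All first-order terms cancel, because F/M³ is constant on constant waves of fixed period. What
remains is the growth of the second moment ∮ (τ - 1)². -/
theorem ratioSlope_zero_pos {k : ℝ} (hk : 1 / 3 < k) : 0 < ratioSlope (k, 0) := by
  have h0 : 0 < k := by linarith
  have e : ratioSlope (k, 0) = 3 * k ^ 2 * period (k, 0) * momentDeriv 2 (k, 0) := by
    simp only [ratioSlope, cubicSlope, cubicMoment, moment_zero one_ne_zero hk,
      moment_zero two_ne_zero hk, moment_zero three_ne_zero hk, momentDeriv_three_zero hk]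
    ring
  rw [e]
  have := momentDeriv_two_zero_pos hk
  have := period_pos (zero_mem_orbitDomain hk)
  positivity

/-- The `(a, b)` for which mass and energy are monotone along the curve of waves. -/
def monotoneSet (c : ℝ) : Set (ℝ × ℝ) :=
  interior {z | ∀ q ∈ orbitDomain, 0 < q.2 → z = (aOf c q.1, bOf c q) →
    massSlope q < 0 ∧ 0 < ratioSlope q}

/-- The orbit (k, r) is a continuous function of (a, b) up to the boundary, so the strict signs at r
= 0 hold in a neighbourhood in the (a, b)-plane. -/
theorem boundary_subset_monotoneSet {c : ℝ} (hc : 0 < c) :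
    constantWaveBoundary c ⊆ monotoneSet c := by
  rintro z ⟨p, hp, rfl⟩
  have hcp : 0 < c - p := by linarith [hp.2]
  set k := p / (c - p)
  have hk : 1 / 3 < k := by
    rw [div_lt_div_iff₀ (by norm_num) hcp]
    linarith [hp.1]
  have h1k : 0 < 1 + k := by linarith
  have hkp : 1 + k = c / (c - p) := by
    simp only [k]
    field_simp
    ring
  have ha : p * (c - p) ^ 3 = aOf c k := by
    rw [aOf, hkp]
    simp only [k]
    field_simp
  have hb : c * p - 2 * p ^ 2 = bOf c (k, 0) := by
    rw [bOf]
    simp only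
    rw [hkp]
    simp only [k]
    field_simp
    ring
  have hm := zero_mem_orbitDomain hk
  have hmem : orbitDomain ∈ 𝓝 ((k, 0) : ℝ × ℝ) := isOpen_orbitDomain.mem_nhds hm
  have h1 : ∀ᶠ q in 𝓝 ((k, 0) : ℝ × ℝ), massSlope q < 0 :=
    (continuousOn_massSlope.continuousAt hmem).eventually_lt_const (massSlope_zero_neg hk)
  have h2 : ∀ᶠ q in 𝓝 ((k, 0) : ℝ × ℝ), 0 < ratioSlope q :=
    (continuousOn_ratioSlope.continuousAt hmem).eventually_const_lt (ratioSlope_zero_pos hk)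
  -- The inverse of (k, r) ↦ (a, b): k is recovered from a, and r² from b by solving the formula of
  -- `bOf`. The square root keeps it continuous at r = 0.
  set ι : ℝ × ℝ → ℝ × ℝ := fun z => (kOf c z.1, Real.sqrt
    (z.2 * (1 + kOf c z.1) ^ 2 / c ^ 2 - kOf c z.1 + kOf c z.1 ^ 2))
  have hι : ∀ q ∈ orbitDomain, 0 < q.2 → ι (aOf c q.1, bOf c q) = q := by
    intro q hq hr
    have hq1 := lt_of_mem_ampRange (k := q.1) (s := q.2) hq.1
    have h3 := one_add_pos_of_mem hq
    simp only [ι, kOf_aOf hc hq1]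
    refine Prod.ext rfl ?_
    have e : bOf c q * (1 + q.1) ^ 2 / c ^ 2 - q.1 + q.1 ^ 2 = q.2 ^ 2 := by
      rw [bOf]
      field_simp
      ring
    simp only [e]
    exact Real.sqrt_sq hr.le
  have hι0 : ι (aOf c k, bOf c (k, 0)) = (k, 0) := by
    simp only [ι, kOf_aOf hc hk]
    refine Prod.ext rfl ?_
    have e : bOf c (k, 0) * (1 + k) ^ 2 / c ^ 2 - k + k ^ 2 = 0 := by
      rw [bOf]
      field_simp
      ring
    simp only [e, Real.sqrt_zero]
  have hιc : ContinuousAt ι (aOf c k, bOf c (k, 0)) := by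
    have e1 : ContinuousAt (fun z : ℝ × ℝ => kOf c z.1) (aOf c k, bOf c (k, 0)) :=
      ContinuousAt.comp (g := kOf c) (f := Prod.fst) (contDiffAt_kOf hc hk).continuousAt
        continuousAt_fst
    refine e1.prodMk (Real.continuous_sqrt.continuousAt.comp ?_)
    fun_prop
  rw [ha, hb, monotoneSet, mem_interior_iff_mem_nhds]
  have h3 := hιc.tendsto
  rw [hι0] at h3
  filter_upwards [h3.eventually (h1.and h2)] with z hz q hq hr hzq
  rwa [hzq, hι q hq hr] at hz

/-! ### Monotonicity of mass and energy ratio in a -/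

section Signs

variable {c L a : ℝ}

theorem deriv_kOf_neg (hc : 0 < c) (hL : 0 < L) (ha : a ∈ Ioo 0 (aMax c L)) :
    deriv (kOf c) a < 0 := by
  have h1 : HasDerivAt (kOf c) (deriv (kOf c) a) a :=
    ((contDiffAt_kOf_of_mem hc hL ha).differentiableAt (by simp)).hasDerivAt
  have hk := (kMin_gt hL).trans (kOf_gt hc hL ha)
  have h2 := (hasDerivAt_aOf c hk).comp a h1
  have h3 : (aOf c ∘ kOf c) =ᶠ[𝓝 a] fun x => x := by
    filter_upwards [isOpen_Ioo.mem_nhds ha] with s hs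
    exact aOf_kOf hc hL hs
  have h4 := h2.unique ((hasDerivAt_id a).congr_of_eventuallyEq h3)
  have h5 := aOf_deriv_neg hc hk
  by_contra h
  have := mul_nonpos_of_nonpos_of_nonneg h5.le (not_lt.mp h)
  linarith

/-- The wave is positive exactly where τ < 1 + k. This holds in the whole well, since `wellPoly k (1
+ k)` = -1. -/
theorem wave_pos (hc : 0 < c) {q : ℝ × ℝ} (hq : q ∈ orbitDomain) (x : ℝ) :
    0 < wave c (q, x) := by
  have h1 := one_add_pos_of_mem hq
  have h2 := mem_wellDomain_profile hq x
  have h3 : profile (q, x) < 1 + q.1 := by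
    by_contra h
    have := (wellDomain_of_le h2 h1 (not_lt.mp h)).2.2
    simp only [wellPoly] at this
    nlinarith
  have : wave c (q, x) = c / (1 + q.1) * (1 + q.1 - profile (q, x)) := by
    rw [wave]
    field_simp
  rw [this]
  exact mul_pos (by positivity) (by linarith)

theorem mass_pos (hc : 0 < c) (hL : 0 < L) {q : ℝ × ℝ} (hq : q ∈ orbitDomain) {φ : HInfPer L}
    (hφ : ∀ x, φ x = wave c (q, x)) : 0 < mass φ :=
  intervalIntegral.intervalIntegral_pos_of_pos (φ.smooth.continuous.intervalIntegrable _ _)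
    (fun x => by
      have := wave_pos hc hq x
      rwa [← hφ] at this) hL

theorem hasDerivAt_moment_along (j : ℕ) {k : ℝ} (hL : 0 < L) (hk : kMin L < k) :
    HasDerivAt (fun k => moment j (k, radius L k)) (momentDeriv j (k, radius L k)) k :=
  hasDerivAt_avg_along hL hk (contDiffOn_moment_integrand j)

theorem hasDerivAt_mass_along (c : ℝ) {k : ℝ} (hL : 0 < L) (hk : kMin L < k) :
    HasDerivAt (fun k => c / (1 + k) * (k * L - moment 1 (k, radius L k)))
      (c / (1 + k) ^ 2 * massSlope (k, radius L k)) k := by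
  have h : 1 + k ≠ 0 := by linarith [kMin_gt hL]
  have h1 := ((hasDerivAt_const k c).div ((hasDerivAt_id k).const_add 1) h).mul
    (((hasDerivAt_id k).mul_const L).sub (hasDerivAt_moment_along 1 hL hk))
  refine h1.congr_deriv ?_
  simp only [massSlope, period_radius hL hk, id, Pi.div_apply, Pi.sub_apply]
  field_simp
  ring

theorem hasDerivAt_ratio_along {k : ℝ} (hL : 0 < L) (hk : kMin L < k)
    (hne : k * L - moment 1 (k, radius L k) ≠ 0) :
    HasDerivAt (fun k => cubicMoment (k, radius L k) / (k * L - moment 1 (k, radius L k)) ^ 3)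
      (ratioSlope (k, radius L k) / (k * L - moment 1 (k, radius L k)) ^ 4) k := by
  have hm1 := hasDerivAt_moment_along 1 hL hk
  have hm2 := hasDerivAt_moment_along 2 hL hk
  have hm3 := hasDerivAt_moment_along 3 hL hk
  have hid := hasDerivAt_id k
  have h1 : HasDerivAt (fun k => cubicMoment (k, radius L k)) (cubicSlope (k, radius L k)) k := by
    have e : (fun k => cubicMoment (k, radius L k)) =ᶠ[𝓝 k] fun k =>
        k ^ 3 * L - 3 * k ^ 2 * moment 1 (k, radius L k) + 3 * k * moment 2 (k, radius L k) -
          moment 3 (k, radius L k) := by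
      filter_upwards [Ioi_mem_nhds hk] with s hs
      simp only [cubicMoment, period_radius hL hs]
    have h2 := (((((hid.pow 3).mul_const L).sub (((hid.pow 2).const_mul 3).mul hm1)).add
      ((hid.const_mul 3).mul hm2)).sub hm3)
    refine (h2.congr_of_eventuallyEq e).congr_deriv ?_
    simp only [cubicSlope, period_radius hL hk, id, Pi.pow_apply]
    push_cast
    ring
  have h2 := ((hid.mul_const L).sub hm1).pow 3
  refine (h1.div h2 (pow_ne_zero 3 hne)).congr_deriv ?_
  simp only [ratioSlope, period_radius hL hk, id, Pi.sub_apply, Pi.pow_apply]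
  rw [div_eq_div_iff (by positivity) (by positivity)]
  push_cast
  ring

variable {Φ : ℝ → HInfPer L}

theorem mass_curve (hc : 0 < c) (hL : 0 < L)
    (hΦ : ∀ a ∈ Ioo 0 (aMax c L), ∀ x, Φ a x = wave c (orbitOf c L a, x))
    (ha : a ∈ Ioo 0 (aMax c L)) : mass (Φ a) = c / (1 + kOf c a) *
      (kOf c a * L - moment 1 (kOf c a, radius L (kOf c a))) :=
  mass_eq (orbitOf_mem hc hL ha) (period_orbitOf hc hL ha) (hΦ a ha)

theorem moment_lt (hc : 0 < c) (hL : 0 < L)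
    (hΦ : ∀ a ∈ Ioo 0 (aMax c L), ∀ x, Φ a x = wave c (orbitOf c L a, x))
    (ha : a ∈ Ioo 0 (aMax c L)) : 0 < kOf c a * L - moment 1 (kOf c a, radius L (kOf c a)) := by
  have h1 := mass_pos hc hL (orbitOf_mem hc hL ha) (hΦ a ha)
  rw [mass_curve hc hL hΦ ha] at h1
  have h2 := one_add_pos_of_mem (orbitOf_mem hc hL ha)
  exact pos_of_mul_pos_right h1 (div_nonneg hc.le h2.le)

theorem ratio_curve (hc : 0 < c) (hL : 0 < L)
    (hΦ : ∀ a ∈ Ioo 0 (aMax c L), ∀ x, Φ a x = wave c (orbitOf c L a, x))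
    (ha : a ∈ Ioo 0 (aMax c L)) : energy (Φ a) / mass (Φ a) ^ 3 =
      1 / 6 * (cubicMoment (kOf c a, radius L (kOf c a)) /
        (kOf c a * L - moment 1 (kOf c a, radius L (kOf c a))) ^ 3) := by
  have h2 : 0 < 1 + kOf c a := one_add_pos_of_mem (orbitOf_mem hc hL ha)
  have h3 := (moment_lt hc hL hΦ ha).ne'
  have h4 : energy (Φ a) = (c / (1 + kOf c a)) ^ 3 / 6 *
      cubicMoment (kOf c a, radius L (kOf c a)) :=
    energy_eq (orbitOf_mem hc hL ha) (period_orbitOf hc hL ha) (hΦ a ha)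
  rw [h4, mass_curve hc hL hΦ ha]
  field_simp

/-- The slopes are taken in k, and k decreases in a, which reverses both signs. Openness of
`monotoneSet` gives the signs on an interval around a and not only at a. -/
theorem monotone_near (hc : 0 < c) (hL : 0 < L)
    (hΦ : ∀ a ∈ Ioo 0 (aMax c L), ∀ x, Φ a x = wave c (orbitOf c L a, x))
    (ha : a ∈ Ioo 0 (aMax c L)) (hU : (a, bOf c (orbitOf c L a)) ∈ monotoneSet c) :
    StrictDecrNear (fun s => energy (Φ s) / mass (Φ s) ^ 3) a ∧
      StrictIncrNear (fun s => mass (Φ s)) a := by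
  have hBc : ContinuousAt (fun s => (s, bOf c (orbitOf c L s))) a :=
    continuousAt_id.prodMk ((contDiffOn_bOf_orbitOf hc hL).continuousOn.continuousAt
      (isOpen_Ioo.mem_nhds ha))
  have h1 : ∀ᶠ s in 𝓝 a, (s, bOf c (orbitOf c L s)) ∈ monotoneSet c :=
    hBc.eventually_mem (isOpen_interior.mem_nhds hU)
  obtain ⟨δ, hδ, hball⟩ := Metric.eventually_nhds_iff_ball.mp
    (h1.and (isOpen_Ioo.mem_nhds ha))
  rw [Real.ball_eq_Ioo] at hball
  have hsign : ∀ s ∈ Ioo (a - δ) (a + δ), massSlope (orbitOf c L s) < 0 ∧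
      0 < ratioSlope (orbitOf c L s) := by
    intro s hs
    obtain ⟨hs1, hs2⟩ := hball s hs
    refine interior_subset hs1 _ (orbitOf_mem hc hL hs2) (orbitOf_pos hc hL hs2) ?_
    rw [show (orbitOf c L s).1 = kOf c s from rfl, aOf_kOf hc hL hs2]
  have hkd : ∀ s ∈ Ioo (a - δ) (a + δ), HasDerivAt (kOf c) (deriv (kOf c) s) s := fun s hs =>
    ((contDiffAt_kOf_of_mem hc hL (hball s hs).2).differentiableAt (by simp)).hasDerivAt
  have hmem : ∀ s ∈ Ioo (a - δ) (a + δ), ∀ᶠ s' in 𝓝 s, s' ∈ Ioo 0 (aMax c L) := fun s hs =>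
    isOpen_Ioo.mem_nhds (hball s hs).2
  refine ⟨⟨δ, hδ, ?_⟩, ⟨δ, hδ, ?_⟩⟩
  · have hd : ∀ s ∈ Ioo (a - δ) (a + δ), ∃ d < 0,
        HasDerivAt (fun s => energy (Φ s) / mass (Φ s) ^ 3) d s := by
      intro s hs
      have hs2 := (hball s hs).2
      have h2 := moment_lt hc hL hΦ hs2
      refine ⟨_, ?_, (((hasDerivAt_ratio_along hL (kOf_gt hc hL hs2) h2.ne').comp s
        (hkd s hs)).const_mul (1 / 6)).congr_of_eventuallyEq ?_⟩
      · have := deriv_kOf_neg hc hL hs2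
        have h3 : 0 < ratioSlope (kOf c s, radius L (kOf c s)) := (hsign s hs).2
        exact mul_neg_of_pos_of_neg (by norm_num) (mul_neg_of_pos_of_neg (by positivity) this)
      · filter_upwards [hmem s hs] with s' hs'
        exact ratio_curve hc hL hΦ hs'
    refine strictAntiOn_of_deriv_neg (convex_Ioo _ _) (fun s hs => ?_) fun s hs => ?_
    · obtain ⟨d, -, hd⟩ := hd s hs
      exact hd.continuousAt.continuousWithinAt
    · rw [interior_Ioo] at hs
      obtain ⟨d, hd0, hd⟩ := hd s hs
      rwa [hd.deriv]
  · have hd : ∀ s ∈ Ioo (a - δ) (a + δ), ∃ d > 0, HasDerivAt (fun s => mass (Φ s)) d s := by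
      intro s hs
      have hs2 := (hball s hs).2
      refine ⟨_, ?_, ((hasDerivAt_mass_along c hL (kOf_gt hc hL hs2)).comp s
        (hkd s hs)).congr_of_eventuallyEq ?_⟩
      · have := deriv_kOf_neg hc hL hs2
        have h3 : massSlope (kOf c s, radius L (kOf c s)) < 0 := (hsign s hs).1
        have h4 : 0 < 1 + kOf c s := one_add_pos_of_mem (orbitOf_mem hc hL hs2)
        exact mul_pos_of_neg_of_neg (mul_neg_of_pos_of_neg (by positivity) h3) this
      · filter_upwards [hmem s hs] with s' hs'
        exact mass_curve hc hL hΦ hs'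
    refine strictMonoOn_of_deriv_pos (convex_Ioo _ _) (fun s hs => ?_) fun s hs => ?_
    · obtain ⟨d, -, hd⟩ := hd s hs
      exact hd.continuousAt.continuousWithinAt
    · rw [interior_Ioo] at hs
      obtain ⟨d, hd0, hd⟩ := hd s hs
      rwa [hd.deriv]

end Signs

/-! ## The Hill operator of a wave -/

/-- An even periodic wave profile with derivative `φ₁`, with crest at `0` and trough at `L / 2`. -/
structure IsProfile (c a b L : ℝ) (φ φ₁ : ℝ → ℝ) : Prop where
  lt : ∀ x, φ x < c
  hasDerivAt : ∀ x, HasDerivAt φ (φ₁ x) x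
  hasDerivAt₁ : ∀ x, HasDerivAt φ₁ (φ x - a / (c - φ x) ^ 3) x
  invariant : ∀ x, φ₁ x ^ 2 = φ x ^ 2 + b - a / (c - φ x) ^ 2
  even : ∀ x, φ (-x) = φ x
  periodic : Function.Periodic φ L
  neg : ∀ x ∈ Ioo 0 (L / 2), φ₁ x < 0
  crest : φ 0 - a / (c - φ 0) ^ 3 < 0
  trough : 0 < φ (L / 2) - a / (c - φ (L / 2)) ^ 3

/-- An infinitesimal variation `η` of a wave profile, with variation `(δa, δb)` of the
parameters. -/
structure IsVariation (c a δa δb : ℝ) (φ φ₁ η η₁ : ℝ → ℝ) : Prop where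
  hasDerivAt : ∀ x, HasDerivAt η (η₁ x) x
  hasDerivAt₁ : ∀ x, HasDerivAt η₁
    (η x - 3 * a * η x / (c - φ x) ^ 4 - δa / (c - φ x) ^ 3) x
  invariant : ∀ x, 2 * φ₁ x * η₁ x =
    2 * φ x * η x + δb - δa / (c - φ x) ^ 2 - 2 * a * η x / (c - φ x) ^ 3

/-- The potential of the Hill operator. -/
def hillPotential (c : ℝ) (φ : ℝ → ℝ) (x : ℝ) : ℝ := 4 - 3 * c / (c - φ x)

section Hill

variable {c a b L δa δb : ℝ} {φ φ₁ η η₁ : ℝ → ℝ}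

theorem IsProfile.sub_pos (h : IsProfile c a b L φ φ₁) (x : ℝ) : 0 < c - φ x := by
  linarith [h.lt x]

theorem IsProfile.continuous (h : IsProfile c a b L φ φ₁) : Continuous φ :=
  continuous_iff_continuousAt.mpr fun x => (h.hasDerivAt x).continuousAt

theorem IsProfile.odd (h : IsProfile c a b L φ φ₁) (x : ℝ) : φ₁ (-x) = -φ₁ x := by
  have h1 := (h.hasDerivAt (-x)).comp x (hasDerivAt_neg x)
  have h2 : φ ∘ (fun x => -x) = φ := funext h.even
  rw [show (Neg.neg : ℝ → ℝ) = fun x => -x from rfl, h2] at h1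
  have := h1.unique (h.hasDerivAt x)
  linarith

theorem IsProfile.periodic₁ (h : IsProfile c a b L φ φ₁) : Function.Periodic φ₁ L := by
  intro x
  have h1 := (h.hasDerivAt (x + L)).comp_add_const x L
  have h2 : (fun x => φ (x + L)) = φ := funext h.periodic
  rw [h2] at h1
  exact h1.unique (h.hasDerivAt x)

theorem IsProfile.deriv_zero (h : IsProfile c a b L φ φ₁) : φ₁ 0 = 0 := by
  have := h.odd 0
  rw [neg_zero] at this
  linarith

theorem IsProfile.deriv_half (h : IsProfile c a b L φ φ₁) : φ₁ (L / 2) = 0 := by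
  have h1 := h.odd (L / 2)
  have h2 := h.periodic₁ (-(L / 2))
  rw [show -(L / 2) + L = L / 2 by ring] at h2
  linarith

theorem IsProfile.pos (h : IsProfile c a b L φ φ₁) {x : ℝ} (hx : x ∈ Ioo (L / 2) L) :
    0 < φ₁ x := by
  have h1 := h.neg (L - x) ⟨by linarith [hx.2], by linarith [hx.1]⟩
  have h2 := h.periodic₁ (-x)
  rw [show -x + L = L - x by ring, h.odd] at h2
  linarith

theorem IsProfile.continuous_potential (h : IsProfile c a b L φ φ₁) :
    Continuous (hillPotential c φ) := by
  have := h.continuous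
  exact continuous_const.sub (continuous_const.div (by fun_prop) fun x => (h.sub_pos x).ne')

theorem IsProfile.potential_neg (h : IsProfile c a b L φ φ₁) (x : ℝ) :
    hillPotential c φ (-x) = hillPotential c φ x := by
  simp only [hillPotential, h.even]

/-- The variation given by translations. -/
theorem IsProfile.isVariation (h : IsProfile c a b L φ φ₁) :
    IsVariation c a 0 0 φ φ₁ φ₁ (fun x => φ x - a / (c - φ x) ^ 3) where
  hasDerivAt := h.hasDerivAt₁
  hasDerivAt₁ x := by
    have h0 := (h.sub_pos x).ne'
    have h1 := (h.hasDerivAt x).sub (((hasDerivAt_const x a).div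
      (((h.hasDerivAt x).const_sub c).pow 3) (pow_ne_zero 3 h0)))
    refine h1.congr_deriv ?_
    simp only [Pi.pow_apply]
    field_simp
    push_cast
    ring
  invariant x := by
    have h0 := (h.sub_pos x).ne'
    field_simp
    ring

/-- A variation solves the inhomogeneous Hill equation. -/
theorem IsVariation.hasDerivAt_hill (h : IsProfile c a b L φ φ₁)
    (hη : IsVariation c a δa δb φ φ₁ η η₁) (x : ℝ) :
    HasDerivAt (fun x => (c - φ x) * η x) ((c - φ x) * η₁ x - φ₁ x * η x) x := by
  refine (((h.hasDerivAt x).const_sub c).mul (hη.hasDerivAt x)).congr_deriv ?_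
  ring

theorem IsVariation.hasDerivAt_hill₁ (h : IsProfile c a b L φ φ₁)
    (hη : IsVariation c a δa δb φ φ₁ η η₁) (x : ℝ) :
    HasDerivAt (fun x => (c - φ x) * η₁ x - φ₁ x * η x)
      (4 * ((c - φ x) * η x) - 3 * c * η x - δb) x := by
  refine ((((h.hasDerivAt x).const_sub c).mul (hη.hasDerivAt₁ x)).sub
    ((h.hasDerivAt₁ x).mul (hη.hasDerivAt x))).congr_deriv ?_
  have h0 := (h.sub_pos x).ne'
  have h1 := hη.invariant x
  -- The linearized invariant is used to eliminate δb; otherwise the φ' η' terms would remain.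
  have e : δb = 2 * φ₁ x * η₁ x - 2 * φ x * η x + δa / (c - φ x) ^ 2 +
      2 * a * η x / (c - φ x) ^ 3 := by linarith
  rw [e]
  field_simp
  ring

/-- Variations at fixed b give solutions of the homogeneous Hill equation. Translations are one,
with δa = 0 as well. -/
theorem IsVariation.hasDerivAt_hill_zero (h : IsProfile c a b L φ φ₁)
    (hη : IsVariation c a δa 0 φ φ₁ η η₁) (x : ℝ) :
    HasDerivAt (fun x => (c - φ x) * η₁ x - φ₁ x * η x)
      (hillPotential c φ x * ((c - φ x) * η x)) x := by
  refine (hη.hasDerivAt_hill₁ h x).congr_deriv ?_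
  have h0 := (h.sub_pos x).ne'
  rw [hillPotential]
  field_simp
  ring

/-- The quadratic form of the Hill operator is nonnegative on functions which vanish at two
consecutive critical points of the profile. -/
theorem hill_nonneg_of_critical (h : IsProfile c a b L φ φ₁) {α β : ℝ} (hαβ : α < β)
    (hα : φ₁ α = 0) (hβ : φ₁ β = 0) (hα' : φ α - a / (c - φ α) ^ 3 ≠ 0)
    (hβ' : φ β - a / (c - φ β) ^ 3 ≠ 0) (hne : ∀ x ∈ Ioo α β, φ₁ x ≠ 0) {f f₁ : ℝ → ℝ}
    (hf : ∀ x, HasDerivAt f (f₁ x) x) (hf₁ : Continuous f₁) (hfα : f α = 0) (hfβ : f β = 0) :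
    0 ≤ ∫ x in α..β, (f₁ x ^ 2 + hillPotential c φ x * f x ^ 2) := by
  have hη := h.isVariation
  -- The Hill solution (c - φ)φ' has simple zeros at both ends, where f vanishes too, so the
  -- boundary terms in Picone's inequality disappear.
  have hz : ∀ x, φ₁ x = 0 → φ x - a / (c - φ x) ^ 3 ≠ 0 → f x = 0 →
      Tendsto (fun x => ((c - φ x) * (φ x - a / (c - φ x) ^ 3) - φ₁ x * φ₁ x) * f x ^ 2 /
        ((c - φ x) * φ₁ x)) (𝓝[≠] x) (𝓝 0) := by
    intro x h1 h2 h3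
    refine tendsto_picone_of_zero (hη.hasDerivAt_hill h x) (hη.hasDerivAt_hill_zero h x).continuousAt
      (hf x) (by rw [h1, mul_zero]) ?_ h3
    rw [h1, mul_zero, sub_zero]
    exact mul_ne_zero (h.sub_pos x).ne' h2
  have := picone_le_integral hαβ h.continuous_potential (hη.hasDerivAt_hill h)
    (hη.hasDerivAt_hill_zero h) (fun x hx => mul_ne_zero (h.sub_pos x).ne' (hne x hx)) hf hf₁
    ((hz α hα hα' hfα).mono_left (nhdsWithin_mono _ fun x hx => ne_of_gt hx))
    ((hz β hβ hβ' hfβ).mono_left (nhdsWithin_mono _ fun x hx => ne_of_lt hx))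
  linarith

theorem IsProfile.continuous_form (h : IsProfile c a b L φ φ₁) {f f₁ : ℝ → ℝ}
    (hf : ∀ x, HasDerivAt f (f₁ x) x) (hf₁ : Continuous f₁) :
    Continuous fun x => f₁ x ^ 2 + hillPotential c φ x * f x ^ 2 := by
  have h1 := h.continuous_potential
  have h2 : Continuous f := continuous_iff_continuousAt.mpr fun x => (hf x).continuousAt
  fun_prop

/-- The Hill form has at most two negative directions. -/
theorem hill_nonneg_of_vanish (hL : 0 < L) (h : IsProfile c a b L φ φ₁) {f f₁ : ℝ → ℝ}
    (hf : ∀ x, HasDerivAt f (f₁ x) x) (hf₁ : Continuous f₁) (hper : Function.Periodic f L)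
    (h0 : f 0 = 0) (h1 : f (L / 2) = 0) :
    0 ≤ ∫ x in (0 : ℝ)..L, (f₁ x ^ 2 + hillPotential c φ x * f x ^ 2) := by
  have hc := h.continuous_form hf hf₁
  rw [← intervalIntegral.integral_add_adjacent_intervals (hc.intervalIntegrable 0 (L / 2))
    (hc.intervalIntegrable _ _)]
  have hfL : f L = 0 := by
    have := hper 0
    rwa [zero_add, h0] at this
  have hφL : φ L = φ 0 := by
    have := h.periodic 0
    rwa [zero_add] at this
  have hφL₁ : φ₁ L = 0 := by
    have := h.periodic₁ 0
    rwa [zero_add, h.deriv_zero] at this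
  refine add_nonneg ?_ ?_
  · exact hill_nonneg_of_critical h (by linarith) h.deriv_zero h.deriv_half h.crest.ne h.trough.ne'
      (fun x hx => (h.neg x hx).ne) hf hf₁ h0 h1
  · exact hill_nonneg_of_critical h (by linarith) h.deriv_half hφL₁ h.trough.ne'
      (by rw [hφL]; exact h.crest.ne) (fun x hx => (h.pos hx).ne') hf hf₁ h1 hfL

/-- The Hill form is nonnegative on even functions which vanish at the zero of an even solution of
the Hill equation, if the latter is monotone at the trough. -/
theorem exists_hill_nonneg_even (hL : 0 < L) (h : IsProfile c a b L φ φ₁)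
    (hη : IsVariation c a δa 0 φ φ₁ η η₁) (h0 : η 0 < 0) (h0' : η₁ 0 = 0)
    (h1 : 0 ≤ η₁ (L / 2)) : ∃ x₀, ∀ f f₁ : ℝ → ℝ, (∀ x, HasDerivAt f (f₁ x) x) →
      Continuous f₁ → f x₀ = 0 →
      0 ≤ ∫ x in (0 : ℝ)..(L / 2), (f₁ x ^ 2 + hillPotential c φ x * f x ^ 2) := by
  set y : ℝ → ℝ := fun x => (c - φ x) * η x
  set y₁ : ℝ → ℝ := fun x => (c - φ x) * η₁ x - φ₁ x * η x
  have hy : ∀ x, HasDerivAt y (y₁ x) x := hη.hasDerivAt_hill h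
  have hy₁ : ∀ x, HasDerivAt y₁ (hillPotential c φ x * y x) x := hη.hasDerivAt_hill_zero h
  set z : ℝ → ℝ := fun x => (c - φ x) * φ₁ x
  set z₁ : ℝ → ℝ := fun x => (c - φ x) * (φ x - a / (c - φ x) ^ 3) - φ₁ x * φ₁ x
  have hz : ∀ x, HasDerivAt z (z₁ x) x := h.isVariation.hasDerivAt_hill h
  have hz₁ : ∀ x, HasDerivAt z₁ (hillPotential c φ x * z x) x :=
    h.isVariation.hasDerivAt_hill_zero h
  have hyc : Continuous y := continuous_iff_continuousAt.mpr fun x => (hy x).continuousAt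
  -- The Wronskian of the two Hill solutions is constant.
  have hW : ∀ x, y x * z₁ x - y₁ x * z x = y 0 * z₁ 0 - y₁ 0 * z 0 := by
    intro x
    have hd : ∀ x, HasDerivAt (fun x => y x * z₁ x - y₁ x * z x) 0 x := fun x =>
      (((hy x).mul (hz₁ x)).sub ((hy₁ x).mul (hz x))).congr_deriv (by ring)
    exact is_const_of_deriv_eq_zero (fun x => (hd x).differentiableAt) (fun x => (hd x).deriv) x 0
  have hz0 : z 0 = 0 := by simp only [z, h.deriv_zero, mul_zero]
  have hzL : z (L / 2) = 0 := by simp only [z, h.deriv_half, mul_zero]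
  have hz10 : z₁ 0 < 0 := by
    simp only [z₁, h.deriv_zero, mul_zero, sub_zero]
    exact mul_neg_of_pos_of_neg (h.sub_pos 0) h.crest
  have hz1L : 0 < z₁ (L / 2) := by
    simp only [z₁, h.deriv_half, mul_zero, sub_zero]
    exact mul_pos (h.sub_pos _) h.trough
  have hy0 : y 0 < 0 := mul_neg_of_pos_of_neg (h.sub_pos 0) h0
  have hy10 : y₁ 0 = 0 := by simp only [y₁, h0', h.deriv_zero, mul_zero, zero_mul, sub_zero]
  have hy1L : 0 ≤ y₁ (L / 2) := by
    simp only [y₁, h.deriv_half, zero_mul, sub_zero]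
    exact mul_nonneg (h.sub_pos _).le h1
  set W := y 0 * z₁ 0
  have hWpos : 0 < W := mul_pos_of_neg_of_neg hy0 hz10
  simp only [hz0, mul_zero, sub_zero] at hW
  -- At the trough z = 0 and z' > 0, so y has there the sign of the Wronskian, opposite to its sign
  -- at the crest.
  have hyL : 0 < y (L / 2) := by
    have := hW (L / 2)
    rw [hzL, mul_zero, sub_zero] at this
    exact pos_of_mul_pos_left (by rw [this]; exact hWpos) hz1L.le
  have hzneg : ∀ x ∈ Ioo 0 (L / 2), z x < 0 := fun x hx =>
    mul_neg_of_pos_of_neg (h.sub_pos x) (h.neg x hx)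
  obtain ⟨x₀, hx₀, hx₀'⟩ := intermediate_value_Ioo (by linarith : (0 : ℝ) ≤ L / 2)
    hyc.continuousOn ⟨hy0, hyL⟩
  -- The derivative of y/z is -W/z², hence y has only one zero x₀ between crest and trough.
  have hanti : StrictAntiOn (fun x => y x / z x) (Ioo 0 (L / 2)) := by
    have hd : ∀ x ∈ Ioo 0 (L / 2), HasDerivAt (fun x => y x / z x) (-W / z x ^ 2) x := by
      intro x hx
      refine ((hy x).div (hz x) (hzneg x hx).ne).congr_deriv ?_
      rw [← hW x]
      ring
    refine strictAntiOn_of_deriv_neg (convex_Ioo _ _)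
      (fun x hx => (hd x hx).continuousAt.continuousWithinAt) fun x hx => ?_
    rw [interior_Ioo] at hx
    rw [(hd x hx).deriv, neg_div, neg_lt_zero]
    have := (hzneg x hx).ne
    positivity
  have huniq : ∀ x ∈ Ioo 0 (L / 2), x ≠ x₀ → y x ≠ 0 := by
    intro x hx hxx hyx
    refine hxx (hanti.injOn hx hx₀ ?_)
    simp only [hyx, hx₀', zero_div]
  have hy1x : y₁ x₀ ≠ 0 := by
    intro h2
    have := hW x₀
    rw [h2, hx₀', zero_mul, zero_mul, sub_zero] at this
    exact hWpos.ne this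
  refine ⟨x₀, fun f f₁ hf hf₁ hfx => ?_⟩
  have hfc : Continuous f := continuous_iff_continuousAt.mpr fun x => (hf x).continuousAt
  have hc := h.continuous_form hf hf₁
  have t0 := tendsto_picone_of_ne (y₁ := y₁) (hy 0).continuousAt (hy₁ 0).continuousAt
    (hfc.continuousAt (x := 0)) hy0.ne (Ioi 0)
  have tL := tendsto_picone_of_ne (y₁ := y₁) (hy (L / 2)).continuousAt (hy₁ (L / 2)).continuousAt
    (hfc.continuousAt (x := L / 2)) hyL.ne' (Iio (L / 2))
  have tx := tendsto_picone_of_zero (hy x₀) (hy₁ x₀).continuousAt (hf x₀) hx₀' hy1x hfx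
  have i1 := picone_le_integral hx₀.1 h.continuous_potential hy hy₁
    (fun x hx => huniq x ⟨hx.1, hx.2.trans hx₀.2⟩ hx.2.ne) hf hf₁ t0
    (tx.mono_left (nhdsWithin_mono _ fun x hx => ne_of_lt hx))
  have i2 := picone_le_integral hx₀.2 h.continuous_potential hy hy₁
    (fun x hx => huniq x ⟨hx₀.1.trans hx.1, hx.2⟩ hx.1.ne') hf hf₁
    (tx.mono_left (nhdsWithin_mono _ fun x hx => ne_of_gt hx)) tL
  rw [hy10, zero_mul, zero_div] at i1
  rw [← intervalIntegral.integral_add_adjacent_intervals (hc.intervalIntegrable 0 x₀)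
    (hc.intervalIntegrable _ _)]
  -- The boundary term at the crest vanishes since y' = 0 there, and those at x₀ vanish since f
  -- does. The one at the trough has the good sign because y' ≥ 0.
  have : 0 ≤ y₁ (L / 2) * f (L / 2) ^ 2 / y (L / 2) := by positivity
  linarith

/-- The Hill form has at most one negative direction if there is an even solution of the Hill
equation which is monotone at the trough. -/
theorem exists_hill_nonneg (hL : 0 < L) (h : IsProfile c a b L φ φ₁)
    (hη : IsVariation c a δa 0 φ φ₁ η η₁) (h0 : η 0 < 0) (h0' : η₁ 0 = 0)
    (h1 : 0 ≤ η₁ (L / 2)) : ∃ x₀, ∀ f f₁ : ℝ → ℝ, (∀ x, HasDerivAt f (f₁ x) x) →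
      Continuous f₁ → Function.Periodic f L → Function.Periodic f₁ L → f x₀ + f (-x₀) = 0 →
      0 ≤ ∫ x in (0 : ℝ)..L, (f₁ x ^ 2 + hillPotential c φ x * f x ^ 2) := by
  obtain ⟨x₀, hx₀⟩ := exists_hill_nonneg_even hL h hη h0 h0' h1
  refine ⟨x₀, fun f f₁ hf hf₁ hper hper₁ hfx => ?_⟩
  have hneg : ∀ x, HasDerivAt (fun x => f (-x)) (-f₁ (-x)) x := by
    intro x
    have := (hf (-x)).comp x (hasDerivAt_neg x)
    refine this.congr_deriv ?_
    ring
  set g : ℝ → ℝ := fun x => f₁ x ^ 2 + hillPotential c φ x * f x ^ 2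
  have hg : Continuous g := h.continuous_form hf hf₁
  have hgper : Function.Periodic g L := by
    intro x
    simp only [g, hper x, hper₁ x, hillPotential, h.periodic x]
  have e1 : ∫ x in (0 : ℝ)..L, g x = ∫ x in (0 : ℝ)..(L / 2), (g x + g (-x)) := by
    have e2 := hgper.intervalIntegral_add_eq 0 (-(L / 2))
    rw [zero_add, show -(L / 2) + L = L / 2 by ring] at e2
    have hgn : Continuous fun x => g (-x) := by fun_prop
    rw [e2, ← intervalIntegral.integral_add_adjacent_intervals (b := 0)
      (hg.intervalIntegrable _ _) (hg.intervalIntegrable _ _),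
      intervalIntegral.integral_add (hg.intervalIntegrable _ _) (hgn.intervalIntegrable _ _),
      intervalIntegral.integral_comp_neg, neg_zero, add_comm]
  -- The potential is even, so the form splits over the even and odd parts of f.
  have e3 : ∀ x, g x + g (-x) =
      2 * (((f₁ x - f₁ (-x)) / 2) ^ 2 + hillPotential c φ x * ((f x + f (-x)) / 2) ^ 2) +
      2 * (((f₁ x + f₁ (-x)) / 2) ^ 2 + hillPotential c φ x * ((f x - f (-x)) / 2) ^ 2) := by
    intro x
    simp only [g, h.potential_neg]
    ring
  have he : ∀ x, HasDerivAt (fun x => (f x + f (-x)) / 2) ((f₁ x - f₁ (-x)) / 2) x := fun x =>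
    ((hf x).add (hneg x)).div_const 2
  have ho : ∀ x, HasDerivAt (fun x => (f x - f (-x)) / 2) ((f₁ x + f₁ (-x)) / 2) x := fun x =>
    (((hf x).sub (hneg x)).div_const 2).congr_deriv (by ring)
  have hce : Continuous fun x => (f₁ x - f₁ (-x)) / 2 := by fun_prop
  have hco : Continuous fun x => (f₁ x + f₁ (-x)) / 2 := by fun_prop
  have i1 := hx₀ _ _ he hce (by rw [hfx, zero_div])
  -- The odd part vanishes at 0 and, by periodicity, at L/2, so it needs no condition; the condition
  -- at x₀ concerns only the even part.
  have i2 := hill_nonneg_of_critical h (by linarith : (0 : ℝ) < L / 2) h.deriv_zero h.deriv_half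
    h.crest.ne h.trough.ne' (fun x hx => (h.neg x hx).ne) ho hco (by simp) (by
      have := hper (-(L / 2))
      rw [show -(L / 2) + L = L / 2 by ring] at this
      rw [this, sub_self, zero_div])
  have c1 := h.continuous_form he hce
  have c2 := h.continuous_form ho hco
  simp only [g] at e1 e3
  rw [e1]
  simp only [e3]
  rw [intervalIntegral.integral_add (Continuous.intervalIntegrable (by fun_prop) _ _)
    (Continuous.intervalIntegrable (by fun_prop) _ _),
    intervalIntegral.integral_const_mul, intervalIntegral.integral_const_mul]
  positivity

/-- The quadratic form of the Hessian operator is bounded below by that of the Hill operator. -/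
theorem hill_le_hessian (h : IsProfile c a b L φ φ₁) {f f₁ f₂ : ℝ → ℝ}
    (hf : ∀ x, HasDerivAt f (f₁ x) x) (hf₁ : ∀ x, HasDerivAt f₁ (f₂ x) x) (hf₂ : Continuous f₂)
    (hper : Function.Periodic f L) (hper₁ : Function.Periodic f₁ L) (hL : 0 < L) :
    3 * c * ∫ x in (0 : ℝ)..L, (f₁ x ^ 2 + hillPotential c φ x * f x ^ 2) ≤
      ∫ x in (0 : ℝ)..L, ((c - φ x) * (4 * f x - f₂ x) ^ 2 - 3 * c * ((4 * f x - f₂ x) * f x)) := by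
  have cf : Continuous f := continuous_iff_continuousAt.mpr fun x => (hf x).continuousAt
  have cf₁ : Continuous f₁ := continuous_iff_continuousAt.mpr fun x => (hf₁ x).continuousAt
  have cφ := h.continuous
  have cV := h.continuous_potential
  have e1 : ∫ x in (0 : ℝ)..L, (f₁ x ^ 2 + f x * f₂ x) = 0 := by
    have h1 : ∀ x, HasDerivAt (fun x => f x * f₁ x) (f₁ x ^ 2 + f x * f₂ x) x := fun x =>
      ((hf x).mul (hf₁ x)).congr_deriv (by ring)
    rw [intervalIntegral.integral_eq_sub_of_hasDerivAt (fun x _ => h1 x)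
      (Continuous.intervalIntegrable (by fun_prop) _ _)]
    have h2 := hper 0
    have h3 := hper₁ 0
    rw [zero_add] at h2 h3
    rw [h2, h3, sub_self]
  have e2 : 3 * c * ∫ x in (0 : ℝ)..L, (f₁ x ^ 2 + hillPotential c φ x * f x ^ 2) =
      ∫ x in (0 : ℝ)..L, 3 * c * (hillPotential c φ x * f x ^ 2 - f x * f₂ x) := by
    rw [intervalIntegral.integral_const_mul, ← sub_eq_zero, ← mul_sub]
    have e3 := intervalIntegral.integral_sub (μ := volume) (a := 0) (b := L)
      (f := fun x => f₁ x ^ 2 + hillPotential c φ x * f x ^ 2)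
      (g := fun x => hillPotential c φ x * f x ^ 2 - f x * f₂ x)
      (Continuous.intervalIntegrable (by fun_prop) _ _)
      (Continuous.intervalIntegrable (by fun_prop) _ _)
    rw [← e3]
    refine mul_eq_zero_of_right _ (Eq.trans ?_ e1)
    refine intervalIntegral.integral_congr fun x _ => ?_
    ring
  rw [e2]
  refine intervalIntegral.integral_mono_on hL.le
    (Continuous.intervalIntegrable (by fun_prop) _ _)
    (Continuous.intervalIntegrable (by fun_prop) _ _) fun x _ => ?_
  have h0 := h.sub_pos x
  -- Completing the square in w = 4f - f'' pointwise, after ∮ f'² has been replaced by -∮ f f''.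
  have e3 : (c - φ x) * (4 * f x - f₂ x) ^ 2 - 3 * c * ((4 * f x - f₂ x) * f x) -
      3 * c * (hillPotential c φ x * f x ^ 2 - f x * f₂ x) =
      (c - φ x) * (4 * f x - f₂ x - 3 * c * f x / (c - φ x)) ^ 2 := by
    rw [hillPotential]
    field_simp
    ring
  have : 0 ≤ (c - φ x) * (4 * f x - f₂ x - 3 * c * f x / (c - φ x)) ^ 2 := by positivity
  linarith

end Hill

/-! ## Variations of the waves -/

section Variation

variable {c : ℝ} {q : ℝ × ℝ}

theorem contDiffOn_wave₁ (c : ℝ) : ContDiffOn ℝ ∞ (wave₁ c) phaseDomain := by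
  have h1 : ContDiff ℝ ∞ fun p : (ℝ × ℝ) × ℝ => p.1.2 := by fun_prop
  have h2 : ContDiff ℝ ∞ fun p : (ℝ × ℝ) × ℝ => 1 + p.1.1 := by fun_prop
  exact ((contDiffOn_const.div h2.contDiffOn fun p hp => (one_add_pos_of_mem hp.1).ne').mul
    (h1.contDiffOn.mul contDiffOn_angle.sin)).neg

theorem wave₁_zero (c : ℝ) (hq : q ∈ orbitDomain) : wave₁ c (q, 0) = 0 := by
  simp only [wave₁, angle_zero hq, Real.sin_zero, mul_zero, neg_zero]

theorem wave₁_half (c : ℝ) (hq : q ∈ orbitDomain) : wave₁ c (q, period q / 2) = 0 := by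
  simp only [wave₁, angle_half hq, Real.sin_pi, mul_zero, neg_zero]

theorem hasDerivAt_phase_snd {G : (ℝ × ℝ) × ℝ → ℝ} (hG : ContDiffOn ℝ ∞ G phaseDomain)
    (hq : q ∈ orbitDomain) (x : ℝ) :
    HasDerivAt (fun x => G (q, x)) (dirDeriv (0, 1) G (q, x)) x :=
  hasDerivAt_comp_curve (γ := fun s => (q, s)) isOpen_phaseDomain hG
    ((hasDerivAt_const x q).prodMk (hasDerivAt_id x)) ⟨hq, mem_univ _⟩

theorem hasDerivAt_line (q v : ℝ × ℝ) : HasDerivAt (fun s : ℝ => q + s • v) v 0 := by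
  simpa using ((hasDerivAt_id (0 : ℝ)).smul_const v).const_add q

theorem hasDerivAt_phase_line {G : (ℝ × ℝ) × ℝ → ℝ} (hG : ContDiffOn ℝ ∞ G phaseDomain)
    (hq : q ∈ orbitDomain) (v : ℝ × ℝ) (x : ℝ) :
    HasDerivAt (fun s : ℝ => G (q + s • v, x)) (dirDeriv (v, 0) G (q, x)) 0 := by
  have := hasDerivAt_comp_curve (γ := fun s : ℝ => (q + s • v, x)) isOpen_phaseDomain hG
    ((hasDerivAt_line q v).prodMk (hasDerivAt_const 0 x))
    (by rw [zero_smul, add_zero]; exact ⟨hq, mem_univ _⟩)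
  simpa only [zero_smul, add_zero] using this

theorem eventually_line_mem (hq : q ∈ orbitDomain) (v : ℝ × ℝ) :
    ∀ᶠ s : ℝ in 𝓝 0, q + s • v ∈ orbitDomain :=
  (hasDerivAt_line q v).continuousAt.eventually_mem
    (by simpa using isOpen_orbitDomain.mem_nhds hq)

theorem hasDerivAt_aOf_line (c : ℝ) (hq : q ∈ orbitDomain) (v : ℝ × ℝ) :
    HasDerivAt (fun s : ℝ => aOf c (q + s • v).1) (-(c ^ 4 * (3 * q.1 - 1) / (1 + q.1) ^ 5) * v.1)
      0 := by
  have hk : 1 / 3 < (q + (0 : ℝ) • v).1 := by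
    simpa using lt_of_mem_ampRange (k := q.1) (s := q.2) hq.1
  have h1 : HasDerivAt (fun s : ℝ => (q + s • v).1) v.1 0 := (hasDerivAt_line q v).fst
  have h2 := (hasDerivAt_aOf c hk).comp 0 h1
  simpa [Function.comp_def] using h2

theorem dirDeriv_wave_snd (c : ℝ) : EqOn (dirDeriv (0, 1) (wave c)) (wave₁ c) phaseDomain :=
  fun p hp => (hasDerivAt_phase_snd (contDiffOn_wave c) hp.1 p.2).unique
    (hasDerivAt_wave c hp.1 p.2)

theorem dirDeriv_wave₁_snd (hc : 0 < c) : EqOn (dirDeriv (0, 1) (wave₁ c))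
    (fun p => wave c p - aOf c p.1.1 / (c - wave c p) ^ 3) phaseDomain :=
  fun p hp => (hasDerivAt_phase_snd (contDiffOn_wave₁ c) hp.1 p.2).unique
    (hasDerivAt_wave₁ hc hp.1 p.2)

theorem isProfile_wave (hc : 0 < c) (hq : q ∈ orbitDomain) (hr : 0 < q.2) :
    IsProfile c (aOf c q.1) (bOf c q) (period q) (fun x => wave c (q, x))
      (fun x => wave₁ c (q, x)) := by
  have hk := one_add_pos_of_mem hq
  have hacc : ∀ x, wave c (q, x) - aOf c q.1 / (c - wave c (q, x)) ^ 3 =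
      c / (1 + q.1) * ((profile (q, x) - 1) *
        (wellPoly q.1 (profile (q, x)) / profile (q, x) ^ 3)) := by
    intro x
    have h1 : HasDerivAt (fun x => wave₁ c (q, x)) _ x :=
      ((hasDerivAt_profile₁ hq x).const_mul (c / (1 + q.1))).neg
    rw [(hasDerivAt_wave₁ hc hq x).unique h1]
    ring
  have hpos : ∀ x, 0 < wellPoly q.1 (profile (q, x)) / profile (q, x) ^ 3 := fun x =>
    div_pos (mem_wellDomain_profile hq x).2.2 (pow_pos (profile_pos hq x) 3)
  -- The acceleration has the sign of τ - 1, hence of -cos θ, which is read off at θ = 0 and θ = π.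
  have hsign : ∀ x, profile (q, x) - 1 =
      -q.2 * Real.cos (angle (q, x)) * (profile (q, x) /
        Real.sqrt (wellFactor q.1 (profile (q, x)))) := by
    intro x
    rw [← amp_profile hq x, amp]
    have h1 := Real.sqrt_pos.mpr (wellFactor_pos (mem_wellDomain_profile hq x))
    have h2 := profile_pos hq x
    field_simp
  have hpos' : ∀ x, 0 < profile (q, x) / Real.sqrt (wellFactor q.1 (profile (q, x))) := fun x =>
    div_pos (profile_pos hq x) (Real.sqrt_pos.mpr (wellFactor_pos (mem_wellDomain_profile hq x)))
  refine ⟨wave_lt hc hq, hasDerivAt_wave c hq, hasDerivAt_wave₁ hc hq, fun x => ?_, wave_neg c hq,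
    wave_add_period c hq, fun x hx => ?_, ?_, ?_⟩
  · have h1 := wave_invariant c hq x
    have h2 := wave_lt hc hq x
    have h3 : c - wave c (q, x) ≠ 0 := by linarith
    field_simp
    linarith
  · have h1 := strictMono_angle hq hx.1
    have h2 := strictMono_angle hq hx.2
    simp only [angle_zero hq, angle_half hq] at h1 h2
    have h3 := Real.sin_pos_of_pos_of_lt_pi h1 h2
    simp only [wave₁, neg_lt_zero]
    positivity
  · have h1 := hpos 0
    have h2 := hpos' 0
    rw [hacc, hsign 0, angle_zero hq, Real.cos_zero]
    refine mul_neg_of_pos_of_neg (by positivity) (mul_neg_of_neg_of_pos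
      (mul_neg_of_neg_of_pos (by linarith) h2) h1)
  · have h1 := hpos (period q / 2)
    have h2 := hpos' (period q / 2)
    rw [hacc, hsign (period q / 2), angle_half hq, Real.cos_pi]
    have : 0 < -q.2 * -1 := by linarith
    positivity

/-- The profile equation and the invariant are differentiated along the line q + s v. Derivatives in
s and x commute by smoothness. -/
theorem isVariation_wave (hc : 0 < c) (hq : q ∈ orbitDomain) (v : ℝ × ℝ) :
    IsVariation c (aOf c q.1) (-(c ^ 4 * (3 * q.1 - 1) / (1 + q.1) ^ 5) * v.1)
      (dirDeriv v (bOf c) q) (fun x => wave c (q, x)) (fun x => wave₁ c (q, x))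
      (fun x => dirDeriv (v, 0) (wave c) (q, x)) (fun x => dirDeriv (v, 0) (wave₁ c) (q, x)) := by
  have hmem : ∀ x, (q, x) ∈ phaseDomain := fun x => ⟨hq, mem_univ _⟩
  have hw := fun x => hasDerivAt_phase_line (contDiffOn_wave c) hq v x
  have hw₁ := fun x => hasDerivAt_phase_line (contDiffOn_wave₁ c) hq v x
  have ha := hasDerivAt_aOf_line c hq v
  have hb : HasDerivAt (fun s : ℝ => bOf c (q + s • v)) (dirDeriv v (bOf c) q) 0 := by
    have := hasDerivAt_comp_curve isOpen_orbitDomain (contDiffOn_bOf c) (hasDerivAt_line q v)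
      (by simpa using hq)
    simpa using this
  refine ⟨fun x => ?_, fun x => ?_, fun x => ?_⟩
  · refine (hasDerivAt_phase_snd (contDiffOn_dirDeriv isOpen_phaseDomain (contDiffOn_wave c) _)
      hq x).congr_deriv ?_
    rw [dirDeriv_comm isOpen_phaseDomain (contDiffOn_wave c) _ _ (hmem x)]
    exact dirDeriv_congr isOpen_phaseDomain (dirDeriv_wave_snd c) _ (hmem x)
  · refine (hasDerivAt_phase_snd (contDiffOn_dirDeriv isOpen_phaseDomain (contDiffOn_wave₁ c) _)
      hq x).congr_deriv ?_
    rw [dirDeriv_comm isOpen_phaseDomain (contDiffOn_wave₁ c) _ _ (hmem x)]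
    have h0 : c - wave c (q, x) ≠ 0 := by linarith [wave_lt hc hq x]
    have h1 := hasDerivAt_phase_line (contDiffOn_dirDeriv isOpen_phaseDomain (contDiffOn_wave₁ c)
      (0, 1)) hq v x
    have h2 := (hw x).sub (ha.div (((hw x).const_sub c).pow 3) (by simpa using h0))
    have h3 : (fun s : ℝ => dirDeriv (0, 1) (wave₁ c) (q + s • v, x)) =ᶠ[𝓝 0] fun s : ℝ =>
        wave c (q + s • v, x) - aOf c (q + s • v).1 / (c - wave c (q + s • v, x)) ^ 3 := by
      filter_upwards [eventually_line_mem hq v] with s hs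
      exact dirDeriv_wave₁_snd hc ⟨hs, mem_univ _⟩
    rw [h1.unique (h2.congr_of_eventuallyEq h3)]
    simp only [zero_smul, add_zero, Pi.pow_apply]
    field_simp
    push_cast
    ring
  · have h0 : c - wave c (q, x) ≠ 0 := by linarith [wave_lt hc hq x]
    have h1 := (((hw x).const_sub c).pow 2).mul ((((hw₁ x).pow 2).sub ((hw x).pow 2)).sub hb)
    have h2 := h1.add ha
    have h3 : (fun s : ℝ => (c - wave c (q + s • v, x)) ^ 2 * (wave₁ c (q + s • v, x) ^ 2 -
        wave c (q + s • v, x) ^ 2 - bOf c (q + s • v)) + aOf c (q + s • v).1) =ᶠ[𝓝 0]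
        fun _ => 0 := by
      filter_upwards [eventually_line_mem hq v] with s hs
      exact wave_invariant c hs x
    have h4 := h2.unique ((hasDerivAt_const (0 : ℝ) (0 : ℝ)).congr_of_eventuallyEq h3)
    have h5 := wave_invariant c hq x
    simp only [zero_smul, add_zero, Pi.pow_apply, Pi.sub_apply] at h4
    have h6 : wave₁ c (q, x) ^ 2 - wave c (q, x) ^ 2 - bOf c q =
        -(aOf c q.1 / (c - wave c (q, x)) ^ 2) := by
      field_simp
      linarith
    rw [h6] at h4
    have key : ∀ D A w w₁ η η₁ δa δb : ℝ, D ≠ 0 → 2 * D * -η * -(A / D ^ 2) +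
        D ^ 2 * (2 * w₁ * η₁ - 2 * w * η - δb) + δa = 0 →
        2 * w₁ * η₁ = 2 * w * η + δb - δa / D ^ 2 - 2 * A * η / D ^ 3 := by
      intro D A w w₁ η η₁ δa δb hD h
      field_simp at h ⊢
      linear_combination h
    refine key _ _ _ _ _ _ _ _ h0 (Eq.trans ?_ h4)
    push_cast
    ring

theorem dirDeriv_wave₁_zero (c : ℝ) (hq : q ∈ orbitDomain) (v : ℝ × ℝ) :
    dirDeriv (v, 0) (wave₁ c) (q, 0) = 0 := by
  have h1 := hasDerivAt_phase_line (contDiffOn_wave₁ c) hq v 0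
  refine h1.unique ((hasDerivAt_const (0 : ℝ) (0 : ℝ)).congr_of_eventuallyEq ?_)
  filter_upwards [eventually_line_mem hq v] with s hs
  exact wave₁_zero c hs

/-- Differentiation of φ'(T/2) = 0 along v, where T/2 moves as well. A shorter period thus gives a
positive slope of the variation at the trough. -/
theorem dirDeriv_wave₁_half (hc : 0 < c) (hq : q ∈ orbitDomain) (v : ℝ × ℝ) :
    dirDeriv (v, 0) (wave₁ c) (q, period q / 2) = -(dirDeriv v period q / 2 *
      (wave c (q, period q / 2) - aOf c q.1 / (c - wave c (q, period q / 2)) ^ 3)) := by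
  have h0 : (q, period q / 2) ∈ phaseDomain := ⟨hq, mem_univ _⟩
  have h1 : HasDerivAt (fun s : ℝ => period (q + s • v) / 2) (dirDeriv v period q / 2) 0 := by
    have := hasDerivAt_comp_curve isOpen_orbitDomain contDiffOn_period (hasDerivAt_line q v)
      (by simpa using hq)
    simpa using this.div_const 2
  have h2 := hasDerivAt_comp_curve isOpen_phaseDomain (contDiffOn_wave₁ c)
    ((hasDerivAt_line q v).prodMk h1) (by simpa using h0)
  simp only [zero_smul, add_zero] at h2
  have h3 := h2.unique ((hasDerivAt_const (0 : ℝ) (0 : ℝ)).congr_of_eventuallyEq (by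
    filter_upwards [eventually_line_mem hq v] with s hs
    exact wave₁_half c hs))
  rw [show ((v, dirDeriv v period q / 2) : (ℝ × ℝ) × ℝ) =
    (v, 0) + (dirDeriv v period q / 2) • ((0 : ℝ × ℝ), (1 : ℝ)) by simp, dirDeriv_add,
    dirDeriv_smul, dirDeriv_wave₁_snd hc h0] at h3
  linarith

theorem dirDeriv_bOf_snd (c : ℝ) (hq : q ∈ orbitDomain) :
    dirDeriv (0, 1) (bOf c) q = 2 * c ^ 2 * q.2 / (1 + q.1) ^ 2 := by
  have hk := (one_add_pos_of_mem hq).ne'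
  have h1 := hasDerivAt_comp_curve isOpen_orbitDomain (contDiffOn_bOf c)
    ((hasDerivAt_const q.2 q.1).prodMk (hasDerivAt_id q.2)) hq
  have h2 : HasDerivAt (fun s => bOf c (q.1, s)) (2 * c ^ 2 * q.2 / (1 + q.1) ^ 2) q.2 := by
    simp only [bOf]
    refine (((((hasDerivAt_id q.2).pow 2).const_add (q.1 - q.1 ^ 2)).const_mul
      (c ^ 2)).div_const ((1 + q.1) ^ 2)).congr_deriv ?_
    simp only [id]
    push_cast
    ring
  exact h1.unique h2

/-- The waves along a curve with increasing `b` have an even solution of the Hill equation which is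
monotone at the trough. -/
theorem exists_isVariation (hc : 0 < c) (hq : q ∈ orbitDomain) (hr : 0 < q.2) {v : ℝ × ℝ}
    (ha : -(c ^ 4 * (3 * q.1 - 1) / (1 + q.1) ^ 5) * v.1 = 1) (hv : dirDeriv v period q = 0)
    (hb : 0 < dirDeriv v (bOf c) q) : ∃ η η₁, IsVariation c (aOf c q.1) 1 0
      (fun x => wave c (q, x)) (fun x => wave₁ c (q, x)) η η₁ ∧ η 0 < 0 ∧ η₁ 0 = 0 ∧
      0 ≤ η₁ (period q / 2) := by
  have hk := one_add_pos_of_mem hq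
  have hβ : 0 < dirDeriv (0, 1) (bOf c) q := by
    rw [dirDeriv_bOf_snd c hq]
    positivity
  set β := dirDeriv (0, 1) (bOf c) q
  set m := dirDeriv v (bOf c) q / β
  have hm : 0 < m := div_pos hb hβ
  -- The direction along the curve T = L is corrected in r so that b is stationary. As b increases
  -- along v, the correction lowers r and hence shortens the period.
  set w : ℝ × ℝ := v + (-m) • ((0 : ℝ), (1 : ℝ))
  have hw := isVariation_wave hc hq w
  have e1 : w.1 = v.1 := by simp [w]
  have e2 : dirDeriv w (bOf c) q = 0 := by
    simp only [w, dirDeriv_add, dirDeriv_smul]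
    change _ + -m * β = 0
    simp only [m]
    field_simp
    ring
  have e3 : dirDeriv w period q = -(m * (q.2 * periodSlope q)) := by
    simp only [w, dirDeriv_add, dirDeriv_smul, hv, dirDeriv_snd_period hq]
    ring
  rw [e1, ha, e2] at hw
  have hp := isProfile_wave hc hq hr
  refine ⟨_, _, hw, ?_, dirDeriv_wave₁_zero c hq w, ?_⟩
  -- At the crest φ' = 0, and the linearized invariant reads φ'' η = 1/(2(c - φ)²) > 0 with φ'' < 0.
  · have h1 := hw.invariant 0
    simp only [wave₁_zero c hq] at h1
    have h2 : wave c (q, 0) - aOf c q.1 / (c - wave c (q, 0)) ^ 3 < 0 := hp.crest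
    have h3 : 0 < c - wave c (q, 0) := hp.sub_pos 0
    have h4 : (wave c (q, 0) - aOf c q.1 / (c - wave c (q, 0)) ^ 3) *
        dirDeriv (w, 0) (wave c) (q, 0) = 1 / (c - wave c (q, 0)) ^ 2 / 2 := by
      linear_combination (-1 / 2) * h1
    by_contra h
    have h5 := mul_nonpos_of_nonpos_of_nonneg h2.le (not_lt.mp h)
    have h6 : 0 < 1 / (c - wave c (q, 0)) ^ 2 / 2 := by positivity
    linarith
  · have h1 : 0 < wave c (q, period q / 2) - aOf c q.1 / (c - wave c (q, period q / 2)) ^ 3 :=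
      hp.trough
    rw [dirDeriv_wave₁_half hc hq, e3]
    have h2 := periodSlope_pos hq
    rw [neg_div, neg_mul, neg_neg]
    positivity

end Variation

/-! ## Fourier coefficients in `L²_per` -/

section Coefficients

variable {L : ℝ} [Fact (0 < L)]

/-- The Fourier coefficients of an element of `L²_per`. -/
def coeff (f : L2per L) (n : ℤ) : ℂ := fourierBasis.repr f n

theorem coeff_ext {f g : L2per L} (h : ∀ n, coeff f n = coeff g n) : f = g :=
  fourierBasis.repr.injective (lp.ext (funext h))

theorem coeff_add (f g : L2per L) (n : ℤ) : coeff (f + g) n = coeff f n + coeff g n := by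
  simp [coeff]

theorem coeff_sub (f g : L2per L) (n : ℤ) : coeff (f - g) n = coeff f n - coeff g n := by
  simp [coeff]

theorem coeff_smul (z : ℂ) (f : L2per L) (n : ℤ) : coeff (z • f) n = z * coeff f n := by
  simp [coeff]

theorem coeff_zero (n : ℤ) : coeff (0 : L2per L) n = 0 := by
  simp [coeff]

theorem hasSum_inner (f g : L2per L) :
    HasSum (fun n => star (coeff f n) * coeff g n) (inner ℂ f g) := by
  have h := lp.hasSum_inner (𝕜 := ℂ) (fourierBasis.repr f) (fourierBasis.repr g)
  rw [LinearIsometryEquiv.inner_map_map] at h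
  refine (congrArg (HasSum · (inner ℂ f g)) (funext fun n => ?_)).mp h
  rw [RCLike.inner_apply']
  rfl

theorem hasSum_norm_sq (f : L2per L) : HasSum (fun n => ‖coeff f n‖ ^ 2) (‖f‖ ^ 2) := by
  have h := lp.hasSum_norm (p := 2) (by norm_num) (fourierBasis.repr f)
  simp only [ENNReal.toReal_ofNat, Real.rpow_ofNat, LinearIsometryEquiv.norm_map] at h
  exact h

theorem norm_le_of_coeff {f g : L2per L} {C : ℝ} (hC : 0 ≤ C)
    (h : ∀ n, ‖coeff g n‖ ≤ C * ‖coeff f n‖) : ‖g‖ ≤ C * ‖f‖ := by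
  refine (pow_le_pow_iff_left₀ (norm_nonneg _) (by positivity) two_ne_zero).mp ?_
  rw [mul_pow]
  refine hasSum_le (fun n => ?_) (hasSum_norm_sq g) ((hasSum_norm_sq f).mul_left (C ^ 2))
  rw [← mul_pow]
  exact pow_le_pow_left₀ (norm_nonneg _) (h n) 2

theorem memℓp_mul {m : ℤ → ℂ} {C : ℝ} (hm : ∀ n, ‖m n‖ ≤ C) (f : L2per L) :
    Memℓp (fun n => m n * coeff f n) 2 := by
  refine memℓp_gen ?_
  simp only [ENNReal.toReal_ofNat, Real.rpow_ofNat]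
  refine ((hasSum_norm_sq f).summable.mul_left (C ^ 2)).of_nonneg_of_le (fun n => by positivity)
    fun n => ?_
  rw [norm_mul, mul_pow]
  gcongr
  exact hm n

/-- The bounded Fourier multiplier with symbol `m`. -/
def multiplier (m : ℤ → ℂ) (C : ℝ) (hm : ∀ n, ‖m n‖ ≤ C) : L2per L →L[ℂ] L2per L :=
  LinearMap.mkContinuous
    { toFun := fun f => fourierBasis.repr.symm ⟨fun n => m n * coeff f n, memℓp_mul hm f⟩
      map_add' := fun f g => coeff_ext fun n => by
        rw [coeff_add]
        simp only [coeff, LinearIsometryEquiv.apply_symm_apply, map_add, lp.coeFn_add,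
          Pi.add_apply]
        ring
      map_smul' := fun z f => coeff_ext fun n => by
        rw [coeff_smul]
        simp only [coeff, LinearIsometryEquiv.apply_symm_apply, map_smul, lp.coeFn_smul,
          Pi.smul_apply, smul_eq_mul, RingHom.id_apply]
        ring } C fun f =>
    norm_le_of_coeff ((norm_nonneg _).trans (hm 0)) fun n => by
      simp only [coeff, LinearMap.coe_mk, AddHom.coe_mk, LinearIsometryEquiv.apply_symm_apply,
        norm_mul]
      exact mul_le_mul_of_nonneg_right (hm n) (norm_nonneg _)

theorem coeff_multiplier (m : ℤ → ℂ) (C : ℝ) (hm : ∀ n, ‖m n‖ ≤ C) (f : L2per L) (n : ℤ) :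
    coeff (multiplier m C hm f) n = m n * coeff f n := by
  simp [multiplier, coeff]

theorem coeff_helmholtzInv (f : L2per L) (n : ℤ) :
    coeff (helmholtzInv L f) n = invSymbol L n * coeff f n := by
  change fourierBasis.repr (fourierBasis.repr.symm _) n = _
  rw [LinearIsometryEquiv.apply_symm_apply]
  rfl

theorem norm_multiplier_le (m : ℤ → ℂ) (C : ℝ) (hm : ∀ n, ‖m n‖ ≤ C) :
    ‖(multiplier m C hm : L2per L →L[ℂ] L2per L)‖ ≤ C :=
  LinearMap.mkContinuous_norm_le _ ((norm_nonneg _).trans (hm 0)) _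

/-- The Fourier coefficient as a bounded functional. -/
theorem inner_fourierBasis (f : L2per L) (n : ℤ) : inner ℂ (fourierBasis n) f = coeff f n :=
  (fourierBasis.repr_apply_apply f n).symm

/-- The finite-rank truncations converge in operator norm, the error being the supremum of the
symbol outside a finite set. -/
theorem isCompactOperator_multiplier {m : ℤ → ℂ} {C : ℝ} (hm : ∀ n, ‖m n‖ ≤ C)
    (h0 : Tendsto m cofinite (𝓝 0)) :
    IsCompactOperator (multiplier m C hm : L2per L →L[ℂ] L2per L) := by
  have hcl : IsClosed {T : L2per L →L[ℂ] L2per L | IsCompactOperator T} :=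
    isClosed_setOfPred_isCompactOperator
  have hfin : ∀ s : Finset ℤ, IsCompactOperator (∑ n ∈ s, m n •
      (innerSL ℂ (fourierBasis (T := L) n)).smulRight (fourierBasis (T := L) n) :
      L2per L →L[ℂ] L2per L) := by
    intro s
    induction s using Finset.induction_on with
    | empty => simpa using isCompactOperator_zero
    | insert n s hn ih =>
      rw [Finset.sum_insert hn]
      have h1 : IsCompactOperator (innerSL ℂ (fourierBasis (T := L) n)) :=
        isCompactOperator_of_locallyCompactSpace_dom (innerSL ℂ (fourierBasis (T := L) n))
      have h2 := (h1.clm_comp (ContinuousLinearMap.toSpanSingleton ℂ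
        (fourierBasis (T := L) n))).smul (m n)
      exact h2.add ih
  refine hcl.closure_subset (Metric.mem_closure_iff.mpr fun ε hε => ?_)
  have hs : {n | ¬ ‖m n‖ < ε / 2}.Finite := by
    have := (tendsto_zero_iff_norm_tendsto_zero.mp h0).eventually_lt_const (half_pos hε)
    exact this
  refine ⟨_, hfin hs.toFinset, ?_⟩
  have hbd : ∀ n, ‖(if n ∈ hs.toFinset then 0 else m n : ℂ)‖ ≤ ε / 2 := by
    intro n
    split_ifs with h
    · simpa using (half_pos hε).le
    · simpa using (not_not.mp (by simpa using h) : ‖m n‖ < ε / 2).le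
  rw [dist_eq_norm]
  refine lt_of_le_of_lt ?_ (half_lt_self hε)
  refine le_of_eq_of_le (congrArg norm ?_) (norm_multiplier_le (L := L) _ _ hbd)
  refine ContinuousLinearMap.ext fun f => coeff_ext fun n => ?_
  have h1 : ∀ k, coeff (fourierBasis (T := L) k) n = if n = k then 1 else 0 := by
    intro k
    rw [coeff, fourierBasis.repr_self, lp.single_apply, Pi.single_apply]
  have h2 : ∀ s : Finset ℤ, coeff ((∑ k ∈ s, m k •
      (innerSL ℂ (fourierBasis (T := L) k)).smulRight (fourierBasis (T := L) k) :
      L2per L →L[ℂ] L2per L) f) n = if n ∈ s then m n * coeff f n else 0 := by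
    intro s
    induction s using Finset.induction_on with
    | empty => simp [coeff_zero]
    | insert k s hk ih =>
      rw [Finset.sum_insert hk, _root_.add_apply, coeff_add, ih,
        _root_.smul_apply, ContinuousLinearMap.smulRight_apply, coeff_smul,
        coeff_smul, h1, innerSL_apply_apply, inner_fourierBasis]
      by_cases h : n = k
      · subst h
        simp [hk]
      · simp [h]
  rw [_root_.sub_apply, coeff_sub, coeff_multiplier, coeff_multiplier, h2]
  split_ifs <;> ring

/-- The bounded operator of multiplication by a continuous function. -/
def mulCLM (g : C(AddCircle L, ℂ)) : L2per L →L[ℂ] L2per L :=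
  LinearMap.mkContinuous (mulOp g) ‖ContinuousMap.toLp ∞ AddCircle.haarAddCircle ℂ g‖
    fun w => Lp.norm_smul_le _ w

theorem mulOp_ae (g : C(AddCircle L, ℂ)) (w : L2per L) :
    mulOp g w =ᵐ[AddCircle.haarAddCircle] fun x => g x * w x := by
  have h1 : mulOp g w =ᵐ[AddCircle.haarAddCircle] _ :=
    Lp.coeFn_lpSMul (r := 2) (ContinuousMap.toLp ∞ AddCircle.haarAddCircle ℂ g) w
  filter_upwards [h1, ContinuousMap.coeFn_toLp (p := ∞) (𝕜 := ℂ) AddCircle.haarAddCircle g]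
    with x hx hx'
  rw [hx, Pi.smul_apply', hx', smul_eq_mul]

theorem mulOp_mulOp (g h : C(AddCircle L, ℂ)) (w : L2per L) :
    mulOp g (mulOp h w) = mulOp (g * h) w := by
  refine Lp.ext ?_
  filter_upwards [mulOp_ae g (mulOp h w), mulOp_ae h w, mulOp_ae (g * h) w] with x h1 h2 h3
  rw [h1, h2, h3, ContinuousMap.mul_apply, mul_assoc]

theorem mulOp_one (w : L2per L) : mulOp 1 w = w := by
  refine Lp.ext ?_
  filter_upwards [mulOp_ae 1 w] with x h1
  rw [h1, ContinuousMap.one_apply, one_mul]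

theorem mulOp_toLp (g h : C(AddCircle L, ℂ)) :
    mulOp g (ContinuousMap.toLp 2 AddCircle.haarAddCircle ℂ h) =
      ContinuousMap.toLp 2 AddCircle.haarAddCircle ℂ (g * h) := by
  refine Lp.ext ?_
  filter_upwards [mulOp_ae g (ContinuousMap.toLp 2 AddCircle.haarAddCircle ℂ h),
    ContinuousMap.coeFn_toLp (p := 2) (𝕜 := ℂ) AddCircle.haarAddCircle h,
    ContinuousMap.coeFn_toLp (p := 2) (𝕜 := ℂ) AddCircle.haarAddCircle (g * h)] with x h1 h2 h3
  rw [h1, h2, h3, ContinuousMap.mul_apply]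

theorem inner_mulOp (g : C(AddCircle L, ℂ)) (hg : ∀ x, star (g x) = g x) (v w : L2per L) :
    inner ℂ (mulOp g v) w = inner ℂ v (mulOp g w) := by
  rw [L2.inner_def, L2.inner_def]
  refine integral_congr_ae ?_
  filter_upwards [mulOp_ae g v, mulOp_ae g w] with x h1 h2
  rw [h1, h2, RCLike.inner_apply', RCLike.inner_apply', map_mul,
    show (starRingEnd ℂ) (g x) = g x from hg x]
  ring

theorem inner_helmholtzInv (v w : L2per L) :
    inner ℂ (helmholtzInv L v) w = inner ℂ v (helmholtzInv L w) := by
  refine (hasSum_inner _ _).unique ?_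
  convert hasSum_inner v (helmholtzInv L w) using 2 with n
  simp only [coeff_helmholtzInv, star_mul, invSymbol, RCLike.star_def, Complex.conj_ofReal]
  ring

end Coefficients

/-! ## Smooth periodic functions in `L²_per` -/

theorem HInfPer.hasDerivAt {L : ℝ} (u : HInfPer L) (x : ℝ) : HasDerivAt u (deriv u x) x :=
  (u.smooth.differentiable (by simp) x).hasDerivAt

/-- The derivative of a smooth periodic function. -/
def HInfPer.derivative {L : ℝ} (u : HInfPer L) : HInfPer L where
  toFun := deriv u
  smooth := ((contDiff_infty_iff_deriv (f := u.toFun)).mp u.smooth).2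
  periodic x := by
    have h1 := (u.hasDerivAt (x + L)).comp_add_const x L
    have h2 : (fun x => u (x + L)) = u := funext u.periodic
    rw [h2] at h1
    exact h1.deriv.symm

theorem onCircle_coe {L : ℝ} (u : HInfPer L) (x : ℝ) :
    u.onCircle (x : AddCircle L) = (u x : ℂ) := rfl

section SmoothVectors

variable {L : ℝ} [Fact (0 < L)]

/-- A smooth periodic function as an element of `L²_per`. -/
def toL2 (u : HInfPer L) : L2per L :=
  ContinuousMap.toLp 2 AddCircle.haarAddCircle ℂ u.onCircle

theorem toL2_eq_add {u v w : HInfPer L} (α β : ℝ) (h : ∀ x, w x = α * u x + β * v x) :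
    toL2 w = (α : ℂ) • toL2 u + (β : ℂ) • toL2 v := by
  have : w.onCircle = (α : ℂ) • u.onCircle + (β : ℂ) • v.onCircle := by
    ext y
    induction y using QuotientAddGroup.induction_on with
    | H x =>
      change ((w x : ℝ) : ℂ) = (α : ℂ) * (u x : ℂ) + (β : ℂ) * (v x : ℂ)
      rw [h]
      push_cast
      ring
  rw [toL2, this, map_add, map_smul, map_smul]
  rfl

theorem mulOp_toL2 {u v w : HInfPer L} (h : ∀ x, w x = u x * v x) :
    mulOp u.onCircle (toL2 v) = toL2 w := by
  have : w.onCircle = u.onCircle * v.onCircle := by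
    ext y
    induction y using QuotientAddGroup.induction_on with
    | H x =>
      change ((w x : ℝ) : ℂ) = (u x : ℂ) * (v x : ℂ)
      rw [h]
      push_cast
      ring
  rw [toL2, toL2, this, mulOp_toLp]

theorem inner_toL2 (u v : HInfPer L) :
    inner ℂ (toL2 u) (toL2 v) = ((1 / L * ∫ x in (0 : ℝ)..L, u x * v x : ℝ) : ℂ) := by
  rw [toL2, toL2, ContinuousMap.inner_toLp, AddCircle.integral_haarAddCircle,
    ← AddCircle.intervalIntegral_preimage L 0, zero_add]
  have : ∀ x : ℝ, v.onCircle (x : AddCircle L) * (starRingEnd ℂ) (u.onCircle (x : AddCircle L)) =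
      ((u x * v x : ℝ) : ℂ) := by
    intro x
    rw [onCircle_coe, onCircle_coe, Complex.conj_ofReal]
    push_cast
    ring
  simp only [this]
  rw [intervalIntegral.integral_ofReal, Complex.real_smul]
  push_cast
  ring

theorem coeff_toL2 (u : HInfPer L) (n : ℤ) :
    coeff (toL2 u) n = (1 / L) • ∫ x in (0 : ℝ)..L, fourier (-n) (x : AddCircle L) * (u x : ℂ) := by
  rw [coeff, fourierBasis_repr, toL2, fourierCoeff_toLp, fourierCoeff_eq_intervalIntegral _ n 0,
    zero_add]
  rfl

theorem coeff_derivative (u : HInfPer L) (n : ℤ) :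
    coeff (toL2 u.derivative) n = Complex.I * waveNumber L n * coeff (toL2 u) n := by
  have hL : (0 : ℝ) < L := Fact.out
  have h1 : ∀ x : ℝ, HasDerivAt (fun x : ℝ => fourier (-n) (x : AddCircle L) * (u x : ℂ))
      (fourier (-n) (x : AddCircle L) * ((deriv u x : ℝ) : ℂ) -
        Complex.I * waveNumber L n * (fourier (-n) (x : AddCircle L) * (u x : ℂ))) x := by
    intro x
    refine ((hasDerivAt_fourier_neg L n x).mul (u.hasDerivAt x).ofReal_comp).congr_deriv ?_
    rw [waveNumber]
    push_cast
    ring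
  have hf : Continuous fun x : ℝ => fourier (-n) (x : AddCircle L) :=
    (map_continuous (fourier (-n))).comp (AddCircle.continuous_mk' L)
  have hu : Continuous fun x => (u x : ℂ) := Complex.continuous_ofReal.comp u.smooth.continuous
  have hu' : Continuous fun x => ((deriv u x : ℝ) : ℂ) :=
    Complex.continuous_ofReal.comp u.derivative.smooth.continuous
  have i1 : IntervalIntegrable (fun x : ℝ => fourier (-n) (x : AddCircle L) * ((deriv u x : ℝ) : ℂ))
      volume 0 L := (hf.mul hu').intervalIntegrable _ _
  have i2 : IntervalIntegrable (fun x : ℝ => Complex.I * waveNumber L n *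
      (fourier (-n) (x : AddCircle L) * (u x : ℂ))) volume 0 L :=
    (continuous_const.mul (hf.mul hu)).intervalIntegrable _ _
  have h2 := intervalIntegral.integral_eq_sub_of_hasDerivAt (fun x _ => h1 x) (i1.sub i2)
  rw [intervalIntegral.integral_sub i1 i2, intervalIntegral.integral_const_mul] at h2
  have h3 : (u L : ℝ) = u 0 := by
    have := u.periodic 0
    rwa [zero_add] at this
  have h4 : ((L : ℝ) : AddCircle L) = ((0 : ℝ) : AddCircle L) := by simp
  rw [h3, h4, sub_self, sub_eq_zero] at h2
  rw [coeff_toL2, coeff_toL2]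
  change (1 / L) • (∫ x in (0 : ℝ)..L, fourier (-n) (x : AddCircle L) * ((deriv u x : ℝ) : ℂ)) = _
  rw [h2, mul_smul_comm]

theorem coeff_helmholtz {u w : HInfPer L} (h : ∀ x, w x = 4 * u x - u.derivative.derivative x)
    (n : ℤ) : coeff (toL2 w) n = (4 + waveNumber L n ^ 2) * coeff (toL2 u) n := by
  rw [toL2_eq_add (u := u) (v := u.derivative.derivative) 4 (-1) (fun x => by rw [h]; ring),
    coeff_add, coeff_smul, coeff_smul, coeff_derivative, coeff_derivative]
  push_cast
  linear_combination -(waveNumber L n : ℂ) ^ 2 * coeff (toL2 u) n * Complex.I_sq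

theorem helmholtzInv_toL2 {u w : HInfPer L}
    (h : ∀ x, w x = 4 * u x - u.derivative.derivative x) : helmholtzInv L (toL2 w) = toL2 u := by
  refine coeff_ext fun n => ?_
  have h0 : (4 + (waveNumber L n : ℂ) ^ 2) ≠ 0 := by
    have : (0 : ℝ) < 4 + waveNumber L n ^ 2 := by positivity
    exact_mod_cast this.ne'
  rw [coeff_helmholtzInv, coeff_helmholtz h, invSymbol]
  push_cast
  field_simp

/-- The constant function `1`. -/
def oneHInf (L : ℝ) : HInfPer L where
  toFun := fun _ => 1
  smooth := contDiff_const
  periodic := fun _ => rfl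

theorem toL2_one : toL2 (oneHInf L) = fourierBasis (T := L) 0 := by
  rw [coe_fourierBasis, toL2, fourierLp]
  congr 1
  ext x
  rw [fourier_zero]
  induction x using QuotientAddGroup.induction_on with
  | H x => exact Complex.ofReal_one

theorem inner_one (w : L2per L) : inner ℂ (toL2 (oneHInf L)) w = coeff w 0 := by
  rw [toL2_one, inner_fourierBasis]

theorem hessian_toL2 {c : ℝ} {φ u w h : HInfPer L}
    (hw : ∀ x, w x = 4 * u x - u.derivative.derivative x)
    (hh : ∀ x, h x = (c - φ x) * w x - 3 * c * u x) : hessian c φ (toL2 w) = toL2 h := by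
  have e1 : (ContinuousMap.const _ (c : ℂ) - φ.onCircle : C(AddCircle L, ℂ)) =
      HInfPer.onCircle ⟨fun x => c - φ x, contDiff_const.sub φ.smooth, fun x => by
        change c - φ (x + L) = c - φ x
        rw [φ.periodic]⟩ := by
    ext y
    induction y using QuotientAddGroup.induction_on with
    | H x =>
      change (c : ℂ) - (φ x : ℂ) = ((c - φ x : ℝ) : ℂ)
      push_cast
      rfl
  rw [hessian, LinearMap.sub_apply, LinearMap.smul_apply, helmholtzInv_toL2 hw, e1,
    mulOp_toL2 (w := ⟨fun x => (c - φ x) * w x, (contDiff_const.sub φ.smooth).mul w.smooth,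
      fun x => by
        change (c - φ (x + L)) * w (x + L) = (c - φ x) * w x
        rw [φ.periodic, w.periodic]⟩) (fun x => rfl), toL2_eq_add (w := h) (u := ⟨fun x =>
        (c - φ x) * w x, (contDiff_const.sub φ.smooth).mul w.smooth, fun x => by
        change (c - φ (x + L)) * w (x + L) = (c - φ x) * w x
        rw [φ.periodic, w.periodic]⟩) (v := u) 1 (-(3 * c)) (fun x => by
        rw [hh]; change _ = 1 * ((c - φ x) * w x) + _; ring)]
  push_cast
  rw [one_smul, neg_smul, sub_eq_add_neg]

/-- The bounded Hessian operator. -/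
def hessianCLM (c : ℝ) (φ : HInfPer L) : L2per L →L[ℂ] L2per L :=
  mulCLM (ContinuousMap.const _ (c : ℂ) - φ.onCircle) - (3 * c : ℂ) •
    multiplier (invSymbol L) 1 (fun n => by
      rw [invSymbol, Complex.norm_real, Real.norm_eq_abs, abs_of_nonneg (by positivity),
        div_le_one (by positivity)]
      nlinarith [sq_nonneg (waveNumber L n)])

theorem inner_hessian (c : ℝ) (φ : HInfPer L) (v w : L2per L) :
    inner ℂ (hessian c φ v) w = inner ℂ v (hessian c φ w) := by
  have h1 : ∀ x, star ((ContinuousMap.const _ (c : ℂ) - φ.onCircle : C(AddCircle L, ℂ)) x) =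
      (ContinuousMap.const _ (c : ℂ) - φ.onCircle : C(AddCircle L, ℂ)) x := by
    intro y
    change star ((c : ℂ) - ((φ.periodic.lift y : ℝ) : ℂ)) = _
    rw [star_sub, Complex.star_def, Complex.conj_ofReal, Complex.conj_ofReal]
    rfl
  rw [hessian, LinearMap.sub_apply, LinearMap.sub_apply, LinearMap.smul_apply,
    LinearMap.smul_apply, inner_sub_left, inner_sub_right, inner_mulOp _ h1, inner_smul_left,
    inner_smul_right, inner_helmholtzInv, map_mul, Complex.conj_ofReal, map_ofNat]

end SmoothVectors

/-! ## Symmetric forms with few negative directions -/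

section Index

variable {V : Type*} [AddCommGroup V] [Module ℝ V] {B : V →ₗ[ℝ] V →ₗ[ℝ] ℝ}

theorem form_sub_smul (hB : ∀ x y, B x y = B y x) (w u : V) (t : ℝ) :
    B (w - t • u) (w - t • u) = B w w - 2 * t * B u w + t ^ 2 * B u u := by
  simp only [map_sub, map_smul, LinearMap.sub_apply, LinearMap.smul_apply, smul_eq_mul, hB w u]
  ring

/-- If a symmetric form is nonnegative on a hyperplane, then it is nonnegative on the orthogonal
complement of every non-radical vector on which it is nonpositive. -/
theorem form_nonneg_of_hyperplane (hB : ∀ x y, B x y = B y x) {S : Submodule ℝ V} (l : V →ₗ[ℝ] ℝ)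
    (hl : ∀ w ∈ S, l w = 0 → 0 ≤ B w w) {u : V} (hu : u ∈ S) (hq : B u u ≤ 0)
    (hne : ∃ v ∈ S, B u v ≠ 0) {w : V} (hw : w ∈ S) (h : B u w = 0) : 0 ≤ B w w := by
  by_cases hlu : l u = 0
  · have h0 : B u u = 0 := le_antisymm hq (hl u hu hlu)
    -- A Cauchy–Schwarz argument: u is isotropic in the hyperplane where the form is nonnegative,
    -- and if B u x ≠ 0 the chosen multiple of u would make the form equal to -1.
    have h1 : ∀ x ∈ S, l x = 0 → B u x = 0 := by
      intro x hx hlx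
      by_contra hne
      have h2 := hl (x - ((B x x + 1) / (2 * B u x)) • u) (S.sub_mem hx (S.smul_mem _ hu))
        (by rw [map_sub, map_smul, hlx, hlu, smul_zero, sub_zero])
      have h3 : 2 * ((B x x + 1) / (2 * B u x)) * B u x = B x x + 1 := by field_simp
      rw [form_sub_smul hB, h0, h3] at h2
      linarith
    obtain ⟨v, hv, hne⟩ := hne
    -- So a vector v detecting u is transversal to the hyperplane, and B u w = 0 forces l w = 0.
    have hlv : l v ≠ 0 := fun h => hne (h1 v hv h)
    have h2 := h1 (w - (l w / l v) • v) (S.sub_mem hw (S.smul_mem _ hv)) (by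
      rw [map_sub, map_smul, smul_eq_mul, div_mul_cancel₀ _ hlv, sub_self])
    rw [map_sub, h, map_smul, smul_eq_mul, zero_sub, neg_eq_zero] at h2
    rcases mul_eq_zero.mp h2 with h3 | h3
    · exact hl w hw ((div_eq_zero_iff.mp h3).resolve_right hlv)
    · exact absurd h3 hne
  -- Since B u w = 0, moving w into the hyperplane along u adds only a nonpositive multiple of B u
  -- u.
  · have h1 := hl (w - (l w / l u) • u) (S.sub_mem hw (S.smul_mem _ hu)) (by
      rw [map_sub, map_smul, smul_eq_mul, div_mul_cancel₀ _ hlu, sub_self])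
    rw [form_sub_smul hB, h] at h1
    nlinarith [sq_nonneg (l w / l u)]

/-- If a symmetric form is nonnegative on a subspace of codimension two, then it is nonnegative on
the orthogonal complement of every plane on which it is nonpositive and not isotropic. -/
theorem form_nonneg_of_codim_two (hB : ∀ x y, B x y = B y x) (l m : V →ₗ[ℝ] ℝ)
    (hlm : ∀ w, l w = 0 → m w = 0 → 0 ≤ B w w) {p u : V} (hp : B p p < 0) (hpu : B p u = 0)
    (hq : B u u ≤ 0) (hne : ∃ v, B u v ≠ 0) {w : V} (hwp : B p w = 0) (hwu : B u w = 0) :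
    0 ≤ B w w := by
  -- Inside the complement of p one linear condition suffices: this combination vanishes at p, and
  -- on its kernel a multiple of p can be subtracted so that l and m both vanish. That multiple only
  -- lowers the form.
  refine form_nonneg_of_hyperplane (S := LinearMap.ker (B p)) hB (l p • m - m p • l)
    (fun x hx hlx => ?_) hpu hq ?_ hwp hwu
  · have hx' : B p x = 0 := hx
    simp only [LinearMap.sub_apply, LinearMap.smul_apply, smul_eq_mul] at hlx
    have key : ∀ t : ℝ, l (x - t • p) = 0 → m (x - t • p) = 0 → 0 ≤ B x x := by
      intro t h1 h2
      have h3 := hlm _ h1 h2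
      rw [form_sub_smul hB, hx'] at h3
      nlinarith [sq_nonneg t]
    by_cases h1 : l p = 0
    · by_cases h2 : m p = 0
      · exact absurd (hlm p h1 h2) (not_le.mpr hp)
      · have h3 : l x = 0 := by
          rw [h1, zero_mul, zero_sub, neg_eq_zero] at hlx
          exact (mul_eq_zero.mp hlx).resolve_left h2
        refine key (m x / m p) ?_ ?_
        · rw [map_sub, map_smul, h1, h3, smul_zero, sub_zero]
        · rw [map_sub, map_smul, smul_eq_mul, div_mul_cancel₀ _ h2, sub_self]
    · refine key (l x / l p) ?_ ?_
      · rw [map_sub, map_smul, smul_eq_mul, div_mul_cancel₀ _ h1, sub_self]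
      · rw [map_sub, map_smul, smul_eq_mul]
        field_simp
        linarith
  · obtain ⟨v, hv⟩ := hne
    refine ⟨v - (B p v / B p p) • p, ?_, ?_⟩
    · rw [LinearMap.mem_ker, map_sub, map_smul, smul_eq_mul, div_mul_cancel₀ _ hp.ne, sub_self]
    · rwa [map_sub, map_smul, hB u p, hpu, smul_zero, sub_zero]

end Index

/-! ## The algebra of smooth periodic functions -/

/-- The algebra of smooth real `L`-periodic functions. -/
def smoothPer (L : ℝ) : Subalgebra ℝ (ℝ → ℝ) where
  carrier := {f | ContDiff ℝ ∞ f ∧ Function.Periodic f L}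
  mul_mem' hf hg := ⟨hf.1.mul hg.1, hf.2.mul hg.2⟩
  add_mem' hf hg := ⟨hf.1.add hg.1, hf.2.add hg.2⟩
  algebraMap_mem' _ := ⟨contDiff_const, fun _ => rfl⟩

section Algebra

variable {L : ℝ}

/-- An element of the algebra of smooth periodic functions as an element of `HInfPer`. -/
def toHInf (f : smoothPer L) : HInfPer L := ⟨f.1, f.2.1, f.2.2⟩

/-- An element of `HInfPer` as an element of the algebra of smooth periodic functions. -/
def ofHInf (u : HInfPer L) : smoothPer L := ⟨u.toFun, u.smooth, u.periodic⟩

theorem smoothPer_continuous (f : smoothPer L) : Continuous f.1 := f.2.1.continuous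

theorem smoothPer_hasDerivAt (f : smoothPer L) (x : ℝ) : HasDerivAt f.1 (deriv f.1 x) x :=
  (toHInf f).hasDerivAt x

/-- The derivative on smooth periodic functions. -/
def derivPer (L : ℝ) : smoothPer L →ₗ[ℝ] smoothPer L where
  toFun f := ofHInf (toHInf f).derivative
  map_add' f g := Subtype.ext (funext fun x =>
    ((smoothPer_hasDerivAt f x).add (smoothPer_hasDerivAt g x)).deriv)
  map_smul' r f := Subtype.ext (funext fun x =>
    ((smoothPer_hasDerivAt f x).const_mul r).deriv)

theorem derivPer_mul (f g : smoothPer L) :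
    derivPer L (f * g) = derivPer L f * g + f * derivPer L g :=
  Subtype.ext (funext fun x => ((smoothPer_hasDerivAt f x).mul (smoothPer_hasDerivAt g x)).deriv)

theorem derivPer_eq {f g : smoothPer L} (h : ∀ x, HasDerivAt f.1 (g.1 x) x) : derivPer L f = g :=
  Subtype.ext (funext fun x => (h x).deriv)

/-- The integral over a period. -/
def integralPer (L : ℝ) : smoothPer L →ₗ[ℝ] ℝ where
  toFun f := ∫ x in (0 : ℝ)..L, f.1 x
  map_add' f g := intervalIntegral.integral_add ((smoothPer_continuous f).intervalIntegrable _ _)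
    ((smoothPer_continuous g).intervalIntegrable _ _)
  map_smul' _ _ := intervalIntegral.integral_const_mul _ _

theorem integralPer_derivPer (f : smoothPer L) : integralPer L (derivPer L f) = 0 := by
  have h := intervalIntegral.integral_eq_sub_of_hasDerivAt (a := 0) (b := L)
    (fun x _ => smoothPer_hasDerivAt f x)
    ((smoothPer_continuous (derivPer L f)).intervalIntegrable _ _)
  have h1 := f.2.2 0
  rw [zero_add] at h1
  rw [h1, sub_self] at h
  exact h

/-- The operator `4 - ∂ₓ²`. -/
def helmholtzPer (L : ℝ) : smoothPer L →ₗ[ℝ] smoothPer L :=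
  (4 : ℝ) • LinearMap.id - derivPer L ∘ₗ derivPer L

theorem helmholtzPer_apply (f : smoothPer L) :
    helmholtzPer L f = (4 : ℝ) • f - derivPer L (derivPer L f) := rfl

theorem integralPer_helmholtzPer (f g : smoothPer L) :
    integralPer L (f * helmholtzPer L g) = integralPer L (helmholtzPer L f * g) := by
  have h1 := integralPer_derivPer (derivPer L f * g - f * derivPer L g)
  have h2 : helmholtzPer L f * g + derivPer L (derivPer L f * g - f * derivPer L g) =
      f * helmholtzPer L g := by
    rw [map_sub, derivPer_mul, derivPer_mul, helmholtzPer_apply, helmholtzPer_apply, sub_mul,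
      mul_sub, smul_mul_assoc, mul_smul_comm]
    ring
  rw [← h2, map_add, h1, add_zero]

/-- The energy identity of `4 - ∂ₓ²`. -/
theorem integralPer_helmholtzPer_self (f : smoothPer L) :
    integralPer L (f * helmholtzPer L f) =
      ∫ x in (0 : ℝ)..L, (4 * f.1 x ^ 2 + deriv f.1 x ^ 2) := by
  have h1 := integralPer_derivPer (f * derivPer L f)
  have h2 : f * helmholtzPer L f + derivPer L (f * derivPer L f) =
      (4 : ℝ) • (f * f) + derivPer L f * derivPer L f := by
    rw [derivPer_mul, helmholtzPer_apply, mul_sub, mul_smul_comm]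
    ring
  have h3 : integralPer L (f * helmholtzPer L f) =
      integralPer L ((4 : ℝ) • (f * f) + derivPer L f * derivPer L f) := by
    rw [← h2, map_add, h1, add_zero]
  rw [h3]
  refine intervalIntegral.integral_congr fun x _ => ?_
  change 4 * (f.1 x * f.1 x) + deriv f.1 x * deriv f.1 x = _
  ring

/-- The Hessian operator in terms of `f = (4 - ∂ₓ²)⁻¹ w`. -/
def hessianPer (c : ℝ) (φ : smoothPer L) : smoothPer L →ₗ[ℝ] smoothPer L :=
  LinearMap.mulLeft ℝ (algebraMap ℝ _ c - φ) ∘ₗ helmholtzPer L - (3 * c) • LinearMap.id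

theorem hessianPer_apply (c : ℝ) (φ f : smoothPer L) :
    hessianPer c φ f = (algebraMap ℝ _ c - φ) * helmholtzPer L f - (3 * c) • f := rfl

/-- The quadratic form of the Hessian operator in terms of `f = (4 - ∂ₓ²)⁻¹ w`. -/
def hessianForm (c : ℝ) (φ : smoothPer L) : smoothPer L →ₗ[ℝ] smoothPer L →ₗ[ℝ] ℝ :=
  LinearMap.mk₂ ℝ (fun f g => integralPer L (hessianPer c φ f * helmholtzPer L g))
    (fun f f' g => by rw [map_add, add_mul, map_add])
    (fun r f g => by rw [map_smul, smul_mul_assoc, map_smul])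
    (fun f g g' => by rw [map_add, mul_add, map_add])
    (fun r f g => by rw [map_smul, mul_smul_comm, map_smul])

theorem hessianForm_apply (c : ℝ) (φ f g : smoothPer L) :
    hessianForm c φ f g = integralPer L (hessianPer c φ f * helmholtzPer L g) := rfl

theorem hessianForm_comm (c : ℝ) (φ f g : smoothPer L) :
    hessianForm c φ f g = hessianForm c φ g f := by
  simp only [hessianForm_apply, hessianPer_apply, sub_mul, smul_mul_assoc, map_sub, map_smul]
  rw [integralPer_helmholtzPer f g, mul_comm (helmholtzPer L f) g, mul_right_comm,
    mul_right_comm φ]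

/-- The test function is 𝓛w itself: pairing it with its image under 4 - ∂ₓ² gives ∮ (4h² + h'²) > 0.
-/
theorem exists_hessianForm_ne (hL : 0 < L) {c : ℝ} {φ f : smoothPer L} {x : ℝ}
    (hx : (hessianPer c φ f).1 x ≠ 0) : ∃ g, hessianForm c φ f g ≠ 0 := by
  refine ⟨hessianPer c φ f, ?_⟩
  rw [hessianForm_apply, integralPer_helmholtzPer_self]
  set h := hessianPer c φ f
  have h1 : Continuous h.1 := smoothPer_continuous h
  have h2 : Continuous (deriv h.1) := smoothPer_continuous (derivPer L h)
  obtain ⟨y, hy, hxy⟩ := h.2.2.exists_mem_Ico₀ hL x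
  refine (intervalIntegral.integral_pos hL (by fun_prop) (fun z _ => by positivity)
    ⟨y, Ico_subset_Icc_self hy, ?_⟩).ne'
  rw [hxy] at hx
  positivity

end Algebra

/-! ## The Hessian form of a wave -/

section WaveForm

variable {c a b L δa δb β : ℝ} {φ ψ : smoothPer L} {φ₁ ψ₁ : ℝ → ℝ}

/-- The function `(4 - ∂ₓ²)⁻¹ ψ` for a variation `ψ` of the wave `φ`. -/
def invVariation (c δb : ℝ) (φ ψ : smoothPer L) : smoothPer L :=
  (1 / (3 * c)) • ((algebraMap ℝ _ c - φ) * ψ - algebraMap ℝ _ (δb / 4))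

/-- The function `(4 - ∂ₓ²)⁻¹ φ` for a wave `φ`. -/
def invWave (c b : ℝ) (φ : smoothPer L) : smoothPer L :=
  (1 / (3 * c)) • (c • φ - (1 / 2 : ℝ) • (φ * φ) - algebraMap ℝ _ (b / 4))

theorem derivPer_algebraMap (r : ℝ) : derivPer L (algebraMap ℝ _ r) = 0 :=
  derivPer_eq fun x => hasDerivAt_const x r

theorem helmholtzPer_algebraMap (r : ℝ) :
    helmholtzPer L (algebraMap ℝ _ r) = algebraMap ℝ _ (4 * r) := by
  rw [helmholtzPer_apply, derivPer_algebraMap, map_zero, sub_zero, Algebra.smul_def, ← map_mul]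

/-- The inhomogeneous Hill equation says (4 - ∂ₓ²)((c - φ)ψ) = 3cψ + δb; the constant is absorbed by
δb/4. -/
theorem helmholtzPer_invVariation (hc : 0 < c) (h : IsProfile c a b L φ.1 φ₁)
    (hψ : IsVariation c a δa δb φ.1 φ₁ ψ.1 ψ₁) :
    helmholtzPer L (invVariation c δb φ ψ) = ψ := by
  set F : smoothPer L := (algebraMap ℝ _ c - φ) * ψ
  have h1 : (derivPer L F).1 = fun x => (c - φ.1 x) * ψ₁ x - φ₁ x * ψ.1 x :=
    funext fun x => (hψ.hasDerivAt_hill h x).deriv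
  have h2 : derivPer L (derivPer L F) =
      (4 : ℝ) • F - (3 * c) • ψ - algebraMap ℝ _ δb := by
    refine derivPer_eq fun x => ?_
    rw [h1]
    exact hψ.hasDerivAt_hill₁ h x
  have h3 : helmholtzPer L F = (3 * c) • ψ + algebraMap ℝ _ δb := by
    rw [helmholtzPer_apply, h2]
    abel
  rw [invVariation, map_smul, map_sub, h3, helmholtzPer_algebraMap, mul_div_cancel₀ _ four_ne_zero,
    add_sub_cancel_right, smul_smul, one_div_mul_cancel (by positivity), one_smul]

/-- The first integral and the profile equation combine to (4 - ∂ₓ²)(cφ - φ²/2) = 3cφ + b, without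
a. -/
theorem helmholtzPer_invWave (hc : 0 < c) (h : IsProfile c a b L φ.1 φ₁) :
    helmholtzPer L (invWave c b φ) = φ := by
  set F : smoothPer L := c • φ - (1 / 2 : ℝ) • (φ * φ)
  have h1 : (derivPer L F).1 = fun x => (c - φ.1 x) * φ₁ x := by
    refine funext fun x => HasDerivAt.deriv ?_
    refine (((h.hasDerivAt x).const_mul c).sub (((h.hasDerivAt x).mul
      (h.hasDerivAt x)).const_mul (1 / 2 : ℝ))).congr_deriv ?_
    ring
  have h2 : derivPer L (derivPer L F) = c • φ - (2 : ℝ) • (φ * φ) - algebraMap ℝ _ b := by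
    refine derivPer_eq fun x => ?_
    rw [h1]
    refine (((h.hasDerivAt x).const_sub c).mul (h.hasDerivAt₁ x)).congr_deriv ?_
    change _ = c * φ.1 x - 2 * (φ.1 x * φ.1 x) - b
    have h3 := h.invariant x
    have h4 := (h.sub_pos x).ne'
    have h5 : -φ₁ x * φ₁ x = -(φ.1 x ^ 2 + b - a / (c - φ.1 x) ^ 2) := by
      rw [← h3]
      ring
    rw [h5]
    field_simp
    ring
  have h3 : helmholtzPer L F = (3 * c) • φ + algebraMap ℝ _ b := by
    rw [helmholtzPer_apply, h2]
    module
  rw [invWave, map_smul, map_sub, h3, helmholtzPer_algebraMap, mul_div_cancel₀ _ four_ne_zero,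
    add_sub_cancel_right, smul_smul, one_div_mul_cancel (by positivity), one_smul]

theorem hessianPer_invVariation (hc : 0 < c) (h : IsProfile c a b L φ.1 φ₁)
    (hψ : IsVariation c a δa δb φ.1 φ₁ ψ.1 ψ₁) :
    hessianPer c φ (invVariation c δb φ ψ) = algebraMap ℝ _ (δb / 4) := by
  rw [hessianPer_apply, helmholtzPer_invVariation hc h hψ, invVariation, smul_smul,
    mul_one_div_cancel (by positivity), one_smul, sub_sub_cancel]

theorem hessianPer_invWave (hc : 0 < c) (h : IsProfile c a b L φ.1 φ₁) :
    hessianPer c φ (invWave c b φ) = algebraMap ℝ _ (b / 4) - (1 / 2 : ℝ) • (φ * φ) := by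
  rw [hessianPer_apply, helmholtzPer_invWave hc h, invWave, smul_smul,
    mul_one_div_cancel (by positivity), one_smul, sub_mul, ← Algebra.smul_def]
  module

theorem hessianForm_invVariation (hc : 0 < c) (h : IsProfile c a b L φ.1 φ₁)
    (hψ : IsVariation c a δa δb φ.1 φ₁ ψ.1 ψ₁) (f : smoothPer L) :
    hessianForm c φ (invVariation c δb φ ψ) f = δb / 4 * integralPer L (helmholtzPer L f) := by
  rw [hessianForm_apply, hessianPer_invVariation hc h hψ, ← Algebra.smul_def, map_smul,
    smul_eq_mul]

theorem hessianForm_invWave (hc : 0 < c) (h : IsProfile c a b L φ.1 φ₁) (f : smoothPer L) :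
    hessianForm c φ (invWave c b φ) f = b / 4 * integralPer L (helmholtzPer L f) -
      1 / 2 * integralPer L (φ * φ * helmholtzPer L f) := by
  rw [hessianForm_apply, hessianPer_invWave hc h, sub_mul, ← Algebra.smul_def, smul_mul_assoc,
    map_sub, map_smul, map_smul, smul_eq_mul, smul_eq_mul]

theorem hill_le_hessianForm (hL : 0 < L) (h : IsProfile c a b L φ.1 φ₁) (f : smoothPer L) :
    3 * c * ∫ x in (0 : ℝ)..L, (deriv f.1 x ^ 2 + hillPotential c φ.1 x * f.1 x ^ 2) ≤
      hessianForm c φ f f := by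
  refine (hill_le_hessian h (smoothPer_hasDerivAt f) (smoothPer_hasDerivAt (derivPer L f))
    (smoothPer_continuous (derivPer L (derivPer L f))) f.2.2 (derivPer L f).2.2 hL).trans_eq ?_
  refine intervalIntegral.integral_congr fun x _ => ?_
  change (c - φ.1 x) * (4 * f.1 x - deriv (derivPer L f).1 x) ^ 2 - 3 * c *
    ((4 * f.1 x - deriv (derivPer L f).1 x) * f.1 x) =
    ((c - φ.1 x) * (4 * f.1 x - deriv (derivPer L f).1 x) - 3 * c * f.1 x) *
      (4 * f.1 x - deriv (derivPer L f).1 x)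
  ring

theorem IsProfile.trough_lt_crest (hL : 0 < L) {φ : ℝ → ℝ} (h : IsProfile c a b L φ φ₁) :
    φ (L / 2) < φ 0 := by
  refine strictAntiOn_of_deriv_neg (convex_Icc 0 (L / 2)) h.continuous.continuousOn
    (fun x hx => ?_) (left_mem_Icc.mpr (by linarith)) (right_mem_Icc.mpr (by linarith))
    (by linarith)
  rw [interior_Icc] at hx
  rw [(h.hasDerivAt x).deriv]
  exact h.neg x hx

/-- The plane spanned by the wave and its variation does not meet the radical of the Hessian
form. -/
theorem exists_hessianForm_combination_ne (hc : 0 < c) (hL : 0 < L)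
    (h : IsProfile c a b L φ.1 φ₁) (hψ : IsVariation c a δa δb φ.1 φ₁ ψ.1 ψ₁)
    (hpos : ∀ x, 0 < φ.1 x) (hδb : δb ≠ 0) {x y : ℝ} (hxy : x ≠ 0 ∨ y ≠ 0) :
    ∃ g, hessianForm c φ (x • invVariation c δb φ ψ + y • invWave c b φ) g ≠ 0 := by
  have h1 : ∀ s, (hessianPer c φ (x • invVariation c δb φ ψ + y • invWave c b φ)).1 s =
      x * (δb / 4) + y * (b / 4 - 1 / 2 * (φ.1 s * φ.1 s)) := by
    intro s
    rw [map_add, map_smul, map_smul, hessianPer_invVariation hc h hψ, hessianPer_invWave hc h]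
    rfl
  by_cases hy : y = 0
  · refine exists_hessianForm_ne hL (x := 0) ?_
    rw [h1, hy, zero_mul, add_zero]
    exact mul_ne_zero (hxy.resolve_right (not_not.mpr hy)) (div_ne_zero hδb four_ne_zero)
  -- With a nonzero coefficient of φ, a vanishing image under 𝓛 would make φ² constant, against 0 <
  -- φ(L/2) < φ(0).
  · by_contra hall
    have h2 : ∀ s, (hessianPer c φ (x • invVariation c δb φ ψ + y • invWave c b φ)).1 s = 0 :=
      fun s => by_contra fun hs => hall (exists_hessianForm_ne hL hs)
    have h3 := (h2 0).trans (h2 (L / 2)).symm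
    rw [h1, h1] at h3
    have h4 : φ.1 0 * φ.1 0 = φ.1 (L / 2) * φ.1 (L / 2) :=
      mul_left_cancel₀ hy (by linarith)
    have := h.trough_lt_crest hL
    nlinarith [hpos 0, hpos (L / 2)]

/-- The Hessian form is nonnegative on the functions orthogonal to `1` and `φ²`, if the variations
of the mass and of the energy satisfy the stability criterion. -/
theorem hessianForm_nonneg (hc : 0 < c) (hL : 0 < L) (h : IsProfile c a b L φ.1 φ₁)
    (hψ : IsVariation c a 1 β φ.1 φ₁ ψ.1 ψ₁) (hpos : ∀ x, 0 < φ.1 x) (hβ : β ≠ 0)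
    (hM : 0 < integralPer L φ)
    (hratio : integralPer L (φ * φ * ψ) * integralPer L φ -
      integralPer L (φ * φ * φ) * integralPer L ψ ≤ 0)
    (hmass : β < 0 → 0 ≤ integralPer L ψ)
    (hhill : 0 < β → ∃ η η₁, IsVariation c a 1 0 φ.1 φ₁ η η₁ ∧ η 0 < 0 ∧ η₁ 0 = 0 ∧
      0 ≤ η₁ (L / 2))
    {f : smoothPer L} (h1 : integralPer L (helmholtzPer L f) = 0)
    (h2 : integralPer L (φ * φ * helmholtzPer L f) = 0) : 0 ≤ hessianForm c φ f f := by
  have hB := hessianForm_comm c φ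
  set B := hessianForm c φ
  set p := invVariation c β φ ψ
  set u := invWave c b φ
  have hp : helmholtzPer L p = ψ := helmholtzPer_invVariation hc h hψ
  have hu : helmholtzPer L u = φ := helmholtzPer_invWave hc h
  have hpB : ∀ g, B p g = β / 4 * integralPer L (helmholtzPer L g) :=
    hessianForm_invVariation hc h hψ
  have huB : ∀ g, B u g = b / 4 * integralPer L (helmholtzPer L g) -
      1 / 2 * integralPer L (φ * φ * helmholtzPer L g) := hessianForm_invWave hc h
  have g11 : B p p = β / 4 * integralPer L ψ := by rw [hpB, hp]
  have g12 : B p u = β / 4 * integralPer L φ := by rw [hpB, hu]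
  have g21 : B u p = b / 4 * integralPer L ψ - 1 / 2 * integralPer L (φ * φ * ψ) := by
    rw [huB, hp]
  have g22 : B u u = b / 4 * integralPer L φ - 1 / 2 * integralPer L (φ * φ * φ) := by
    rw [huB, hu]
  have g3 := hB p u
  -- Writing B(p, u)² with one factor as B(u, p) cancels the terms in b.
  have hdet : B p p * B u u - B p u ^ 2 = β / 8 * (integralPer L (φ * φ * ψ) * integralPer L φ -
      integralPer L (φ * φ * φ) * integralPer L ψ) := by
    have e : B p u ^ 2 = β / 4 * integralPer L φ *
        (b / 4 * integralPer L ψ - 1 / 2 * integralPer L (φ * φ * ψ)) := by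
      rw [sq, g12, ← g21, ← g3, g12]
    rw [e, g11, g22]
    ring
  have hpf : B p f = 0 := by rw [hpB, h1, mul_zero]
  have huf : B u f = 0 := by rw [huB, h1, h2, mul_zero, mul_zero, sub_zero]
  have hne : ∀ {x y : ℝ}, x ≠ 0 ∨ y ≠ 0 → ∃ g, B (x • p + y • u) g ≠ 0 := fun hxy =>
    exists_hessianForm_combination_ne hc hL h hψ hpos hβ hxy
  have hcombf : ∀ x y : ℝ, B (x • p + y • u) f = 0 := by
    intro x y
    rw [map_add, map_smul, map_smul, LinearMap.add_apply, LinearMap.smul_apply,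
      LinearMap.smul_apply, hpf, huf, smul_zero, smul_zero, add_zero]
  have hcombq : ∀ x y : ℝ, B (x • p + y • u) (x • p + y • u) =
      x ^ 2 * B p p + 2 * x * y * B p u + y ^ 2 * B u u := by
    intro x y
    simp only [map_add, map_smul, LinearMap.add_apply, LinearMap.smul_apply, smul_eq_mul, ← g3]
    ring
  have hc3 : 0 < 3 * c := by positivity
  rcases lt_or_gt_of_ne hβ with hneg | hpos'
  -- Case B' < 0: the plane of p and u is nonpositive, and the Hill form, nonnegative on functions
  -- vanishing at crest and trough, allows no further negative direction.
  · have hd : 0 ≤ B p p * B u u - B p u ^ 2 := by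
      rw [hdet]
      exact mul_nonneg_of_nonpos_of_nonpos (by linarith) hratio
    have g12' : B p u < 0 := by
      rw [g12]
      exact mul_neg_of_neg_of_pos (by linarith) hM
    have g11' : B p p ≤ 0 := by
      rw [g11]
      exact mul_nonpos_of_nonpos_of_nonneg (by linarith) (hmass hneg)
    -- If B(p, p) were 0, the determinant would be -B(p, u)² < 0.
    have g11'' : B p p < 0 := by
      refine lt_of_le_of_ne g11' fun h0 => ?_
      rw [h0, zero_mul] at hd
      nlinarith
    let ev : ℝ → smoothPer L →ₗ[ℝ] ℝ := fun x =>
      { toFun := fun f => f.1 x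
        map_add' := fun _ _ => rfl
        map_smul' := fun _ _ => rfl }
    have hne0 := g11''.ne
    refine form_nonneg_of_codim_two (B := B) hB (ev 0) (ev (L / 2)) (fun w hw0 hwL => ?_) g11''
      (u := (-(B p u / B p p)) • p + (1 : ℝ) • u) ?_ ?_ (hne (Or.inr one_ne_zero)) hpf
      (hcombf _ _)
    · refine le_trans (mul_nonneg hc3.le (hill_nonneg_of_vanish hL h (smoothPer_hasDerivAt w)
        (smoothPer_continuous (derivPer L w)) w.2.2 hw0 hwL)) (hill_le_hessianForm hL h w)
    · rw [map_add, map_smul, map_smul, smul_eq_mul, smul_eq_mul, neg_mul,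
        div_mul_cancel₀ _ g11''.ne, one_mul, neg_add_cancel]
    · rw [hcombq]
      have e : (-(B p u / B p p)) ^ 2 * B p p + 2 * -(B p u / B p p) * 1 * B p u + 1 ^ 2 * B u u =
          (B p p * B u u - B p u ^ 2) / B p p := by
        field_simp
        ring
      rw [e]
      exact div_nonpos_of_nonneg_of_nonpos hd g11'
  -- Case B' > 0: the Hill form is nonnegative on a hyperplane, so one nonpositive direction in the
  -- plane is enough.
  · obtain ⟨η, η₁, hη, hη0, hη1, hηL⟩ := hhill hpos'
    obtain ⟨x₀, hx₀⟩ := exists_hill_nonneg hL h hη hη0 hη1 hηL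
    have hd : B p p * B u u - B p u ^ 2 ≤ 0 := by
      rw [hdet]
      exact mul_nonpos_of_nonneg_of_nonpos (by linarith) hratio
    obtain ⟨x, y, hxy, hq⟩ : ∃ x y : ℝ, (x ≠ 0 ∨ y ≠ 0) ∧
        B (x • p + y • u) (x • p + y • u) ≤ 0 := by
      rcases le_or_gt (B p p) 0 with h0 | h0
      · refine ⟨1, 0, Or.inl one_ne_zero, ?_⟩
        rw [hcombq]
        linarith
      -- The form at this combination is B(p, p) times the Gram determinant.
      · refine ⟨-(B p u), B p p, Or.inr h0.ne', ?_⟩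
        rw [hcombq]
        nlinarith
    let ev : smoothPer L →ₗ[ℝ] ℝ :=
      { toFun := fun f => f.1 x₀ + f.1 (-x₀)
        map_add' := fun f g => by
          change f.1 x₀ + g.1 x₀ + (f.1 (-x₀) + g.1 (-x₀)) = _
          ring
        map_smul' := fun r f => by
          change r * f.1 x₀ + r * f.1 (-x₀) = r * _
          ring }
    obtain ⟨g, hg⟩ := hne hxy
    refine form_nonneg_of_hyperplane (S := ⊤) hB ev (fun w _ hw => ?_) trivial hq
      ⟨g, trivial, hg⟩ trivial (hcombf x y)
    exact le_trans (mul_nonneg hc3.le (hx₀ _ _ (smoothPer_hasDerivAt w)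
      (smoothPer_continuous (derivPer L w)) w.2.2 (derivPer L w).2.2 hw))
      (hill_le_hessianForm hL h w)

end WaveForm

/-! ## The Hessian form on `L²_per` -/

/-- A dense subspace of a kernel. -/
theorem mem_closure_inf_ker {E : Type*} [NormedAddCommGroup E] [NormedSpace ℂ E]
    (D : Submodule ℂ E) (l : E →L[ℂ] ℂ) {w : E} (hw : w ∈ closure (D : Set E)) (hl : l w = 0) :
    w ∈ closure ((D ⊓ LinearMap.ker (l : E →ₗ[ℂ] ℂ) : Submodule ℂ E) : Set E) := by
  by_cases h : ∃ h ∈ D, l h ≠ 0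
  · obtain ⟨h, hD, hne⟩ := h
    obtain ⟨x, hx, hlim⟩ := mem_closure_iff_seq_limit.mp hw
    -- The approximating sequence is corrected along one fixed vector of D not killed by l.
    refine mem_closure_iff_seq_limit.mpr ⟨fun n => x n - (l (x n) / l h) • h, fun n => ⟨?_, ?_⟩, ?_⟩
    · exact D.sub_mem (hx n) (D.smul_mem _ hD)
    · change l (x n - (l (x n) / l h) • h) = 0
      rw [map_sub, map_smul, smul_eq_mul, div_mul_cancel₀ _ hne, sub_self]
    · have h1 : Tendsto (fun n => l (x n)) atTop (𝓝 0) := by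
        rw [← hl]
        exact (l.continuous.tendsto w).comp hlim
      have h2 := hlim.sub ((h1.div_const (l h)).smul_const h)
      simpa using h2
  · push Not at h
    refine closure_mono ?_ hw
    exact fun x hx => ⟨hx, h x hx⟩

section Density

variable {L : ℝ} [Fact (0 < L)]

/-- A smooth periodic function as an element of `L²_per`. -/
def vec (f : smoothPer L) : L2per L := toL2 (toHInf f)

theorem vec_add (f g : smoothPer L) : vec (f + g) = vec f + vec g := by
  rw [vec, toL2_eq_add (u := toHInf f) (v := toHInf g) 1 1 (fun x => by
    rw [one_mul, one_mul]; rfl), Complex.ofReal_one, one_smul, one_smul]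
  rfl

theorem vec_smul (r : ℝ) (f : smoothPer L) : vec (r • f) = (r : ℂ) • vec f := by
  rw [vec, toL2_eq_add (u := toHInf f) (v := toHInf f) r 0 (fun x => by
    rw [zero_mul, add_zero]; rfl), Complex.ofReal_zero, zero_smul, add_zero]
  rfl

theorem vec_sub (f g : smoothPer L) : vec (f - g) = vec f - vec g := by
  have h := vec_smul (-1) g
  rw [neg_one_smul] at h
  rw [sub_eq_add_neg, vec_add, h]
  push_cast
  rw [neg_one_smul, sub_eq_add_neg]

theorem vec_zero : vec (0 : smoothPer L) = 0 := by
  have h := vec_smul 0 (0 : smoothPer L)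
  rwa [zero_smul, Complex.ofReal_zero, zero_smul] at h

theorem inner_vec (f g : smoothPer L) :
    inner ℂ (vec f) (vec g) = ((1 / L * integralPer L (f * g) : ℝ) : ℂ) := inner_toL2 _ _

theorem coeff_vec_derivPer (f : smoothPer L) (n : ℤ) :
    coeff (vec (derivPer L f)) n = Complex.I * waveNumber L n * coeff (vec f) n :=
  coeff_derivative (toHInf f) n

theorem coeff_vec_helmholtzPer (f : smoothPer L) (n : ℤ) :
    coeff (vec (helmholtzPer L f)) n = (4 + waveNumber L n ^ 2) * coeff (vec f) n :=
  coeff_helmholtz (u := toHInf f) (fun _ => rfl) n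

theorem hessian_vec (c : ℝ) (φ : HInfPer L) (f : smoothPer L) :
    hessian c φ (vec (helmholtzPer L f)) = vec (hessianPer c (ofHInf φ) f) :=
  hessian_toL2 (u := toHInf f) (fun _ => rfl) (fun _ => rfl)

/-- The cosine of wave number `2πn/L`. -/
def cosPer (L : ℝ) [Fact (0 < L)] (n : ℤ) : smoothPer L :=
  ⟨fun x => Real.cos (waveNumber L n * x), by fun_prop, fun x => by
    have h : (0 : ℝ) < L := Fact.out
    change Real.cos (waveNumber L n * (x + L)) = Real.cos (waveNumber L n * x)
    rw [← Real.cos_add_int_mul_two_pi (waveNumber L n * x) n]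
    congr 1
    rw [waveNumber]
    field_simp⟩

/-- The sine of wave number `2πn/L`. -/
def sinPer (L : ℝ) [Fact (0 < L)] (n : ℤ) : smoothPer L :=
  ⟨fun x => Real.sin (waveNumber L n * x), by fun_prop, fun x => by
    have h : (0 : ℝ) < L := Fact.out
    change Real.sin (waveNumber L n * (x + L)) = Real.sin (waveNumber L n * x)
    rw [← Real.sin_add_int_mul_two_pi (waveNumber L n * x) n]
    congr 1
    rw [waveNumber]
    field_simp⟩

theorem derivPer_cosPer (n : ℤ) : derivPer L (cosPer L n) = (-waveNumber L n) • sinPer L n :=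
  derivPer_eq fun x => by
    refine ((hasDerivAt_id x).const_mul (waveNumber L n)).cos.congr_deriv ?_
    change _ = -waveNumber L n * Real.sin (waveNumber L n * x)
    simp only [id]
    ring

theorem derivPer_sinPer (n : ℤ) : derivPer L (sinPer L n) = waveNumber L n • cosPer L n :=
  derivPer_eq fun x => by
    refine ((hasDerivAt_id x).const_mul (waveNumber L n)).sin.congr_deriv ?_
    change _ = waveNumber L n * Real.cos (waveNumber L n * x)
    simp only [id]
    ring

theorem helmholtzPer_cosPer (n : ℤ) :
    helmholtzPer L ((1 / (4 + waveNumber L n ^ 2)) • cosPer L n) = cosPer L n := by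
  have h : 4 + waveNumber L n ^ 2 ≠ 0 := by positivity
  have h1 : helmholtzPer L (cosPer L n) = (4 + waveNumber L n ^ 2) • cosPer L n := by
    rw [helmholtzPer_apply, derivPer_cosPer, map_smul, derivPer_sinPer]
    module
  rw [map_smul, h1, smul_smul, one_div_mul_cancel h, one_smul]

theorem helmholtzPer_sinPer (n : ℤ) :
    helmholtzPer L ((1 / (4 + waveNumber L n ^ 2)) • sinPer L n) = sinPer L n := by
  have h : 4 + waveNumber L n ^ 2 ≠ 0 := by positivity
  have h1 : helmholtzPer L (sinPer L n) = (4 + waveNumber L n ^ 2) • sinPer L n := by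
    rw [helmholtzPer_apply, derivPer_sinPer, map_smul, derivPer_cosPer]
    module
  rw [map_smul, h1, smul_smul, one_div_mul_cancel h, one_smul]

theorem fourierBasis_eq (n : ℤ) :
    fourierBasis (T := L) n = vec (cosPer L n) + Complex.I • vec (sinPer L n) := by
  have h : fourier n = (toHInf (cosPer L n)).onCircle +
      Complex.I • (toHInf (sinPer L n)).onCircle := by
    ext y
    induction y using QuotientAddGroup.induction_on with
    | H x =>
      have h1 : (fourier n : AddCircle L → ℂ) (x : AddCircle L) =
          ((Real.cos (waveNumber L n * x) : ℝ) : ℂ) +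
            Complex.I * ((Real.sin (waveNumber L n * x) : ℝ) : ℂ) := by
        rw [fourier_coe_apply, Complex.ofReal_cos, Complex.ofReal_sin, mul_comm Complex.I,
          ← Complex.exp_mul_I, waveNumber]
        congr 1
        push_cast
        ring
      exact h1
  rw [coe_fourierBasis, fourierLp, h, map_add, map_smul]
  rfl

/-- The vectors `(4 - ∂ₓ²) f` with `f` smooth, complex-valued and periodic. -/
def smoothVectors (L : ℝ) [Fact (0 < L)] : Submodule ℂ (L2per L) where
  carrier := {w | ∃ f g : smoothPer L, w = vec (helmholtzPer L f) +
    Complex.I • vec (helmholtzPer L g)}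
  zero_mem' := ⟨0, 0, by rw [map_zero, vec_zero, smul_zero, add_zero]⟩
  add_mem' := by
    rintro _ _ ⟨f, g, rfl⟩ ⟨f', g', rfl⟩
    refine ⟨f + f', g + g', ?_⟩
    rw [map_add, map_add, vec_add, vec_add]
    module
  smul_mem' := by
    rintro z _ ⟨f, g, rfl⟩
    refine ⟨z.re • f - z.im • g, z.im • f + z.re • g, ?_⟩
    rw [map_sub, map_add, map_smul, map_smul, map_smul, map_smul, vec_sub, vec_add, vec_smul,
      vec_smul, vec_smul, vec_smul]
    have h1 : z = z.re + z.im * Complex.I := (Complex.re_add_im z).symm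
    have h2 : Complex.I * Complex.I = -1 := Complex.I_mul_I
    generalize (z.re : ℂ) = r at *
    generalize (z.im : ℂ) = s at *
    subst h1
    rw [smul_add, smul_smul, add_mul, mul_assoc, h2]
    module

/-- Trigonometric polynomials are in the range of 4 - ∂ₓ² on smooth functions. -/
theorem dense_smoothVectors (w : L2per L) : w ∈ closure (smoothVectors L : Set (L2per L)) := by
  have h1 : Submodule.span ℂ (range (fourierBasis (T := L))) ≤ smoothVectors L := by
    rw [Submodule.span_le]
    rintro _ ⟨n, rfl⟩
    refine ⟨(1 / (4 + waveNumber L n ^ 2)) • cosPer L n,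
      (1 / (4 + waveNumber L n ^ 2)) • sinPer L n, ?_⟩
    rw [helmholtzPer_cosPer, helmholtzPer_sinPer, fourierBasis_eq]
  have h2 : w ∈ (Submodule.span ℂ (range (fourierBasis (T := L)))).topologicalClosure := by
    rw [fourierBasis.dense_span]
    trivial
  exact closure_mono h1 h2

theorem re_inner_hessian_smooth (c : ℝ) (φ : HInfPer L) (f g : smoothPer L) :
    (inner ℂ (hessian c φ (vec (helmholtzPer L f) + Complex.I • vec (helmholtzPer L g)))
      (vec (helmholtzPer L f) + Complex.I • vec (helmholtzPer L g))).re =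
      1 / L * (hessianForm c (ofHInf φ) f f + hessianForm c (ofHInf φ) g g) := by
  rw [map_add, map_smul, hessian_vec, hessian_vec, inner_add_left, inner_add_right,
    inner_add_right, inner_smul_left, inner_smul_left, inner_smul_right, inner_smul_right,
    inner_vec, inner_vec, inner_vec, inner_vec]
  simp only [Complex.add_re, Complex.mul_re, Complex.mul_im, Complex.I_re, Complex.I_im,
    Complex.ofReal_re, Complex.ofReal_im, Complex.conj_I, Complex.neg_re, Complex.neg_im,
    hessianForm_apply]
  ring

theorem inner_vec_smooth_eq_zero {h f g : smoothPer L}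
    (h0 : inner ℂ (vec h) (vec f + Complex.I • vec g) = 0) :
    integralPer L (h * f) = 0 ∧ integralPer L (h * g) = 0 := by
  have hL : (1 / L : ℝ) ≠ 0 := by
    have : (0 : ℝ) < L := Fact.out
    positivity
  rw [inner_add_right, inner_smul_right, inner_vec, inner_vec] at h0
  have h1 := congrArg Complex.re h0
  have h2 := congrArg Complex.im h0
  simp only [Complex.add_re, Complex.add_im, Complex.mul_re, Complex.mul_im, Complex.I_re,
    Complex.I_im, Complex.ofReal_re, Complex.ofReal_im, Complex.zero_re, Complex.zero_im] at h1 h2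
  constructor
  · refine (mul_eq_zero.mp (?_ : 1 / L * integralPer L (h * f) = 0)).resolve_left hL
    linarith
  · refine (mul_eq_zero.mp (?_ : 1 / L * integralPer L (h * g) = 0)).resolve_left hL
    linarith

/-- Nonnegativity of the Hessian form extends from smooth functions to `L²_per`. -/
theorem re_inner_hessian_nonneg {c : ℝ} {φ : HInfPer L}
    (hQ : ∀ f : smoothPer L, integralPer L (helmholtzPer L f) = 0 →
      integralPer L (ofHInf φ * ofHInf φ * helmholtzPer L f) = 0 →
      0 ≤ hessianForm c (ofHInf φ) f f)
    {w : L2per L} (h1 : inner ℂ (vec 1) w = 0)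
    (h2 : inner ℂ (vec (ofHInf φ * ofHInf φ)) w = 0) : 0 ≤ (inner ℂ (hessian c φ w) w).re := by
  have hL : (0 : ℝ) < L := Fact.out
  -- Approximation by smooth vectors has to respect both constraints, which are imposed one after
  -- the other.
  have h3 := mem_closure_inf_ker _ (innerSL ℂ (vec (ofHInf φ * ofHInf φ)))
    (mem_closure_inf_ker _ (innerSL ℂ (vec (1 : smoothPer L))) (dense_smoothVectors w) h1) h2
  have hcl : IsClosed {w : L2per L | 0 ≤ (inner ℂ (hessianCLM c φ w) w).re} := by
    refine isClosed_le continuous_const ?_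
    exact Complex.continuous_re.comp ((hessianCLM c φ).continuous.inner continuous_id)
  refine closure_minimal ?_ hcl h3
  rintro w ⟨⟨⟨f, g, rfl⟩, hw1⟩, hw2⟩
  obtain ⟨e1, e2⟩ := inner_vec_smooth_eq_zero hw1
  obtain ⟨e3, e4⟩ := inner_vec_smooth_eq_zero hw2
  rw [one_mul] at e1 e2
  change 0 ≤ (inner ℂ (hessian c φ _) _).re
  rw [re_inner_hessian_smooth]
  have := hQ f e1 e3
  have := hQ g e2 e4
  positivity

end Density

/-! ## The spectrum of the linearized operator -/

/-- The symbol of `J`. -/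
def symbolJ (L : ℝ) (n : ℤ) : ℂ :=
  -((4 + waveNumber L n ^ 2) / (1 + waveNumber L n ^ 2) * (Complex.I * waveNumber L n))

/-- The symbol of `(1 + ∂ₓ)⁻¹`. -/
def symbolD (L : ℝ) (n : ℤ) : ℂ := (1 + Complex.I * waveNumber L n)⁻¹

section Symbols

variable {L : ℝ}

theorem symbolJ_zero : symbolJ L 0 = 0 := by
  simp [symbolJ, waveNumber]

theorem star_symbolJ (n : ℤ) : star (symbolJ L n) = -symbolJ L n := by
  simp [symbolJ]

theorem one_add_ne (n : ℤ) : 1 + Complex.I * (waveNumber L n : ℂ) ≠ 0 := by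
  intro h
  have := congrArg Complex.re h
  simp at this

theorem one_add_sq_ne (n : ℤ) : 1 + (waveNumber L n : ℂ) ^ 2 ≠ 0 := by
  have : (0 : ℝ) < 1 + waveNumber L n ^ 2 := by positivity
  exact_mod_cast this.ne'

/-- Thus (1 + ∂ₓ)⁻¹J is minus the identity up to an operator whose symbol tends to 0. -/
theorem symbolD_mul_symbolJ (n : ℤ) : symbolD L n * symbolJ L n =
    symbolD L n * (1 - 3 * Complex.I * waveNumber L n / (1 + waveNumber L n ^ 2)) - 1 := by
  have h1 := one_add_ne (L := L) n
  have h2 := one_add_sq_ne (L := L) n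
  rw [symbolD, symbolJ]
  field_simp
  ring

theorem norm_symbolD (n : ℤ) : ‖symbolD L n‖ = (Real.sqrt (1 + waveNumber L n ^ 2))⁻¹ := by
  rw [symbolD, norm_inv, Complex.norm_eq_sqrt_sq_add_sq]
  simp

theorem norm_symbolD_le (n : ℤ) : ‖symbolD L n‖ ≤ 1 := by
  rw [norm_symbolD]
  refine inv_le_one_of_one_le₀ (Real.one_le_sqrt.mpr ?_)
  nlinarith [sq_nonneg (waveNumber L n)]

theorem norm_symbol_bracket_le (n : ℤ) :
    ‖1 - 3 * Complex.I * waveNumber L n / (1 + waveNumber L n ^ 2)‖ ≤ 4 := by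
  have h1 : ‖3 * Complex.I * waveNumber L n / (1 + (waveNumber L n : ℂ) ^ 2)‖ =
      3 * |waveNumber L n| / (1 + waveNumber L n ^ 2) := by
    have e : (1 + (waveNumber L n : ℂ) ^ 2) = ((1 + waveNumber L n ^ 2 : ℝ) : ℂ) := by push_cast; rfl
    rw [e, norm_div, norm_mul, norm_mul, Complex.norm_I, Complex.norm_real, Complex.norm_real,
      Real.norm_eq_abs, Real.norm_eq_abs, abs_of_nonneg (by positivity : 0 ≤ 1 + waveNumber L n ^ 2)]
    simp
  have h2 : 3 * |waveNumber L n| / (1 + waveNumber L n ^ 2) ≤ 3 := by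
    rw [div_le_iff₀ (by positivity)]
    nlinarith [sq_abs (waveNumber L n), sq_nonneg (|waveNumber L n| - 1)]
  calc _ ≤ ‖(1 : ℂ)‖ + ‖3 * Complex.I * waveNumber L n / (1 + (waveNumber L n : ℂ) ^ 2)‖ :=
        norm_sub_le _ _
    _ ≤ 1 + 3 := by rw [norm_one, h1]; linarith
    _ = 4 := by norm_num

theorem tendsto_symbolD (hL : 0 < L) : Tendsto (symbolD L) cofinite (𝓝 0) := by
  have h1 : Tendsto (fun n : ℤ => ‖(n : ℝ)‖) cofinite atTop :=
    (tendsto_norm_cocompact_atTop (E := ℝ)).comp Int.tendsto_coe_cofinite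
  have h2 : Tendsto (fun n : ℤ => 2 * Real.pi / L * ‖(n : ℝ)‖) cofinite atTop :=
    h1.const_mul_atTop (by positivity)
  refine squeeze_zero_norm' ?_ h2.inv_tendsto_atTop
  filter_upwards [h2.eventually_gt_atTop 0] with n hn
  have h3 : 2 * Real.pi / L * ‖(n : ℝ)‖ = |waveNumber L n| := by
    rw [waveNumber, Real.norm_eq_abs, abs_div, abs_mul, abs_of_pos hL,
      abs_of_pos Real.two_pi_pos]
    ring
  rw [h3] at hn
  rw [norm_symbolD, Pi.inv_apply, h3]
  refine inv_anti₀ hn (Real.abs_le_sqrt ?_)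
  linarith

/-- The symbol of the smoothing part of `(1 + ∂ₓ)⁻¹ J`. -/
def symbolE (L : ℝ) (n : ℤ) : ℂ :=
  symbolD L n * (1 - 3 * Complex.I * waveNumber L n / (1 + waveNumber L n ^ 2))

theorem norm_symbolE_le (n : ℤ) : ‖symbolE L n‖ ≤ 4 := by
  rw [symbolE, norm_mul, ← one_mul (4 : ℝ)]
  exact mul_le_mul (norm_symbolD_le n) (norm_symbol_bracket_le n) (norm_nonneg _) zero_le_one

theorem tendsto_symbolE (hL : 0 < L) : Tendsto (symbolE L) cofinite (𝓝 0) := by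
  have h1 := (tendsto_symbolD hL).norm.mul_const 4
  rw [norm_zero, zero_mul] at h1
  refine squeeze_zero_norm (fun n => ?_) h1
  rw [symbolE, norm_mul]
  exact mul_le_mul_of_nonneg_left (norm_symbol_bracket_le n) (norm_nonneg _)

theorem norm_invSymbol_le (n : ℤ) : ‖invSymbol L n‖ ≤ 1 := by
  rw [invSymbol, Complex.norm_real, Real.norm_eq_abs, abs_of_nonneg (by positivity),
    div_le_one (by positivity)]
  nlinarith [sq_nonneg (waveNumber L n)]

theorem tendsto_invSymbol (hL : 0 < L) : Tendsto (invSymbol L) cofinite (𝓝 0) := by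
  have h1 := (tendsto_symbolD hL).norm
  rw [norm_zero] at h1
  refine squeeze_zero_norm (fun n => ?_) h1
  rw [norm_symbolD, invSymbol, Complex.norm_real, Real.norm_eq_abs, abs_of_nonneg (by positivity),
    one_div]
  refine inv_anti₀ (Real.sqrt_pos.mpr (by positivity)) (Real.sqrt_le_iff.mpr ⟨by positivity, ?_⟩)
  nlinarith [sq_nonneg (waveNumber L n), sq_nonneg (waveNumber L n ^ 2)]

end Symbols

section Kernel

variable {L : ℝ} [Fact (0 < L)] {c a b : ℝ} {φ : HInfPer L} {φ₁ : ℝ → ℝ}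

theorem coeff_vec_one {n : ℤ} (hn : n ≠ 0) : coeff (vec (1 : smoothPer L)) n = 0 := by
  change coeff (toL2 (oneHInf L)) n = 0
  rw [toL2_one, coeff, fourierBasis.repr_self, lp.single_apply, Pi.single_eq_of_ne hn]

theorem waveNumber_mul_coeff_algebraMap (r : ℝ) (n : ℤ) :
    (waveNumber L n : ℂ) * coeff (vec (algebraMap ℝ (smoothPer L) r)) n = 0 := by
  rw [Algebra.algebraMap_eq_smul_one, vec_smul, coeff_smul]
  by_cases hn : n = 0
  · simp [hn, waveNumber]
  · rw [coeff_vec_one hn, mul_zero, mul_zero]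

/-- The square of a wave is mapped by `J` to a multiple of the derivative of the wave. -/
theorem symbolJ_mul_coeff_sq (hc : 0 < c) (h : IsProfile c a b L φ φ₁) (n : ℤ) :
    symbolJ L n * coeff (vec (ofHInf φ * ofHInf φ)) n =
      -(2 * c) * coeff (vec (derivPer L (ofHInf φ))) n := by
  have hc' : (c : ℂ) ≠ 0 := by exact_mod_cast hc.ne'
  have h1 := coeff_vec_helmholtzPer (invWave c b (ofHInf φ)) n
  rw [helmholtzPer_invWave (φ := ofHInf φ) hc h] at h1
  have h2 : coeff (vec (invWave c b (ofHInf φ))) n = (1 / (3 * c) : ℝ) *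
      (c * coeff (vec (ofHInf φ)) n - (1 / 2 : ℝ) * coeff (vec (ofHInf φ * ofHInf φ)) n -
        coeff (vec (algebraMap ℝ (smoothPer L) (b / 4))) n) := by
    rw [invWave, vec_smul, coeff_smul, vec_sub, coeff_sub, vec_sub, coeff_sub, vec_smul,
      coeff_smul, vec_smul, coeff_smul]
  have h3 := waveNumber_mul_coeff_algebraMap (L := L) (b / 4) n
  have h4 := one_add_sq_ne (L := L) n
  rw [coeff_vec_derivPer, symbolJ]
  rw [h2] at h1
  generalize coeff (vec (ofHInf φ)) n = f at *
  generalize coeff (vec (ofHInf φ * ofHInf φ)) n = s at *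
  generalize coeff (vec (algebraMap ℝ (smoothPer L) (b / 4))) n = t at *
  generalize (waveNumber L n : ℂ) = k at *
  push_cast at h1
  have h5 : 3 * c * f = (4 + k ^ 2) * (c * f - 1 / 2 * s - t) := by
    have e : 3 * (c : ℂ) * (1 / (3 * c)) = 1 := by field_simp
    linear_combination (3 * c) * h1 + (4 + k ^ 2) * (c * f - 1 / 2 * s - t) * e
  have h6 : (4 + k ^ 2) * k * s = 2 * c * (k * f) * (1 + k ^ 2) := by
    linear_combination (2 * k) * h5 - 2 * (4 + k ^ 2) * h3
  field_simp
  linear_combination -h6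

/-- The derivative of a wave lies in the kernel of the Hessian operator. -/
theorem hessian_deriv_wave (hc : 0 < c) (h : IsProfile c a b L φ φ₁) :
    hessian c φ (vec (derivPer L (ofHInf φ))) = 0 := by
  have h1 : (derivPer L (ofHInf φ)).1 = φ₁ := funext fun x => (h.hasDerivAt x).deriv
  have h2 : IsVariation c a 0 0 (ofHInf φ).1 φ₁ (derivPer L (ofHInf φ)).1
      (fun x => φ x - a / (c - φ x) ^ 3) := by
    rw [h1]
    exact h.isVariation
  rw [← helmholtzPer_invVariation (φ := ofHInf φ) hc h h2, hessian_vec,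
    hessianPer_invVariation (φ := ofHInf φ) hc h h2, zero_div, map_zero, vec_zero]

/-- A vector on which a nonnegative quadratic form vanishes is in its kernel. -/
theorem inner_hessian_eq_zero {S : Submodule ℂ (L2per L)}
    (hS : ∀ w ∈ S, 0 ≤ (inner ℂ (hessian c φ w) w).re) {w : L2per L} (hw : w ∈ S)
    (h0 : inner ℂ (hessian c φ w) w = 0) : hessian c φ w ∈ Sᗮ := by
  have key : ∀ h ∈ S, (inner ℂ (hessian c φ w) h).re = 0 := by
    intro h hh
    by_contra hne
    set r := (inner ℂ (hessian c φ w) h).re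
    set q := (inner ℂ (hessian c φ h) h).re
    -- The coefficient is chosen so that the form takes the value q - (q + 1) = -1.
    have h1 := hS (h + ((-(q + 1) / (2 * r) : ℝ) : ℂ) • w) (S.add_mem hh (S.smul_mem _ hw))
    have h2 : (inner ℂ (hessian c φ h) w).re = r := by
      rw [inner_hessian, ← inner_conj_symm, Complex.conj_re]
    rw [map_add, map_smul, inner_add_left, inner_add_right, inner_add_right, inner_smul_left,
      inner_smul_left, inner_smul_right, inner_smul_right, h0, Complex.conj_ofReal] at h1
    simp only [mul_zero, add_zero, Complex.add_re, Complex.re_ofReal_mul, h2] at h1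
    change 0 ≤ q + -(q + 1) / (2 * r) * r + -(q + 1) / (2 * r) * r at h1
    have h3 : -(q + 1) / (2 * r) * r = -(q + 1) / 2 := by field_simp
    rw [h3] at h1
    linarith
  refine (Submodule.mem_orthogonal' S _).mpr fun h hh => Complex.ext (key h hh) ?_
  have h1 := key _ (S.smul_mem Complex.I hh)
  rw [inner_smul_right, Complex.mul_re, Complex.I_re, Complex.I_im] at h1
  rw [Complex.zero_im]
  linarith

/-- The linearized operator has no eigenvalues off the imaginary axis if the Hessian is nonnegative
on the functions orthogonal to `1` and `φ²`. -/
theorem eq_zero_of_eigenvector (hc : 0 < c) (h : IsProfile c a b L φ φ₁)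
    (hQ : ∀ w : L2per L, inner ℂ (vec 1) w = 0 →
      inner ℂ (vec (ofHInf φ * ofHInf φ)) w = 0 → 0 ≤ (inner ℂ (hessian c φ w) w).re)
    {z : ℂ} (hz : z.re ≠ 0) {w : L2per L}
    (hw : ∀ n, symbolJ L n * coeff (hessian c φ w) n = z * coeff w n) : w = 0 := by
  have hz0 : z ≠ 0 := fun h => hz (by rw [h, Complex.zero_re])
  set s := ofHInf φ * ofHInf φ
  set v := hessian c φ w
  -- The symbol of J vanishes at n = 0, so z times the mean of w is 0.
  have e1 : inner ℂ (vec 1) w = 0 := by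
    have h1 := hw 0
    rw [symbolJ_zero, zero_mul] at h1
    change inner ℂ (toL2 (oneHInf L)) w = 0
    rw [inner_one]
    exact (mul_eq_zero.mp h1.symm).resolve_left hz0
  -- By skewness of J, z(φ², w) = -(Jφ², 𝓛w) = 2c(φ', 𝓛w) = 2c(𝓛φ', w) = 0.
  have e2 : inner ℂ (vec s) w = 0 := by
    have h1 := (hasSum_inner (vec s) w).mul_left z
    have h2 := (hasSum_inner (vec (derivPer L (ofHInf φ))) v).mul_left (2 * c : ℂ)
    rw [← inner_hessian, hessian_deriv_wave hc h, inner_zero_left, mul_zero] at h2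
    refine (mul_eq_zero.mp (h1.unique ?_)).resolve_left hz0
    refine (congrArg (HasSum · (0 : ℂ)) (funext fun n => ?_)).mp h2
    have h3 := congrArg star (symbolJ_mul_coeff_sq hc h n)
    have h4 : star (c : ℂ) = c := Complex.conj_ofReal c
    have h5 : star (2 : ℂ) = 2 := map_ofNat (starRingEnd ℂ) 2
    rw [star_mul, star_mul, star_symbolJ, star_neg, star_mul, h4, h5] at h3
    change star (coeff (vec s) n) * _ = _ at h3
    rw [mul_left_comm z, ← hw n]
    linear_combination coeff v n * h3
  -- The number z(𝓛w, w) = (𝓛w, J𝓛w) is imaginary and (𝓛w, w) is real, while Re z ≠ 0.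
  have e3 : inner ℂ v w = 0 := by
    have h1 := (hasSum_inner v w).mul_left z
    have h2 : (z * inner ℂ v w).re = 0 := by
      refine (Complex.hasSum_re h1).unique ?_
      convert hasSum_zero using 2 with n
      rw [mul_left_comm, ← hw n]
      have h3 := congrArg Complex.re (star_symbolJ (L := L) n)
      rw [Complex.star_def, Complex.conj_re, Complex.neg_re] at h3
      rw [mul_left_comm, Complex.star_def, mul_comm ((starRingEnd ℂ) _), Complex.mul_conj,
        Complex.re_mul_ofReal, mul_eq_zero]
      left
      linarith
    have h3 : (inner ℂ v w).im = 0 := by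
      have h4 : starRingEnd ℂ (inner ℂ v w) = inner ℂ v w := by
        rw [inner_conj_symm]
        exact (inner_hessian c φ w w).symm
      exact Complex.conj_eq_iff_im.mp h4
    rw [Complex.mul_re, h3, mul_zero, sub_zero] at h2
    exact Complex.ext ((mul_eq_zero.mp h2).resolve_left hz) h3
  -- The form is nonnegative on the constrained space and vanishes at w, so 𝓛w is orthogonal to that
  -- space; the span is closed, being finite-dimensional.
  have e4 : v ∈ Submodule.span ℂ {vec 1, vec s} := by
    have : FiniteDimensional ℂ (Submodule.span ℂ {vec 1, vec s} : Submodule ℂ (L2per L)) :=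
      FiniteDimensional.span_of_finite ℂ (toFinite _)
    rw [← Submodule.orthogonal_orthogonal (Submodule.span ℂ {vec 1, vec s})]
    have hmem : ∀ {u : L2per L}, u ∈ (Submodule.span ℂ {vec 1, vec s})ᗮ ↔
        inner ℂ (vec 1) u = 0 ∧ inner ℂ (vec s) u = 0 := by
      intro u
      rw [Submodule.mem_orthogonal]
      constructor
      · intro hu
        exact ⟨hu _ (Submodule.subset_span (by simp)), hu _ (Submodule.subset_span (by simp))⟩
      · rintro ⟨h1, h2⟩ y hy
        obtain ⟨α, β, rfl⟩ := Submodule.mem_span_pair.mp hy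
        rw [inner_add_left, inner_smul_left, inner_smul_left, h1, h2, mul_zero, mul_zero, add_zero]
    exact inner_hessian_eq_zero (fun u hu => hQ u (hmem.mp hu).1 (hmem.mp hu).2)
      (hmem.mpr ⟨e1, e2⟩) e3
  obtain ⟨α, β, hv⟩ := Submodule.mem_span_pair.mp e4
  -- Applying J: it kills 1 and maps φ² to -2cφ'.
  have e5 : w = (-(2 * c * β) / z) • vec (derivPer L (ofHInf φ)) := by
    refine coeff_ext fun n => mul_left_cancel₀ hz0 ?_
    rw [← hw n, ← hv, coeff_add, coeff_smul, coeff_smul, coeff_smul]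
    have h1 : symbolJ L n * coeff (vec (1 : smoothPer L)) n = 0 := by
      by_cases hn : n = 0
      · rw [hn, symbolJ_zero, zero_mul]
      · rw [coeff_vec_one hn, mul_zero]
    have h2 : symbolJ L n * coeff (vec s) n = _ := symbolJ_mul_coeff_sq hc h n
    rw [mul_add, mul_left_comm, h1, mul_left_comm, h2]
    field_simp
    ring
  have e6 : v = 0 := by
    change hessian c φ w = 0
    rw [e5, map_smul, hessian_deriv_wave hc h, smul_zero]
  refine coeff_ext fun n => mul_left_cancel₀ hz0 ?_
  rw [← hw n, e6, coeff_zero, mul_zero, mul_zero]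

end Kernel

/-! ## The resolvent of the linearized operator -/

theorem symbolD_ne {L : ℝ} (n : ℤ) : symbolD L n ≠ 0 := inv_ne_zero (one_add_ne n)

section Resolvent

variable {L : ℝ} [Fact (0 < L)] {c : ℝ} {φ : HInfPer L}

/-- The bounded operator `(1 + ∂ₓ)⁻¹`. -/
def resolventD (L : ℝ) [Fact (0 < L)] : L2per L →L[ℂ] L2per L :=
  multiplier (symbolD L) 1 norm_symbolD_le

theorem coeff_resolventD (f : L2per L) (n : ℤ) :
    coeff (resolventD L f) n = symbolD L n * coeff f n := coeff_multiplier _ _ _ f n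

/-- The operator `(1 + ∂ₓ)⁻¹ (J𝓛 - z)`, which is bounded. -/
def regularizedOp (c : ℝ) (φ : HInfPer L) (z : ℂ) : L2per L →L[ℂ] L2per L :=
  multiplier (symbolE L) 4 norm_symbolE_le ∘L hessianCLM c φ - hessianCLM c φ -
    z • resolventD L

theorem coeff_regularizedOp (z : ℂ) (w : L2per L) (n : ℤ) :
    coeff (regularizedOp c φ z w) n =
      symbolD L n * (symbolJ L n * coeff (hessian c φ w) n - z * coeff w n) := by
  have h : symbolE L n - 1 = symbolD L n * symbolJ L n := (symbolD_mul_symbolJ n).symm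
  change coeff (multiplier (symbolE L) 4 norm_symbolE_le (hessian c φ w) - hessian c φ w -
    z • resolventD L w) n = _
  rw [coeff_sub, coeff_sub, coeff_smul, coeff_multiplier, coeff_resolventD]
  linear_combination coeff (hessian c φ w) n * h

theorem coeff_opJ (v : (opJ L).domain) (n : ℤ) :
    coeff (opJ L v) n = symbolJ L n * coeff (v : L2per L) n := by
  change fourierBasis.repr (fourierBasis.repr.symm _) n = _
  rw [LinearIsometryEquiv.apply_symm_apply]
  rfl

theorem hessian_mem_domain (w : (linearizedOp c φ).domain) :
    hessian c φ (w : L2per L) ∈ (opJ L).domain := w.2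

/-- The Hessian operator as a map from the domain of the linearized operator to the domain of
`J`. -/
def hessianRestrict (c : ℝ) (φ : HInfPer L) :
    (opJ L).domain.comap (hessian c φ) →ₗ[ℂ] (opJ L).domain :=
  LinearMap.codRestrict _ (hessian c φ ∘ₗ Submodule.subtype _) fun w => w.2

theorem hessianRestrict_apply (w : (linearizedOp c φ).domain) :
    hessianRestrict c φ w = ⟨hessian c φ (w : L2per L), hessian_mem_domain w⟩ := rfl

theorem linearizedOp_toFun (w : (linearizedOp c φ).domain) :
    (linearizedOp c φ).toFun w = ((opJ L).toFun ∘ₗ hessianRestrict c φ) w := rfl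

theorem linearizedOp_apply (w : (linearizedOp c φ).domain) :
    linearizedOp c φ w = opJ L ⟨hessian c φ (w : L2per L), hessian_mem_domain w⟩ :=
  (linearizedOp_toFun w).trans ((LinearMap.comp_apply _ _ _).trans
    (congrArg (opJ L).toFun (hessianRestrict_apply w)))

theorem coeff_linearizedOp (w : (linearizedOp c φ).domain) (n : ℤ) :
    coeff (linearizedOp c φ w) n = symbolJ L n * coeff (hessian c φ (w : L2per L)) n := by
  rw [linearizedOp_apply, coeff_opJ]

/-- If the regularized operator has a bounded inverse, then `z` is in the resolvent set. -/
theorem mem_resolventSetOf {z : ℂ} {S : L2per L →L[ℂ] L2per L}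
    (h1 : ∀ f, regularizedOp c φ z (S f) = f) (h2 : ∀ f, S (regularizedOp c φ z f) = f) :
    z ∈ resolventSetOf (linearizedOp c φ) := by
  refine ⟨S ∘L resolventD L, fun f => ?_, fun w => ?_⟩
  · set w := S (resolventD L f)
    -- The symbol of (1 + ∂ₓ)⁻¹ has no zeros, so it can be cancelled mode by mode. The resulting
    -- identity also shows that w lies in the domain.
    have hw : ∀ n, symbolJ L n * coeff (hessian c φ w) n = coeff (z • w + f) n := by
      intro n
      have h3 : coeff (regularizedOp c φ z w) n = coeff (resolventD L f) n := by
        rw [h1 (resolventD L f)]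
      rw [coeff_regularizedOp, coeff_resolventD] at h3
      have h4 := mul_left_cancel₀ (symbolD_ne n) h3
      rw [coeff_add, coeff_smul]
      linear_combination h4
    have hdom : w ∈ (linearizedOp c φ).domain := by
      change Memℓp (fun n => symbolJ L n * coeff (hessian c φ w) n) 2
      rw [funext hw]
      exact lp.memℓp (fourierBasis.repr (z • w + f))
    refine ⟨hdom, coeff_ext fun n => ?_⟩
    change coeff (linearizedOp c φ ⟨w, hdom⟩ - z • w) n = _
    rw [coeff_sub, coeff_linearizedOp, hw, coeff_add]
    ring
  · change S (resolventD L (linearizedOp c φ w - z • (w : L2per L))) = w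
    rw [← h2 w]
    congr 1
    refine coeff_ext fun n => ?_
    rw [coeff_resolventD, coeff_regularizedOp, coeff_sub, coeff_smul, coeff_linearizedOp, h2]

/-- The linearized operator has only point spectrum. -/
theorem mem_resolventSetOf_of_injective (hφ : ∀ x, φ x < c) {z : ℂ}
    (hinj : ∀ w : L2per L, (∀ n, symbolJ L n * coeff (hessian c φ w) n = z * coeff w n) → w = 0) :
    z ∈ resolventSetOf (linearizedOp c φ) := by
  have hL : (0 : ℝ) < L := Fact.out
  set g : C(AddCircle L, ℂ) := ContinuousMap.const _ (c : ℂ) - φ.onCircle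
  have hg : ∀ y, g y ≠ 0 := by
    intro y
    induction y using QuotientAddGroup.induction_on with
    | H x =>
      change (c : ℂ) - (φ x : ℂ) ≠ 0
      rw [← Complex.ofReal_sub, Complex.ofReal_ne_zero]
      linarith [hφ x]
  set g' : C(AddCircle L, ℂ) := ⟨fun y => (g y)⁻¹, g.continuous.inv₀ hg⟩
  have hgg : g * g' = 1 := by
    ext y
    exact mul_inv_cancel₀ (hg y)
  have hM1 : ∀ w : L2per L, mulCLM g (mulCLM g' w) = w := fun w => by
    change mulOp g (mulOp g' w) = w
    rw [mulOp_mulOp, hgg, mulOp_one]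
  have hM2 : ∀ w : L2per L, mulCLM g' (mulCLM g w) = w := fun w => by
    change mulOp g' (mulOp g w) = w
    rw [mulOp_mulOp, mul_comm, hgg, mulOp_one]
  set R : L2per L →L[ℂ] L2per L := multiplier (invSymbol L) 1 norm_invSymbol_le
  set E : L2per L →L[ℂ] L2per L := multiplier (symbolE L) 4 norm_symbolE_le
  have hR : IsCompactOperator R := isCompactOperator_multiplier _ (tendsto_invSymbol hL)
  have hE : IsCompactOperator E := isCompactOperator_multiplier _ (tendsto_symbolE hL)
  have hD : IsCompactOperator (resolventD L) :=
    isCompactOperator_multiplier _ (tendsto_symbolD hL)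
  -- All terms of the regularized operator except the multiplication by -(c - φ) are compact.
  set K : L2per L →L[ℂ] L2per L := (3 * c : ℂ) • R + E ∘L hessianCLM c φ - z • resolventD L
  have hK : IsCompactOperator K :=
    ((hR.smul (3 * c : ℂ)).add (hE.comp_clm (hessianCLM c φ))).sub (hD.smul z)
  set T : L2per L →L[ℂ] L2per L := mulCLM g' ∘L K
  have hT : IsCompactOperator T := hK.clm_comp (mulCLM g')
  -- Since c - φ is bounded away from 0, it factors out and leaves the identity minus a compact
  -- operator.
  have hQ : ∀ w, regularizedOp c φ z w = -(mulCLM g (w - T w)) := by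
    intro w
    rw [map_sub]
    change _ = -(mulCLM g w - mulCLM g (mulCLM g' (K w)))
    rw [hM1]
    have h1 : hessianCLM c φ w = mulCLM g w - (3 * c : ℂ) • R w := rfl
    change E (hessianCLM c φ w) - hessianCLM c φ w - z • resolventD L w =
      -(mulCLM g w - ((3 * c : ℂ) • R w + E (hessianCLM c φ w) - z • resolventD L w))
    generalize E (hessianCLM c φ w) = e
    rw [h1]
    abel
  -- The Fredholm alternative: a fixed vector of T would solve the eigenvalue equation.
  have hres : (1 : ℂ) ∈ resolventSet ℂ T := by
    refine (hT.hasEigenvalue_or_mem_resolventSet one_ne_zero).resolve_left fun hev => ?_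
    obtain ⟨w, hw⟩ := hev.exists_hasEigenvector
    refine hw.2 (hinj w fun n => ?_)
    have h1 : T w = w := by
      have := hw.apply_eq_smul
      rwa [one_smul] at this
    have h2 := coeff_regularizedOp (c := c) (φ := φ) z w n
    rw [hQ, h1, sub_self, map_zero, neg_zero, coeff_zero] at h2
    exact sub_eq_zero.mp ((mul_eq_zero.mp h2.symm).resolve_left (symbolD_ne n))
  obtain ⟨S, hS1, hS2⟩ := isUnit_iff_exists.mp hres
  rw [map_one] at hS1 hS2
  have e1 : ∀ w, S w - T (S w) = w := fun w => by
    simpa using congrArg (fun A : L2per L →L[ℂ] L2per L => A w) hS1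
  have e2 : ∀ w, S (w - T w) = w := fun w => by
    simpa using congrArg (fun A : L2per L →L[ℂ] L2per L => A w) hS2
  refine mem_resolventSetOf (S := -(S ∘L mulCLM g')) (fun f => ?_) fun f => ?_
  · change regularizedOp c φ z (-(S (mulCLM g' f))) = f
    rw [map_neg, hQ, neg_neg, e1, hM1]
  · change -(S (mulCLM g' (regularizedOp c φ z f))) = f
    rw [hQ, map_neg, hM2, map_neg, neg_neg, e2]

/-- A wave satisfying the criterion on the variations of mass and energy is spectrally stable. -/
theorem spectrallyStable_of_isProfile {a b β : ℝ} {φ₁ ψ₁ : ℝ → ℝ} {ψ : HInfPer L} (hc : 0 < c)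
    (h : IsProfile c a b L φ φ₁) (hψ : IsVariation c a 1 β φ φ₁ ψ ψ₁) (hpos : ∀ x, 0 < φ x)
    (hβ : β ≠ 0)
    (hratio : (∫ x in (0 : ℝ)..L, φ x ^ 2 * ψ x) * mass φ - 6 * energy φ * mass ψ ≤ 0)
    (hmass : β < 0 → 0 ≤ mass ψ)
    (hhill : 0 < β → ∃ η η₁, IsVariation c a 1 0 φ φ₁ η η₁ ∧ η 0 < 0 ∧ η₁ 0 = 0 ∧
      0 ≤ η₁ (L / 2)) : SpectrallyStable c φ := by
  have hL : (0 : ℝ) < L := Fact.out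
  have hM : 0 < integralPer L (ofHInf φ) :=
    intervalIntegral.intervalIntegral_pos_of_pos (φ.smooth.continuous.intervalIntegrable _ _)
      hpos hL
  have e1 : integralPer L (ofHInf φ * ofHInf φ * ofHInf ψ) =
      ∫ x in (0 : ℝ)..L, φ x ^ 2 * ψ x := by
    refine intervalIntegral.integral_congr fun x _ => ?_
    change φ x * φ x * ψ x = φ x ^ 2 * ψ x
    ring
  have e2 : integralPer L (ofHInf φ * ofHInf φ * ofHInf φ) = 6 * energy φ := by
    rw [energy, ← mul_assoc, show (6 : ℝ) * (1 / 6) = 1 by norm_num, one_mul]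
    refine intervalIntegral.integral_congr fun x _ => ?_
    change φ x * φ x * φ x = φ x ^ 3
    ring
  intro z hz
  by_contra hre
  refine hz (mem_resolventSetOf_of_injective h.lt fun w hw => ?_)
  refine eq_zero_of_eigenvector hc h (fun v h1 h2 => re_inner_hessian_nonneg
    (fun f h3 h4 => ?_) h1 h2) hre hw
  refine hessianForm_nonneg (φ := ofHInf φ) (ψ := ofHInf ψ) hc hL h hψ hpos hβ hM ?_ hmass hhill
    h3 h4
  rw [e1, e2]
  exact hratio

end Resolvent

/-! ## The curve of waves -/

theorem hasDerivAt_intervalIntegral {I : Set ℝ} (hI : IsOpen I) {G : ℝ × ℝ → ℝ}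
    (hG : ContDiffOn ℝ ∞ G (I ×ˢ univ)) (α β : ℝ) {a : ℝ} (ha : a ∈ I) :
    HasDerivAt (fun s => ∫ x in α..β, G (s, x)) (∫ x in α..β, dirDeriv (1, 0) G (a, x)) a := by
  have h1 := (hasFDerivAt_intervalIntegral hI hG α β ha).hasDerivAt
  have h2 : Continuous fun x => fderivFst G (a, x) :=
    (contDiffOn_fderivFst hI hG).continuousOn.comp_continuous (by fun_prop)
      fun t => ⟨ha, mem_univ _⟩
  rw [ContinuousLinearMap.intervalIntegral_apply (h2.intervalIntegrable _ _)] at h1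
  exact h1

/-- Strict monotonicity gives only a weak sign of the derivative. This is why the index argument has
to cope with a degenerate Gram matrix. -/
theorem StrictDecrNear.deriv_nonpos {f : ℝ → ℝ} {a d : ℝ} (h : StrictDecrNear f a)
    (hd : HasDerivAt f d a) : d ≤ 0 := by
  obtain ⟨δ, hδ, hf⟩ := h
  have hmem : a ∈ Ioo (a - δ) (a + δ) := ⟨by linarith, by linarith⟩
  rw [← hd.deriv, ← derivWithin_of_isOpen isOpen_Ioo hmem]
  exact hf.antitoneOn.derivWithin_nonpos

theorem StrictIncrNear.deriv_nonneg {f : ℝ → ℝ} {a d : ℝ} (h : StrictIncrNear f a)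
    (hd : HasDerivAt f d a) : 0 ≤ d := by
  obtain ⟨δ, hδ, hf⟩ := h
  have hmem : a ∈ Ioo (a - δ) (a + δ) := ⟨by linarith, by linarith⟩
  rw [← hd.deriv, ← derivWithin_of_isOpen isOpen_Ioo hmem]
  exact hf.monotoneOn.derivWithin_nonneg

/-- The waves of period `L` as a function of `(a, x)`. -/
def waveSheet (c L : ℝ) (p : ℝ × ℝ) : ℝ := wave c (orbitOf c L p.1, p.2)

section Sheet

variable {c L a : ℝ}

theorem contDiffOn_waveSheet (hc : 0 < c) (hL : 0 < L) :
    ContDiffOn ℝ ∞ (waveSheet c L) (Ioo 0 (aMax c L) ×ˢ univ) := by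
  refine (contDiffOn_wave c).comp (((contDiffOn_orbitOf hc hL).comp contDiffOn_fst
    fun p hp => hp.1).prodMk contDiffOn_snd) fun p hp => ⟨orbitOf_mem hc hL hp.1, mem_univ _⟩

theorem waveSheet_periodic (hc : 0 < c) (hL : 0 < L) (ha : a ∈ Ioo 0 (aMax c L)) (x : ℝ) :
    waveSheet c L (a, x + L) = waveSheet c L (a, x) := by
  have := wave_add_period c (orbitOf_mem hc hL ha) x
  rwa [period_orbitOf hc hL ha] at this

theorem contDiff_slice {I : Set ℝ} {G : ℝ × ℝ → ℝ} (hG : ContDiffOn ℝ ∞ G (I ×ˢ univ))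
    (ha : a ∈ I) : ContDiff ℝ ∞ fun x => G (a, x) := by
  rw [← contDiffOn_univ]
  exact hG.comp (contDiffOn_const.prodMk contDiffOn_id) fun x _ => ⟨ha, mem_univ _⟩

open Classical in
/-- The wave of period `L` with parameter `a`. -/
def waveOf (c L : ℝ) (hc : 0 < c) (hL : 0 < L) (a : ℝ) : HInfPer L :=
  if ha : a ∈ Ioo 0 (aMax c L) then
    ⟨fun x => waveSheet c L (a, x), contDiff_slice (contDiffOn_waveSheet hc hL) ha,
      waveSheet_periodic hc hL ha⟩
  else oneHInf L

open Classical in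
/-- The derivative in `a` of the wave of period `L` with parameter `a`. -/
def waveOf₁ (c L : ℝ) (hc : 0 < c) (hL : 0 < L) (a : ℝ) : HInfPer L :=
  if ha : a ∈ Ioo 0 (aMax c L) then
    ⟨fun x => dirDeriv (1, 0) (waveSheet c L) (a, x),
      contDiff_slice (contDiffOn_dirDeriv (isOpen_Ioo.prod isOpen_univ)
        (contDiffOn_waveSheet hc hL) (1, 0)) ha, fun x => by
      have h1 := hasDerivAt_fst_dirDeriv isOpen_Ioo (contDiffOn_waveSheet hc hL) ha (x + L)
      have h2 := hasDerivAt_fst_dirDeriv isOpen_Ioo (contDiffOn_waveSheet hc hL) ha x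
      refine h1.unique (h2.congr_of_eventuallyEq ?_)
      filter_upwards [isOpen_Ioo.mem_nhds ha] with s hs
      exact waveSheet_periodic hc hL hs x⟩
  else oneHInf L

theorem waveOf_apply (hc : 0 < c) (hL : 0 < L) (ha : a ∈ Ioo 0 (aMax c L)) (x : ℝ) :
    waveOf c L hc hL a x = waveSheet c L (a, x) := by
  rw [waveOf, dif_pos ha]

theorem waveOf₁_apply (hc : 0 < c) (hL : 0 < L) (ha : a ∈ Ioo 0 (aMax c L)) (x : ℝ) :
    waveOf₁ c L hc hL a x = dirDeriv (1, 0) (waveSheet c L) (a, x) := by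
  rw [waveOf₁, dif_pos ha]

theorem hasDerivAt_mass_waveOf (hc : 0 < c) (hL : 0 < L) (ha : a ∈ Ioo 0 (aMax c L)) :
    HasDerivAt (fun s => mass (waveOf c L hc hL s)) (mass (waveOf₁ c L hc hL a)) a := by
  have h1 := hasDerivAt_intervalIntegral isOpen_Ioo (contDiffOn_waveSheet hc hL) 0 L ha
  simp only [← waveOf₁_apply hc hL ha] at h1
  refine h1.congr_of_eventuallyEq ?_
  filter_upwards [isOpen_Ioo.mem_nhds ha] with s hs
  simp only [mass, waveOf_apply hc hL hs]

theorem hasDerivAt_energy_waveOf (hc : 0 < c) (hL : 0 < L) (ha : a ∈ Ioo 0 (aMax c L)) :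
    HasDerivAt (fun s => energy (waveOf c L hc hL s))
      (1 / 2 * ∫ x in (0 : ℝ)..L, waveOf c L hc hL a x ^ 2 * waveOf₁ c L hc hL a x) a := by
  have hG : ContDiffOn ℝ ∞ (fun p => waveSheet c L p ^ 3) (Ioo 0 (aMax c L) ×ˢ univ) :=
    (contDiffOn_waveSheet hc hL).pow 3
  have h1 := (hasDerivAt_intervalIntegral isOpen_Ioo hG 0 L ha).const_mul (1 / 6)
  have h2 : ∀ x, dirDeriv (1, 0) (fun p => waveSheet c L p ^ 3) (a, x) =
      3 * (waveOf c L hc hL a x ^ 2 * waveOf₁ c L hc hL a x) := by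
    intro x
    have h3 := (hasDerivAt_fst_dirDeriv isOpen_Ioo (contDiffOn_waveSheet hc hL) ha x).pow 3
    rw [(hasDerivAt_fst_dirDeriv isOpen_Ioo hG ha x).unique h3, waveOf_apply hc hL ha,
      waveOf₁_apply hc hL ha]
    push_cast
    ring
  simp only [h2] at h1
  rw [intervalIntegral.integral_const_mul, ← mul_assoc,
    show (1 / 6 * 3 : ℝ) = 1 / 2 by norm_num] at h1
  refine h1.congr_of_eventuallyEq ?_
  filter_upwards [isOpen_Ioo.mem_nhds ha] with s hs
  simp only [energy, waveOf_apply hc hL hs]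

/-- The tangent v of the curve in the (k, r)-plane has δa = 1, δT = 0 and δb = B', so ∂ₐφ is an
L-periodic variation of the wave, as the index argument requires. -/
theorem spectrallyStable_waveOf [Fact (0 < L)] (hc : 0 < c) (hL : 0 < L)
    (ha : a ∈ Ioo 0 (aMax c L)) (hB : deriv (fun s => bOf c (orbitOf c L s)) a ≠ 0)
    (hratio : StrictDecrNear
      (fun s => energy (waveOf c L hc hL s) / mass (waveOf c L hc hL s) ^ 3) a)
    (hmass : deriv (fun s => bOf c (orbitOf c L s)) a < 0 →
      StrictIncrNear (fun s => mass (waveOf c L hc hL s)) a) :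
    SpectrallyStable c (waveOf c L hc hL a) := by
  have hq := orbitOf_mem hc hL ha
  have hr := orbitOf_pos hc hL ha
  have hT := period_orbitOf hc hL ha
  have hnear : ∀ᶠ s in 𝓝 a, s ∈ Ioo 0 (aMax c L) := isOpen_Ioo.mem_nhds ha
  have hv : HasDerivAt (orbitOf c L) (deriv (orbitOf c L) a) a :=
    (((contDiffOn_orbitOf hc hL).contDiffAt (isOpen_Ioo.mem_nhds ha)).differentiableAt
      (by simp)).hasDerivAt
  set q := orbitOf c L a
  set v := deriv (orbitOf c L) a
  have hqa : aOf c q.1 = a := aOf_kOf hc hL ha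
  have hva : -(c ^ 4 * (3 * q.1 - 1) / (1 + q.1) ^ 5) * v.1 = 1 := by
    have h1 : HasDerivAt (fun s => (orbitOf c L s).1) v.1 a := hv.fst
    have h2 := (hasDerivAt_aOf c (lt_of_mem_ampRange (k := q.1) (s := q.2) hq.1)).comp a h1
    refine h2.unique ((hasDerivAt_id a).congr_of_eventuallyEq ?_)
    filter_upwards [hnear] with s hs
    exact aOf_kOf hc hL hs
  have hvb : deriv (fun s => bOf c (orbitOf c L s)) a = dirDeriv v (bOf c) q :=
    (hasDerivAt_comp_curve isOpen_orbitDomain (contDiffOn_bOf c) hv hq).deriv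
  have hvT : dirDeriv v period q = 0 := by
    refine (hasDerivAt_comp_curve isOpen_orbitDomain contDiffOn_period hv hq).unique
      ((hasDerivAt_const a L).congr_of_eventuallyEq ?_)
    filter_upwards [hnear] with s hs
    exact period_orbitOf hc hL hs
  have eφ : (waveOf c L hc hL a).toFun = fun x => wave c (q, x) :=
    funext (waveOf_apply hc hL ha)
  have eψ : (waveOf₁ c L hc hL a).toFun = fun x => dirDeriv (v, 0) (wave c) (q, x) := by
    refine funext fun x => (waveOf₁_apply hc hL ha x).trans ?_
    refine (hasDerivAt_fst_dirDeriv isOpen_Ioo (contDiffOn_waveSheet hc hL) ha x).unique ?_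
    exact hasDerivAt_comp_curve isOpen_phaseDomain (contDiffOn_wave c)
      (hv.prodMk (hasDerivAt_const a x)) ⟨hq, mem_univ _⟩
  have hp := isProfile_wave hc hq hr
  have hvar := isVariation_wave hc hq v
  rw [hqa, hT, ← eφ] at hp
  rw [hqa, hva, ← hvb, ← eφ, ← eψ] at hvar
  have hM : 0 < mass (waveOf c L hc hL a) := mass_pos hc hL hq (waveOf_apply hc hL ha)
  have hdM := hasDerivAt_mass_waveOf hc hL ha
  refine spectrallyStable_of_isProfile hc hp hvar (fun x => ?_) hB ?_
    (fun h => (hmass h).deriv_nonneg hdM) fun h => ?_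
  · rw [eφ]
    exact wave_pos hc hq x
  -- With ψ = ∂ₐφ, the derivative of F/M³ is (M ∮ φ²ψ - 6 F M')/(2M⁴), and 6F = ∮ φ³.
  · have h1 := hratio.deriv_nonpos ((hasDerivAt_energy_waveOf hc hL ha).div (hdM.pow 3)
      (pow_ne_zero 3 hM.ne'))
    set M := mass (waveOf c L hc hL a)
    rw [show ∀ x y z : ℝ, (1 / 2 * x * M ^ 3 - y * (((3 : ℕ) : ℝ) * M ^ (3 - 1) * z)) / (M ^ 3) ^ 2 =
      (x * M - 6 * y * z) / (2 * M ^ 4) by intro x y z; push_cast; field_simp; ring] at h1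
    by_contra! hlt
    exact absurd h1 (not_le.2 (div_pos hlt (by positivity)))
  · rw [hvb] at h
    obtain ⟨η, η₁, h1, h2, h3, h4⟩ := exists_isVariation hc hq hr hva hvT h
    rw [hqa, ← eφ] at h1
    rw [hT] at h4
    exact ⟨η, η₁, h1, h2, h3, h4⟩

end Sheet

end DP

end

theorem theorem2 (c : ℝ) (hc : 0 < c) :
    ∃ U : Set (ℝ × ℝ), IsOpen U ∧ DP.constantWaveBoundary c ⊆ U ∧
      ∀ (L : ℝ) [Fact (0 < L)],
        ∃ aL ∈ Ioo 0 (27 / 256 * c ^ 4), ∃ (B : ℝ → ℝ) (Φ : ℝ → DP.HInfPer L),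
          -- the curve `b = B a` and the waves along it
          ContDiffOn ℝ 1 B (Ioo 0 aL) ∧
          DP.IsC1HInf (Ioo 0 aL) Φ ∧
          (∀ a ∈ Ioo 0 aL, DP.IsWave c a (B a) L (Φ a)) ∧
          -- the curve ends on the boundary of constant waves
          (∃ bL, (aL, bL) ∈ DP.constantWaveBoundary c ∧ Tendsto B (𝓝[<] aL) (𝓝 bL)) ∧
          -- the stability criterion
          (∀ a ∈ Ioo 0 aL, deriv B a ≠ 0 →
            DP.StrictDecrNear (fun s => DP.energy (Φ s) / DP.mass (Φ s) ^ 3) a →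
            (deriv B a < 0 → DP.StrictIncrNear (fun s => DP.mass (Φ s)) a) →
            DP.SpectrallyStable c (Φ a)) ∧
          -- the criterion holds in a neighbourhood of the boundary of constant waves
          (∀ a ∈ Ioo 0 aL, (a, B a) ∈ U →
            DP.StrictDecrNear (fun s => DP.energy (Φ s) / DP.mass (Φ s) ^ 3) a ∧
            DP.StrictIncrNear (fun s => DP.mass (Φ s)) a) := by
  refine ⟨DP.monotoneSet c, isOpen_interior, DP.boundary_subset_monotoneSet hc, fun L hL' => ?_⟩
  have hL : (0 : ℝ) < L := Fact.out
  refine ⟨DP.aMax c L, DP.aMax_mem hc hL, fun a => DP.bOf c (DP.orbitOf c L a),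
    DP.waveOf c L hc hL, (DP.contDiffOn_bOf_orbitOf hc hL).of_le (by exact_mod_cast le_top), ?_, ?_,
    ⟨_, DP.boundary_mem hc (DP.kMin_gt hL), DP.tendsto_bOf_orbitOf hc hL⟩, ?_, ?_⟩
  · exact DP.isC1HInf_of_contDiffOn hL isOpen_Ioo (DP.contDiffOn_waveSheet hc hL)
      (fun a ha => DP.waveOf_apply hc hL ha) fun a ha => DP.waveOf₁_apply hc hL ha
  · intro a ha
    have h := DP.isWave_of_orbit hc (DP.orbitOf_mem hc hL ha) (DP.orbitOf_pos hc hL ha)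
      (DP.period_orbitOf hc hL ha) (DP.waveOf_apply hc hL ha)
    rwa [show (DP.orbitOf c L a).1 = DP.kOf c a from rfl, DP.aOf_kOf hc hL ha] at h
  · exact fun a ha hB hratio hmass => DP.spectrallyStable_waveOf hc hL ha hB hratio hmass
  · exact fun a ha hU => DP.monotone_near hc hL (fun a ha => DP.waveOf_apply hc hL ha) ha hU
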